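/- **Setting.** Let $I(t)=\tfrac12[(1-t)\log(1-t)+(1+t)\log(1+t)]$ and $\rho(t)=\sqrt{2(\log 2-I(t))}$ for $t\in[-1,1]$ (with $0\log 0=0$). For $h\ge 0$ let $M(h)=\max_{t\in[-1,1]}(\rho(t)+ht)$, let $t_*(h)$ be the unique maximizer, and for $N\in\mathbb N$ put, with $t_*=t_*(h)$, $$A_N(h)=\big(\rho(t_*)\sqrt N\big)^{-1},\qquad B_N(h)=M(h)\sqrt N+\frac{A_N(h)}2\log\frac{A_N(h)^2}{2\pi(1-t_*^2)\,(I''(t_*)+h^2)},\qquad u_{N,h}(x)=A_N(h)x+B_N(h).$$ Let $n\ge 1$, $0=x_0<x_1<\dots<x_n=1$, $0=q_0<q_1<\dots<q_n=1$, and let $\varrho:[0,1]\to[0,1]$ be the right-continuous step function with $\varrho=0$ on $[0,x_1)$, $\varrho=q_k$ on $[x_k,x_{k+1})$ for $1\le k<n$, and $\varrho(1)=1$. Put $\theta_{l,n}=(1-q_{l-1})/(1-x_{l-1})$. For $\sigma,\tau\in\Sigma_N=\{-1,1\}^N$ let $q_L(\sigma,\tau)$ be $1/N$ times the largest $k\in\{0,\dots,N\}$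 such that the first $k$ coordinates of $\sigma$ and $\tau$ coincide. Let $\mathrm{GREM}_N$ be a centered Gaussian process on $\Sigma_N$ with covariance $\mathbb E[\mathrm{GREM}_N(\sigma)\mathrm{GREM}_N(\tau)]=\varrho(q_L(\sigma,\tau))$, and $$X_N(h,\sigma)=\mathrm{GREM}_N(\sigma)+\frac h{\sqrt N}\sum_{i=1}^N\sigma_i .$$ The limit $N\to\infty$ is taken along any sequence of $N$'s tending to infinity with $x_kN\in\mathbb N$ for all $k$. Convergence of random measures on $\mathbb R$ is convergence in law with respect to the vague topology on locally finite measures, and $\mathrm{PPP}(f(x)\,dx)$ is the Poisson point process on $\mathbb R$ with intensity $f(x)\,dx$. **Proposition.** Let $h\ge 0$. 1. If for all $l\in\{2,\dots,n\}$ $$\frac{\log 2-I(t_*(\theta_{l,n}^{-1/2}h))}{\log 2-I(t_*(h))}<\theta_{l,n},$$ then $$\sum_{\sigma\in\Sigma_N}\delta_{u_{N,h}^{-1}(X_N(h,\sigma))}\longrightarrow \mathrm{PPP}(e^{-x}\,dx).$$ 2. If for all $l\in\{2,\dots,n\}$ $$\frac{\log 2-I(t_*(\theta_{l,n}^{-1/2}h))}{\log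 2-I(t_*(h))}\le\theta_{l,n},$$ with equality for at least one $l_0\in\{2,\dots,n\}$, then there is a constant $K=K(\varrho,h)\in(0,1)$, depending only on $\varrho$ and $h$, such that $$\sum_{\sigma\in\Sigma_N}\delta_{u_{N,h}^{-1}(X_N(h,\sigma))}\longrightarrow \mathrm{PPP}(K e^{-x}\,dx).$$ -/

import Mathlib

open MeasureTheory ProbabilityTheory Filter Topology
open scoped CompactlySupported

universe u

noncomputable section

namespace GREM

/-! ### Cramér entropy, the functions `ρ`, `t_*`, `M`, and the REM scaling -/

/-- Cramér's entropy `I(t) = ½ [(1 - t) log (1 - t) + (1 + t) log (1 + t)]` on `[-1, 1]`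
(with `0 log 0 = 0`). -/
def cramerEntropy (t : ℝ) : ℝ :=
  (1 / 2) * ((1 - t) * Real.log (1 - t) + (1 + t) * Real.log (1 + t))

/-- `ρ(t) = √(2 (log 2 - I(t)))`. -/
def rho (t : ℝ) : ℝ := Real.sqrt (2 * (Real.log 2 - cramerEntropy t))

/-- `M(h) = max_{t ∈ [-1, 1]} (ρ(t) + h t)`. -/
def maxM (h : ℝ) : ℝ := sSup ((fun t => rho t + h * t) '' Set.Icc (-1) 1)

lemma continuous_cramerEntropy : Continuous cramerEntropy := by
  have h1 : Continuous fun t : ℝ => (1 - t) * Real.log (1 - t) :=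
    Real.continuous_mul_log.comp (continuous_const.sub continuous_id)
  have h2 : Continuous fun t : ℝ => (1 + t) * Real.log (1 + t) :=
    Real.continuous_mul_log.comp (continuous_const.add continuous_id)
  exact continuous_const.mul (h1.add h2)

lemma continuous_rho : Continuous rho :=
  Real.continuous_sqrt.comp
    (continuous_const.mul (continuous_const.sub continuous_cramerEntropy))

lemma exists_maximizer (h : ℝ) :
    ∃ t ∈ Set.Icc (-1 : ℝ) 1, IsMaxOn (fun s => rho s + h * s) (Set.Icc (-1) 1) t :=
  isCompact_Icc.exists_isMaxOn (Set.nonempty_Icc.2 (by norm_num))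
    (continuous_rho.add (continuous_const.mul continuous_id)).continuousOn

/-- The point `t_*(h) ∈ [-1, 1]` at which `ρ(t) + h t` attains its maximum over `[-1, 1]`
(unique, because `ρ` is strictly concave there). -/
def tStar (h : ℝ) : ℝ := Classical.choose (exists_maximizer h)

lemma tStar_spec (h : ℝ) :
    tStar h ∈ Set.Icc (-1 : ℝ) 1 ∧
      IsMaxOn (fun s => rho s + h * s) (Set.Icc (-1) 1) (tStar h) :=
  Classical.choose_spec (exists_maximizer h)

/-- `A_N(h) = (ρ(t_*) √N)⁻¹`. -/
def scaleA (N : ℕ) (h : ℝ) : ℝ := (rho (tStar h) * Real.sqrt N)⁻¹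

/-- `B_N(h) = M(h) √N + (A_N(h) / 2) log (A_N(h)² / (2 π (1 - t_*²) (I''(t_*) + h²)))`. -/
def scaleB (N : ℕ) (h : ℝ) : ℝ :=
  maxM h * Real.sqrt N + scaleA N h / 2 *
    Real.log (scaleA N h ^ 2 /
      (2 * Real.pi * (1 - tStar h ^ 2) * (iteratedDeriv 2 cramerEntropy (tStar h) + h ^ 2)))

/-- The inverse `u_{N,h}⁻¹` of the REM scaling function `u_{N,h}(x) = A_N(h) x + B_N(h)`. -/
def remScalingInv (N : ℕ) (h : ℝ) (e : ℝ) : ℝ := (e - scaleB N h) / scaleA N h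

/-! ### The discrete order parameter -/

/-- The data `0 = x_0 < x_1 < ⋯ < x_n = 1` and `0 = q_0 < q_1 < ⋯ < q_n = 1` of a piecewise
constant order parameter with `n` jumps (values at indices above `n` are irrelevant). -/
structure OrderParameter (n : ℕ) where
  x : ℕ → ℝ
  q : ℕ → ℝ
  x_zero : x 0 = 0
  x_last : x n = 1
  x_strictMono : StrictMonoOn x (Set.Iic n)
  q_zero : q 0 = 0
  q_last : q n = 1
  q_strictMono : StrictMonoOn q (Set.Iic n)

/-- The function `ϱ : [0, 1] → [0, 1]`, `ϱ = q_k` on `[x_k, x_{k+1})`, `ϱ(1) = q_n = 1`;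
it is written as the sum of its jumps `q_k - q_{k-1}` at the points `x_k`. -/
def OrderParameter.toFun {n : ℕ} (ϱ : OrderParameter n) (s : ℝ) : ℝ :=
  ∑ k ∈ Finset.Icc 1 n, if ϱ.x k ≤ s then ϱ.q k - ϱ.q (k - 1) else 0

/-- The slopes `θ_{j,k} = (q_k - q_{j-1}) / (x_k - x_{j-1})`, `1 ≤ j ≤ k ≤ n`. -/
def OrderParameter.slope {n : ℕ} (ϱ : OrderParameter n) (j k : ℕ) : ℝ :=
  (ϱ.q k - ϱ.q (j - 1)) / (ϱ.x k - ϱ.x (j - 1))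

/-- `(log 2 - I(t_*(θ_{l,n}^{-1/2} h))) / (log 2 - I(t_*(h)))`. -/
def entropyRatio {n : ℕ} (ϱ : OrderParameter n) (h : ℝ) (l : ℕ) : ℝ :=
  (Real.log 2 - cramerEntropy (tStar ((Real.sqrt (ϱ.slope l n))⁻¹ * h))) /
    (Real.log 2 - cramerEntropy (tStar h))

/-! ### The GREM with external field -/

/-- The hypercube `Σ_N = {-1, 1}^N`. -/
abbrev Spins (N : ℕ) : Type := Fin N → ℤˣ

open Classical in
/-- The lexicographic overlap `q_L(σ, τ)`: the largest `k ∈ {0, …, N}` such that the first `k`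
coordinates of `σ` and `τ` agree, divided by `N`. -/
def lexOverlap {N : ℕ} (σ τ : Spins N) : ℝ :=
  (Nat.findGreatest (fun k => ∀ i : Fin N, (i : ℕ) < k → σ i = τ i) N : ℝ) / N

/-- `G` is the GREM process on `Σ_N` with order parameter `ϱ`: a centered Gaussian process with
covariance `E[G(σ) G(τ)] = ϱ(q_L(σ, τ))`. -/
structure IsGREM {n : ℕ} (ϱ : OrderParameter n) {N : ℕ} {Ω : Type*} [MeasurableSpace Ω]
    (G : Spins N → Ω → ℝ) (P : Measure Ω) : Prop where
  gaussian : IsGaussianProcess G P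
  centered : ∀ σ, ∫ ω, G σ ω ∂P = 0
  covariance : ∀ σ τ, ∫ ω, G σ ω * G τ ω ∂P = ϱ.toFun (lexOverlap σ τ)

/-- The energies `X_N(h, σ) = G(σ) + (h / √N) ∑ σ_i`. -/
def energy {N : ℕ} {Ω : Type*} (G : Spins N → Ω → ℝ) (h : ℝ) (σ : Spins N) (ω : Ω) : ℝ :=
  G σ ω + h / Real.sqrt N * ∑ i, (((σ i : ℤˣ) : ℤ) : ℝ)

/-! ### Random measures on `ℝ` and their vague convergence in law -/

/-- Locally finite Borel measures on `ℝ`. -/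
def LocFinMeasure : Type := {μ : Measure ℝ // IsLocallyFiniteMeasure μ}

/-- The vague topology: the coarsest one for which `μ ↦ ∫ φ dμ` is continuous for each
continuous compactly supported `φ`. -/
instance : TopologicalSpace LocFinMeasure :=
  TopologicalSpace.induced (fun μ (φ : C_c(ℝ, ℝ)) => ∫ y, φ y ∂μ.1) inferInstance

instance : MeasurableSpace LocFinMeasure := borel LocFinMeasure

instance : BorelSpace LocFinMeasure := ⟨rfl⟩

lemma isLocallyFinite_sum_dirac {ι : Type*} [Fintype ι] (y : ι → ℝ) :
    IsLocallyFiniteMeasure (∑ i, Measure.dirac (y i)) := by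
  have : IsFiniteMeasure (∑ i, Measure.dirac (y i)) := by infer_instance
  infer_instance

/-- The point measure `∑ i, δ_{y i}` of a finite family of reals. -/
def pointMeasure {ι : Type*} [Fintype ι] (y : ι → ℝ) : LocFinMeasure :=
  ⟨∑ i, Measure.dirac (y i), isLocallyFinite_sum_dirac y⟩

/-- `Λ` is the law of a Poisson point process on `ℝ` with intensity measure `ν`: the number of
points in a Borel set `B` with `ν B < ∞` is Poisson distributed with mean `ν B`, and the numbers
of points in finitely many disjoint Borel sets are independent. -/
structure IsPoissonProcessLaw (ν : Measure ℝ) (Λ : Measure LocFinMeasure) : Prop where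
  count : ∀ B : Set ℝ, MeasurableSet B → ν B ≠ ⊤ →
    HasLaw (fun μ : LocFinMeasure => μ.1 B)
      ((poissonMeasure (ν B).toNNReal).map (Nat.cast : ℕ → ENNReal)) Λ
  indep : ∀ (m : ℕ) (B : Fin m → Set ℝ), (∀ i, MeasurableSet (B i)) →
    Pairwise (fun i j => Disjoint (B i) (B j)) →
    iIndepFun (fun i (μ : LocFinMeasure) => μ.1 (B i)) Λ

/-- The random measures `ξ α` converge in law, with respect to the vague topology, to the Poisson
point process with intensity measure `ν`. -/
def TendstoPPP {Ω : ℕ → Type*} [∀ α, MeasurableSpace (Ω α)] (P : ∀ α, Measure (Ω α))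
    [∀ α, IsProbabilityMeasure (P α)] (ξ : ∀ α, Ω α → LocFinMeasure) (ν : Measure ℝ) : Prop :=
  ∃ (Λ : Measure LocFinMeasure) (_ : IsProbabilityMeasure Λ), IsPoissonProcessLaw ν Λ ∧
    TendstoInDistribution ξ atTop (id : LocFinMeasure → LocFinMeasure) P Λ

/-- The measure `K e^{-y} dy` on `ℝ`. -/
def expIntensity (K : ℝ) : Measure ℝ :=
  volume.withDensity fun y => ENNReal.ofReal (K * Real.exp (-y))

/-- With `PPP(K e^{-y} dy)` as limit: along every sequence of sizes `N_α → ∞` with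
`x_k N_α ∈ ℕ` for all `k`, and for every realization of the GREM process at these sizes, the point
process `∑_σ δ_{u_{N,h}⁻¹(X_N(h, σ))}` of energies under the REM scaling converges in law. -/
def EnergiesTendstoPPP {n : ℕ} (ϱ : OrderParameter n) (h K : ℝ) : Prop :=
  ∀ N : ℕ → ℕ, Tendsto N atTop atTop →
    (∀ α, ∀ k ∈ Finset.Icc 1 n, ∃ j : ℕ, ϱ.x k * N α = j) →
    ∀ (Ω : ℕ → Type u) [∀ α, MeasurableSpace (Ω α)] (P : ∀ α, Measure (Ω α))
      [∀ α, IsProbabilityMeasure (P α)] (G : ∀ α, Spins (N α) → Ω α → ℝ),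
      (∀ α, IsGREM ϱ (G α) (P α)) →
      TendstoPPP P
        (fun α ω => pointMeasure fun σ => remScalingInv (N α) h (energy (G α) h σ ω))
        (expIntensity K)

end GREM

end

/-! Write s(u) = log(2 cosh u) - u tanh u (`spinEntropy`) for the entropy of a spin tilted by u. The
critical β solves s(βh) = β²/2. Young's inequality for I then gives t_*(h) = tanh(βh), ρ(t_*) = β
and M(h) = β + h tanh(βh), so that A_N = 1/(β√N). Since s decreases on [0, ∞), comparing the
critical values at the fields h and θ^{-1/2}h shows that the two sides of the hypothesis for l
compare as 1 and θ_{l,n} do (`slope_comparison`). The hypothesis thus forces q_{l-1} < x_{l-1}, or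
q_{l-1} = x_{l-1} in the case of equality: ϱ stays below the diagonal, and the equality cases are
contacts with it, called tight levels.

The convergence is proved through characteristic functionals. On locally finite measures they
determine convergence in law to a given limit (`tendsto_of_tendsto_charFunctional`), and that of the
Poisson process is explicit (`hasPoissonCharFunctional_poissonLaw`). For the GREM the functional E
∏_σ exp(iφ(u⁻¹(X_σ))) is the value Ψ_0(0) of a backward recursion along the tree of blocks: Ψ_k(s)
is the product, over the configurations v of one block, of the mean of Ψ_{k+1} at s plus the
increment of v (`integral_prod_energy`).

The quantity to follow is D_k(s) = (1 - Ψ_k(s)) exp(-λs + γ_k), with λ = β√N and γ_k = N(x_k -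
q_k)β²/2. Exponential tilting turns the linearized recursion into D_k(s) = ∫ D_{k+1}(s + y) κ_k(dy),
where κ_k is the law of a Gaussian plus a centered field of tilted spins
(`integral_gaussianReal_tilt`). The quadratic error carries the factor exp(λs - γ_k). Off the tight
levels γ_k is of order N and the error is negligible. At a tight level γ_k = 0: the error is
negligible for s < 0, while for s > 0 the trivial bound |D_k(s)| ≤ 2 exp(-λs) makes D_k itself
negligible. In the limit a tight level therefore only multiplies by the indicator of s ≤ 0
(`norm_sub_cutStep_le`, `integral_norm_sub_backward_cutStep_le`). By the central limit theorem and
Scheffé's lemma the κ_k converge in total variation to Gaussians (`exists_tendsto_tiltKernel`). The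
final D is a bump of width A_N with fixed mass √(2πv) ∫ (1 - e^{iφ}) e^{-y} dy, where v = 1 + h²(1 -
t_*²) is the total variance of the limiting walk, so it acts as a point mass at 0.

Hence Ψ_0(0) tends to exp(-K ∫ (1 - e^{iφ}) e^{-y} dy), where K is √(2πv) times the density at 0 of
the Gaussian walk constrained to be nonpositive at the tight levels (`tendsto_genFun`).
Equivalently, K is the probability that the Gaussian bridge from 0 to 0 meets these constraints. It
is 1 without tight levels and lies strictly between 0 and 1 otherwise. -/

noncomputable section

namespace GREM

/-! ### The vague topology -/

lemma continuous_integral_locFin (φ : C_c(ℝ, ℝ)) :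
    Continuous fun μ : LocFinMeasure => ∫ y, φ y ∂μ.1 :=
  (continuous_apply φ).comp
    (continuous_induced_dom (f := fun (μ : LocFinMeasure) (φ : C_c(ℝ, ℝ)) => ∫ y, φ y ∂μ.1))

lemma integrable_cc (φ : C_c(ℝ, ℝ)) (μ : LocFinMeasure) : Integrable φ μ.1 :=
  have := μ.2
  φ.continuous.integrable_of_hasCompactSupport φ.hasCompactSupport

/-- A trapezoidal cutoff: `1` on `[-m, m]` and `0` outside `[-m - 1, m + 1]`. -/
def cutoff (m : ℕ) : C_c(ℝ, ℝ) where
  toFun y := max 0 (min 1 ((m : ℝ) + 1 - |y|))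
  continuous_toFun := by fun_prop
  hasCompactSupport' := by
    refine HasCompactSupport.intro (K := Set.Icc (-((m : ℝ) + 1)) (m + 1)) isCompact_Icc ?_
    intro y hy
    have : (m : ℝ) + 1 < |y| := by
      by_contra h
      exact hy (abs_le.1 (not_lt.1 h))
    have h2 : min 1 ((m : ℝ) + 1 - |y|) ≤ 0 := (min_le_right _ _).trans (by linarith)
    simp [h2]

lemma cutoff_apply (m : ℕ) (y : ℝ) : cutoff m y = max 0 (min 1 ((m : ℝ) + 1 - |y|)) := rfl

lemma cutoff_nonneg (m : ℕ) (y : ℝ) : 0 ≤ cutoff m y := le_max_left _ _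

lemma cutoff_eq_one {m : ℕ} {y : ℝ} (hy : |y| ≤ m) : cutoff m y = 1 := by
  rw [cutoff_apply, min_eq_left (by linarith), max_eq_right zero_le_one]

lemma cutoff_eq_zero {m : ℕ} {y : ℝ} (hy : (m : ℝ) + 1 ≤ |y|) : cutoff m y = 0 := by
  rw [cutoff_apply, max_eq_left]
  exact (min_le_right _ _).trans (by linarith)

/-- The product of a cutoff and a continuous function. -/
def cutoffMul (m : ℕ) (g : C(ℝ, ℝ)) : C_c(ℝ, ℝ) where
  toFun y := cutoff m y * g y
  continuous_toFun := (cutoff m).continuous.mul g.continuous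
  hasCompactSupport' := (cutoff m).hasCompactSupport.mul_right

lemma cutoffMul_apply (m : ℕ) (g : C(ℝ, ℝ)) (y : ℝ) : cutoffMul m g y = cutoff m y * g y := rfl

lemma exists_support_bound (φ : C_c(ℝ, ℝ)) : ∃ m : ℕ, ∀ y, φ y ≠ 0 → |y| ≤ m := by
  obtain ⟨R, hR⟩ := φ.hasCompactSupport.isCompact.isBounded.exists_norm_le
  obtain ⟨m, hm⟩ := exists_nat_ge R
  exact ⟨m, fun y hy => (hR y (subset_tsupport _ hy)).trans hm⟩

/-- The countably many test functions that determine the vague topology. -/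
def testFamily : (ℕ × ℕ) ⊕ ℕ → C_c(ℝ, ℝ)
  | Sum.inl p => cutoffMul p.1 (TopologicalSpace.denseSeq C(ℝ, ℝ) p.2)
  | Sum.inr m => cutoff m

/-- In the compact-open topology the functions that stay δ-close to `f` on `[-r, r]` form an open
neighbourhood of `f`, which the dense sequence has to meet. -/
lemma exists_denseSeq_near (f : C(ℝ, ℝ)) (r : ℝ) {δ : ℝ} (hδ : 0 < δ) :
    ∃ j, ∀ y, |y| ≤ r → |f y - TopologicalSpace.denseSeq C(ℝ, ℝ) j y| < δ := by
  have hopen : IsOpen {g : C(ℝ, ℝ) | Set.MapsTo (fun y => f y - g y) (Set.Icc (-r) r)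
      (Metric.ball 0 δ)} := by
    have h1 := ContinuousMap.isOpen_setOfPred_mapsTo (X := ℝ) (Y := ℝ) (K := Set.Icc (-r) r)
      isCompact_Icc (U := Metric.ball 0 δ) Metric.isOpen_ball
    exact h1.preimage (f := fun g : C(ℝ, ℝ) => f - g) (by fun_prop)
  obtain ⟨j, hj⟩ := (TopologicalSpace.denseRange_denseSeq C(ℝ, ℝ)).exists_mem_open hopen
    ⟨f, fun y _ => by simpa using hδ⟩
  refine ⟨j, fun y hy => ?_⟩
  simpa using hj (abs_le.1 hy)

/-- The cutoff leaves `φ` unchanged and confines the uniform error to a bounded interval. The error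
is paid in mass there, and this mass is controlled by a member of the same countable family. -/
lemma abs_integral_sub_cutoffMul_le {φ : C_c(ℝ, ℝ)} {m : ℕ} (hm : ∀ y, φ y ≠ 0 → |y| ≤ m)
    {g : C(ℝ, ℝ)} {δ : ℝ} (hg : ∀ y, |y| ≤ (m : ℝ) + 1 → |φ y - g y| < δ) (μ : LocFinMeasure) :
    |∫ y, φ y ∂μ.1 - ∫ y, cutoffMul m g y ∂μ.1| ≤ δ * ∫ y, cutoff m y ∂μ.1 := by
  rw [← integral_sub (integrable_cc _ _) (integrable_cc _ _), ← integral_const_mul]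
  refine (norm_integral_le_integral_norm _).trans
    (integral_mono ((integrable_cc _ _).sub (integrable_cc _ _)).norm
      ((integrable_cc _ _).const_mul _) fun y => ?_)
  have h1 : φ y = cutoff m y * φ y := by
    by_cases h : φ y = 0
    · simp [h]
    · rw [cutoff_eq_one (hm y h), one_mul]
  simp only [Real.norm_eq_abs]
  change |φ y - cutoffMul m g y| ≤ _
  rw [cutoffMul_apply, h1, ← mul_sub, abs_mul, abs_of_nonneg (cutoff_nonneg _ _), mul_comm]
  rcases le_total |y| ((m : ℝ) + 1) with h | h
  · exact mul_le_mul_of_nonneg_right (hg y h).le (cutoff_nonneg _ _)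
  · simp [cutoff_eq_zero h]

/-- Integrals of the countable family of test functions. -/
def testIntegrals (μ : LocFinMeasure) (i : (ℕ × ℕ) ⊕ ℕ) : ℝ := ∫ y, testFamily i y ∂μ.1

/-- This makes the vague topology second countable and its Borel sets generated by countably many
integrals. -/
lemma topology_eq_induced_testFamily :
    (inferInstance : TopologicalSpace LocFinMeasure) =
      TopologicalSpace.induced testIntegrals inferInstance := by
  apply le_antisymm
  · rw [← continuous_iff_le_induced]
    exact continuous_pi fun i => continuous_integral_locFin _
  · set τ : TopologicalSpace LocFinMeasure :=
      TopologicalSpace.induced testIntegrals inferInstance with hτ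
    have hfam : ∀ i, Continuous[τ, _] fun μ : LocFinMeasure => ∫ y, testFamily i y ∂μ.1 :=
      fun i => (continuous_apply i).comp (continuous_induced_dom (f := testIntegrals))
    change τ ≤ TopologicalSpace.induced _ _
    rw [← continuous_iff_le_induced]
    refine continuous_pi fun φ => ?_
    rw [continuous_iff_continuousAt]
    intro μ₀
    obtain ⟨m, hm⟩ := exists_support_bound φ
    rw [ContinuousAt, Metric.tendsto_nhds]
    intro ε hε
    -- The added 1 keeps `C` a bound for the cutoff mass of every measure near `μ₀`; the tolerance
    -- `ε / (3 * C)` then leaves `ε / 3` for each of the three errors.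
    set C := ∫ y, cutoff m y ∂μ₀.1 + 1 with hC
    have hC0 : 0 < C := by
      have : 0 ≤ ∫ y, cutoff m y ∂μ₀.1 := integral_nonneg (cutoff_nonneg m)
      linarith
    obtain ⟨j, hj⟩ := exists_denseSeq_near (φ : C(ℝ, ℝ)) ((m : ℝ) + 1)
      (show 0 < ε / (3 * C) by positivity)
    have h1 := (hfam (Sum.inl (m, j))).continuousAt (x := μ₀)
    rw [ContinuousAt, Metric.tendsto_nhds] at h1
    have h2 := (hfam (Sum.inr m)).continuousAt (x := μ₀)
    have h3 := h2.eventually (gt_mem_nhds (show ∫ y, cutoff m y ∂μ₀.1 < C by linarith))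
    filter_upwards [h1 (ε / 3) (by positivity), h3] with μ hμ1 hμ2
    have e1 := abs_integral_sub_cutoffMul_le hm hj μ
    have e2 := abs_integral_sub_cutoffMul_le hm hj μ₀
    have b1 : ε / (3 * C) * ∫ y, cutoff m y ∂μ.1 < ε / 3 := by
      calc ε / (3 * C) * ∫ y, cutoff m y ∂μ.1 < ε / (3 * C) * C :=
            mul_lt_mul_of_pos_left hμ2 (by positivity)
        _ = ε / 3 := by field_simp
    have b2 : ε / (3 * C) * ∫ y, cutoff m y ∂μ₀.1 < ε / 3 := by
      calc ε / (3 * C) * ∫ y, cutoff m y ∂μ₀.1 < ε / (3 * C) * C :=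
            mul_lt_mul_of_pos_left (by linarith) (by positivity)
        _ = ε / 3 := by field_simp
    rw [Real.dist_eq] at hμ1 ⊢
    simp only [testFamily] at hμ1
    rw [abs_lt] at *
    rw [abs_le] at e1 e2
    constructor <;> linarith [e1.1, e1.2, e2.1, e2.2, hμ1.1, hμ1.2]

instance : SecondCountableTopology LocFinMeasure := by
  rw [show (instTopologicalSpaceLocFinMeasure : TopologicalSpace LocFinMeasure) = _ from
    topology_eq_induced_testFamily]
  exact TopologicalSpace.secondCountableTopology_induced _ _ _

lemma measurable_toLocFin {Ω : Type*} [MeasurableSpace Ω] {f : Ω → LocFinMeasure}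
    (hf : ∀ φ : C_c(ℝ, ℝ), Measurable fun ω => ∫ y, φ y ∂(f ω).1) : Measurable f := by
  have h : (inferInstance : MeasurableSpace LocFinMeasure) =
      MeasurableSpace.comap testIntegrals inferInstance := by
    rw [show (inferInstance : MeasurableSpace LocFinMeasure) = @borel LocFinMeasure _ from rfl,
      show (instTopologicalSpaceLocFinMeasure : TopologicalSpace LocFinMeasure) = _ from
      topology_eq_induced_testFamily, borel_comap, ← BorelSpace.measurable_eq]
  change @Measurable _ _ _ (inferInstance : MeasurableSpace LocFinMeasure) f
  rw [h, measurable_comap_iff]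
  exact measurable_pi_lambda _ fun i => hf _

/-! ### Convergence in law -/

/-- Evaluation of a measure at finitely many test functions. -/
def evalFinset (I : Finset C_c(ℝ, ℝ)) (μ : LocFinMeasure) : EuclideanSpace ℝ I :=
  WithLp.toLp 2 fun φ => ∫ y, φ.1 y ∂μ.1

lemma continuous_evalFinset (I : Finset C_c(ℝ, ℝ)) : Continuous (evalFinset I) :=
  (PiLp.continuous_toLp 2 _).comp (continuous_pi fun φ => continuous_integral_locFin φ.1)

/-- Open sets that depend on finitely many test functions only. -/
def IsOpenCylinder (W : Set LocFinMeasure) : Prop :=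
  ∃ (I : Finset C_c(ℝ, ℝ)) (O : Set (EuclideanSpace ℝ I)), IsOpen O ∧ W = evalFinset I ⁻¹' O

lemma IsOpenCylinder.isOpen {W : Set LocFinMeasure} (h : IsOpenCylinder W) : IsOpen W := by
  obtain ⟨I, O, hO, rfl⟩ := h
  exact hO.preimage (continuous_evalFinset I)

open Classical in
lemma IsOpenCylinder.union {W W' : Set LocFinMeasure} (h : IsOpenCylinder W)
    (h' : IsOpenCylinder W') : IsOpenCylinder (W ∪ W') := by
  obtain ⟨I, O, hO, rfl⟩ := h
  obtain ⟨I', O', hO', rfl⟩ := h'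
  let r : ∀ (A B : Finset C_c(ℝ, ℝ)) (_ : A ⊆ B), EuclideanSpace ℝ B → EuclideanSpace ℝ A :=
    fun A B hAB x => WithLp.toLp 2 fun φ => x ⟨φ.1, hAB φ.2⟩
  have hr : ∀ A B hAB, Continuous (r A B hAB) := fun A B hAB =>
    (PiLp.continuous_toLp 2 _).comp (continuous_pi fun φ => by fun_prop)
  exact ⟨I ∪ I', r _ _ Finset.subset_union_left ⁻¹' O ∪ r _ _ Finset.subset_union_right ⁻¹' O',
    (hO.preimage (hr _ _ _)).union (hO'.preimage (hr _ _ _)), rfl⟩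

lemma isOpenCylinder_empty : IsOpenCylinder ∅ := ⟨∅, ∅, isOpen_empty, rfl⟩

lemma exists_isOpenCylinder_subset {G : Set LocFinMeasure} (hG : IsOpen G) {μ : LocFinMeasure}
    (hμ : μ ∈ G) : ∃ W, IsOpenCylinder W ∧ μ ∈ W ∧ W ⊆ G := by
  obtain ⟨V, hV, rfl⟩ := isOpen_induced_iff.1 hG
  rw [isOpen_pi_iff] at hV
  obtain ⟨I, u, hu, hsub⟩ := hV _ hμ
  refine ⟨evalFinset I ⁻¹' {x | ∀ φ : I, x φ ∈ u φ.1}, ⟨I, _, ?_, rfl⟩, ?_, ?_⟩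
  · have : {x : EuclideanSpace ℝ I | ∀ φ : I, x φ ∈ u φ.1} =
        ⋂ φ : I, (fun x : EuclideanSpace ℝ I => x φ) ⁻¹' u φ.1 := by ext; simp
    rw [this]
    exact isOpen_iInter_of_finite fun φ => (hu φ.1 φ.2).1.preimage (by fun_prop)
  · exact fun φ => (hu φ.1 φ.2).2
  · intro ν hν
    exact hsub fun φ hφ => hν ⟨φ, hφ⟩

/-- Second countability reduces the union of all cylinders inside `G` to a countable one. Cylinders
are stable under finite unions, so the partial unions increase through cylinders. -/
lemma exists_seq_isOpenCylinder {G : Set LocFinMeasure} (hG : IsOpen G) :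
    ∃ W : ℕ → Set LocFinMeasure, (∀ k, IsOpenCylinder (W k)) ∧ Monotone W ∧ ⋃ k, W k = G := by
  obtain ⟨T, hTc, hTsub, hTU⟩ := TopologicalSpace.isOpen_sUnion_countable
    {W | IsOpenCylinder W ∧ W ⊆ G} fun W hW => hW.1.isOpen
  have hU : ⋃₀ T = G := by
    rw [hTU]
    apply Set.Subset.antisymm (Set.sUnion_subset fun W hW => hW.2)
    intro μ hμ
    obtain ⟨W, hW, hμW, hWG⟩ := exists_isOpenCylinder_subset hG hμ
    exact ⟨W, ⟨hW, hWG⟩, hμW⟩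
  rcases T.eq_empty_or_nonempty with rfl | hne
  · exact ⟨fun _ => ∅, fun _ => isOpenCylinder_empty, monotone_const, by simpa using hU⟩
  · obtain ⟨f, rfl⟩ := hTc.exists_eq_range hne
    refine ⟨Set.accumulate f, fun k => ?_, Set.monotone_accumulate, ?_⟩
    · induction k with
      | zero =>
        have : Set.accumulate f 0 = f 0 := by ext; simp [Set.accumulate_def]
        rw [this]
        exact (hTsub ⟨0, rfl⟩).1
      | succ k ih =>
        rw [Set.accumulate_succ]
        exact ih.union (hTsub ⟨k + 1, rfl⟩).1
    · rw [Set.iUnion_accumulate, ← hU, Set.sUnion_range]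

/-- The characteristic functional of a random locally finite measure. -/
def charFunctional (P : Measure LocFinMeasure) (φ : C_c(ℝ, ℝ)) : ℂ :=
  ∫ μ, Complex.exp (Complex.I * ((∫ y, φ y ∂μ.1 : ℝ) : ℂ)) ∂P

lemma charFun_map_evalFinset (P : Measure LocFinMeasure) (I : Finset C_c(ℝ, ℝ))
    (t : EuclideanSpace ℝ I) :
    charFun (P.map (evalFinset I)) t = charFunctional P (∑ φ : I, t φ • φ.1) := by
  rw [charFun_apply, integral_map (continuous_evalFinset I).aemeasurable
    (Measurable.aestronglyMeasurable (by fun_prop)), charFunctional]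
  refine integral_congr_ae (ae_of_all _ fun μ => ?_)
  have h : ∫ y, (∑ φ : I, t φ • φ.1) y ∂μ.1 = ∑ φ : I, t φ * ∫ y, φ.1 y ∂μ.1 := by
    have h1 : ∀ y, (∑ φ : I, t φ • φ.1) y = ∑ φ : I, t φ * φ.1 y := fun y => by
      simp [CompactlySupportedContinuousMap.coe_sum]
    simp_rw [h1]
    rw [integral_finsetSum _ fun φ _ => (integrable_cc φ.1 μ).const_mul _]
    simp_rw [integral_const_mul]
  simp only [h, evalFinset, PiLp.inner_apply, mul_comm]
  simp

/-- By linearity the characteristic functions of the finite-dimensional marginals are values of the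
functional, so Lévy's theorem and the portmanteau theorem give the liminf inequality on open
cylinders. Increasing unions carry it to all open sets. No tightness argument is needed, because the
limit law `Q` is given in advance. -/
theorem tendsto_of_tendsto_charFunctional {P : ℕ → ProbabilityMeasure LocFinMeasure}
    {Q : ProbabilityMeasure LocFinMeasure}
    (h : ∀ φ, Tendsto (fun α => charFunctional (P α : Measure LocFinMeasure) φ) atTop
      (𝓝 (charFunctional (Q : Measure LocFinMeasure) φ))) :
    Tendsto P atTop (𝓝 Q) := by
  have hcyl : ∀ W, IsOpenCylinder W → (Q : Measure LocFinMeasure) W ≤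
      liminf (fun α => (P α : Measure LocFinMeasure) W) atTop := by
    rintro W ⟨I, O, hO, rfl⟩
    have hm := (continuous_evalFinset I).measurable
    have key : Tendsto (fun α => (P α).map hm.aemeasurable) atTop (𝓝 (Q.map hm.aemeasurable)) := by
      rw [ProbabilityMeasure.tendsto_iff_tendsto_charFun]
      intro t
      simp only [ProbabilityMeasure.toMeasure_map, charFun_map_evalFinset]
      exact h _
    have := ProbabilityMeasure.le_liminf_measure_open_of_tendsto key hO
    simpa only [ProbabilityMeasure.toMeasure_map, Measure.map_apply hm hO.measurableSet] using this
  refine tendsto_of_forall_isOpen_le_liminf' fun G hG => ?_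
  obtain ⟨W, hW, hmono, rfl⟩ := exists_seq_isOpenCylinder hG
  refine le_of_tendsto' (tendsto_measure_iUnion_atTop hmono) fun k => ?_
  refine (hcyl _ (hW k)).trans (liminf_le_liminf (Eventually.of_forall fun α => ?_))
  exact measure_mono (Set.subset_iUnion W k)

/-! ### Measurability of evaluations -/

/-- Continuous compactly supported functions increasing to the indicator of `(a, b)`. -/
def tent (a b : ℝ) (k : ℕ) : C_c(ℝ, ℝ) where
  toFun y := min 1 (k * max 0 (min (y - a) (b - y)))
  continuous_toFun := by fun_prop
  hasCompactSupport' := by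
    refine HasCompactSupport.intro (K := Set.Icc a b) isCompact_Icc fun y hy => ?_
    have h : min (y - a) (b - y) ≤ 0 := by
      rw [min_le_iff]
      by_contra! h
      exact hy ⟨by linarith [h.1], by linarith [h.2]⟩
    simp [max_eq_left h]

lemma tent_apply (a b : ℝ) (k : ℕ) (y : ℝ) :
    tent a b k y = min 1 (k * max 0 (min (y - a) (b - y))) := rfl

lemma tent_nonneg (a b : ℝ) (k : ℕ) (y : ℝ) : 0 ≤ tent a b k y :=
  le_min zero_le_one (mul_nonneg (Nat.cast_nonneg _) (le_max_left _ _))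

lemma tendsto_tent (a b y : ℝ) : Tendsto (fun k => ENNReal.ofReal (tent a b k y)) atTop
    (𝓝 ((Set.Ioo a b).indicator 1 y)) := by
  by_cases hy : y ∈ Set.Ioo a b
  · have h0 : 0 < max 0 (min (y - a) (b - y)) :=
      lt_max_of_lt_right (lt_min (by linarith [hy.1]) (by linarith [hy.2]))
    have h1 : ∀ᶠ k : ℕ in atTop, tent a b k y = 1 := by
      have := (tendsto_natCast_atTop_atTop (R := ℝ)).atTop_mul_const h0
      filter_upwards [this.eventually_ge_atTop 1] with k hk
      rw [tent_apply, min_eq_left hk]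
    rw [Set.indicator_of_mem hy]
    exact tendsto_const_nhds.congr' (h1.mono fun k hk => by simp [hk])
  · have h : min (y - a) (b - y) ≤ 0 := by
      rw [min_le_iff]
      by_contra! h
      exact hy ⟨by linarith [h.1], by linarith [h.2]⟩
    rw [Set.indicator_of_notMem hy]
    simp [tent_apply, max_eq_left h]

lemma measurable_eval_Ioo (a b : ℝ) : Measurable fun μ : LocFinMeasure => μ.1 (Set.Ioo a b) := by
  refine measurable_of_tendsto_metrizable (f := fun (k : ℕ) (μ : LocFinMeasure) =>
    ENNReal.ofReal (∫ y, tent a b k y ∂μ.1))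
    (fun k => (continuous_integral_locFin _).measurable.ennreal_ofReal) ?_
  rw [tendsto_pi_nhds]
  intro μ
  have h1 : μ.1 (Set.Ioo a b) = ∫⁻ y, (Set.Ioo a b).indicator 1 y ∂μ.1 := by
    rw [lintegral_indicator_one measurableSet_Ioo]
  rw [h1]
  simp_rw [ofReal_integral_eq_lintegral_ofReal (integrable_cc _ μ)
    (ae_of_all _ (tent_nonneg _ _ _))]
  refine lintegral_tendsto_of_tendsto_of_monotone
    (fun k => (tent a b k).continuous.measurable.ennreal_ofReal.aemeasurable)
    (ae_of_all _ fun y => ?_) (ae_of_all _ (tendsto_tent a b))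
  intro j k hjk
  refine ENNReal.ofReal_le_ofReal (min_le_min le_rfl ?_)
  exact mul_le_mul_of_nonneg_right (by exact_mod_cast hjk) (le_max_left _ _)

/-- The window `(-m, m)`. -/
def window (m : ℕ) : Set ℝ := Set.Ioo (-(m : ℝ)) m

lemma measurableSet_window (m : ℕ) : MeasurableSet (window m) := measurableSet_Ioo

lemma window_mono : Monotone window := fun i j hij =>
  have : (i : ℝ) ≤ j := by exact_mod_cast hij
  Set.Ioo_subset_Ioo (by linarith) this

lemma iUnion_window : ⋃ m, window m = Set.univ := by
  refine Set.eq_univ_of_forall fun y => ?_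
  obtain ⟨m, hm⟩ := exists_nat_gt |y|
  exact Set.mem_iUnion.2 ⟨m, abs_lt.1 hm⟩

lemma iUnion_inter_window (B : Set ℝ) : ⋃ m, B ∩ window m = B := by
  rw [← Set.inter_iUnion, iUnion_window, Set.inter_univ]

lemma measure_window_lt_top (μ : Measure ℝ) [IsLocallyFiniteMeasure μ] (m : ℕ) :
    μ (window m) < ⊤ :=
  (measure_mono Set.Ioo_subset_Icc_self).trans_lt isCompact_Icc.measure_lt_top

/-- Restriction to a window makes the measures finite, so that a π-system argument from rational
intervals applies; monotone limits over windows remove the restriction. -/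
lemma measurable_eval_locFin {B : Set ℝ} (hB : MeasurableSet B) :
    Measurable fun μ : LocFinMeasure => μ.1 B := by
  have hw : ∀ m, Measurable fun μ : LocFinMeasure => μ.1.restrict (window m) := by
    intro m
    have : ∀ μ : LocFinMeasure, IsFiniteMeasure (μ.1.restrict (window m)) := fun μ => by
      have := μ.2
      exact isFiniteMeasure_restrict.2 (measure_window_lt_top μ.1 m).ne
    refine Measurable.measure_of_isPiSystem
      (BorelSpace.measurable_eq.trans Real.borel_eq_generateFrom_Ioo_rat)
      Real.isPiSystem_Ioo_rat ?_ ?_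
    · intro S hS
      simp only [Set.mem_iUnion, Set.mem_singleton_iff] at hS
      obtain ⟨l, u, -, rfl⟩ := hS
      simp only [Measure.restrict_apply measurableSet_Ioo, window, Set.Ioo_inter_Ioo]
      exact measurable_eval_Ioo _ _
    · simpa only [Measure.restrict_apply MeasurableSet.univ, Set.univ_inter, window]
        using measurable_eval_Ioo _ _
  have h1 : (fun μ : LocFinMeasure => μ.1 B) = fun μ => ⨆ m, μ.1.restrict (window m) B := by
    ext μ
    simp_rw [Measure.restrict_apply hB]
    rw [← (monotone_const.inter window_mono).measure_iUnion, iUnion_inter_window]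
  rw [h1]
  exact Measurable.iSup fun m => (Measure.measurable_coe hB).comp (hw m)

/-! ### A characterization of Poisson point processes -/

/-- The values of the characteristic functional on bounded functions with bounded support. -/
def HasPoissonCharFunctional (ν : Measure ℝ) (Λ : Measure LocFinMeasure) : Prop :=
  ∀ f : ℝ → ℝ, Measurable f → (∃ C, ∀ y, |f y| ≤ C) → (∃ m : ℕ, ∀ y ∉ window m, f y = 0) →
    ∫ μ, Complex.exp (Complex.I * ((∫ y, f y ∂μ.1 : ℝ) : ℂ)) ∂Λ =
      Complex.exp (∫ y, (Complex.exp (Complex.I * f y) - 1) ∂ν)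

/-- For finite `c` only finitely many atoms contribute, each continuous in the rate. This lets the
mean vary along an exhaustion by windows. -/
lemma continuous_poissonMeasure_Iic (c : ENNReal) :
    Continuous fun r : NNReal => poissonMeasure r (Nat.cast ⁻¹' Set.Iic c) := by
  rcases eq_or_ne c ⊤ with rfl | hc
  · simp [continuous_const]
  · have hfin : (Nat.cast ⁻¹' Set.Iic c : Set ℕ).Finite := by
      obtain ⟨m, hm⟩ := ENNReal.exists_nat_gt hc
      refine (Set.finite_Iio m).subset fun k hk => ?_
      have : (k : ENNReal) < m := lt_of_le_of_lt hk hm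
      exact_mod_cast this
    have h1 : ∀ r : NNReal, poissonMeasure r (Nat.cast ⁻¹' Set.Iic c) =
        ∑ k ∈ hfin.toFinset, ENNReal.ofReal (Real.exp (-r) * r ^ k / k.factorial) := fun r => by
      simp_rw [← poissonMeasure_singleton]
      rw [sum_measure_singleton, hfin.coe_toFinset]
    simp_rw [h1]
    exact continuous_finsetSum _ fun k _ => ENNReal.continuous_ofReal.comp (by fun_prop)

lemma setOf_count_le_eq_iInter (B : Set ℝ) (c : ENNReal) :
    {μ : LocFinMeasure | μ.1 B ≤ c} = ⋂ m, {μ : LocFinMeasure | μ.1 (B ∩ window m) ≤ c} := by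
  ext μ
  simp only [Set.mem_ofPred_eq, Set.mem_iInter]
  rw [← iSup_le_iff, ← (monotone_const.inter window_mono).measure_iUnion, iUnion_inter_window]

/-- Statements on bounded sets pass to arbitrary Borel sets through these events, which decrease as
the window grows. -/
lemma tendsto_measure_iInter_count_le {Λ : Measure LocFinMeasure}
    [IsProbabilityMeasure Λ] {ι : Type*} (S : Finset ι) {B : ι → Set ℝ}
    (hB : ∀ i, MeasurableSet (B i)) (c : ι → ENNReal) :
    Tendsto (fun m => Λ (⋂ i ∈ S, {μ : LocFinMeasure | μ.1 (B i ∩ window m) ≤ c i})) atTop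
      (𝓝 (Λ (⋂ i ∈ S, {μ : LocFinMeasure | μ.1 (B i) ≤ c i}))) := by
  have h : ⋂ i ∈ S, {μ : LocFinMeasure | μ.1 (B i) ≤ c i} =
      ⋂ m, ⋂ i ∈ S, {μ : LocFinMeasure | μ.1 (B i ∩ window m) ≤ c i} := by
    rw [Set.iInter_congr fun i => Set.iInter_congr fun _ =>
      setOf_count_le_eq_iInter (B i) (c i), Set.iInter_comm]
    exact Set.iInter_congr fun i => Set.iInter_comm _
  rw [h]
  refine tendsto_measure_iInter_atTop (fun m => MeasurableSet.nullMeasurableSet ?_) ?_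
    ⟨0, measure_ne_top _ _⟩
  · exact Finset.measurableSet_biInter _ fun i _ =>
      measurable_eval_locFin ((hB i).inter (measurableSet_window m)) measurableSet_Iic
  · intro m m' hmm'
    refine Set.iInter₂_mono fun i _ μ hμ => ?_
    exact (measure_mono (Set.inter_subset_inter_right _ (window_mono hmm'))).trans hμ

section

variable {ν : Measure ℝ} [IsLocallyFiniteMeasure ν] {Λ : Measure LocFinMeasure}

lemma integral_sum_indicator_window {ι : Type*} [Fintype ι] {B : ι → Set ℝ}
    (hB : ∀ i, MeasurableSet (B i)) {m : ℕ} (hm : ∀ i, B i ⊆ window m) (c : ι → ℝ)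
    (μ : LocFinMeasure) :
    ∫ y, (∑ i, (B i).indicator (fun _ => c i) y) ∂μ.1 = ∑ i, c i * (μ.1 (B i)).toReal := by
  have := μ.2
  have hfin : ∀ i, μ.1 (B i) ≠ ⊤ := fun i =>
    ((measure_mono (hm i)).trans_lt (measure_window_lt_top _ m)).ne
  rw [integral_finsetSum _ fun i _ => (integrable_indicator_iff (hB i)).2
    (integrableOn_const (hfin i))]
  refine Finset.sum_congr rfl fun i _ => ?_
  rw [integral_indicator (hB i), setIntegral_const, smul_eq_mul, mul_comm, measureReal_def]

/-- The functional is evaluated at the step function with value `c i` on `B i`. By disjointness `exp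
(i f) - 1` is the sum of the contributions of the sets, so the exponential factorizes. -/
lemma HasPoissonCharFunctional.charFun_counts (h : HasPoissonCharFunctional ν Λ)
    {ι : Type*} [Fintype ι] {B : ι → Set ℝ} (hB : ∀ i, MeasurableSet (B i))
    {m : ℕ} (hm : ∀ i, B i ⊆ window m) (hd : Pairwise fun i j => Disjoint (B i) (B j))
    (c : ι → ℝ) :
    ∫ μ : LocFinMeasure, Complex.exp (Complex.I * ((∑ i, c i * (μ.1 (B i)).toReal : ℝ) : ℂ)) ∂Λ =
      ∏ i, Complex.exp ((ν (B i)).toReal * (Complex.exp (c i * Complex.I) - 1)) := by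
  classical
  have hind : ∀ i y, |(B i).indicator (fun _ => c i) y| ≤ |c i| := fun i y => by
    by_cases hy : y ∈ B i <;> simp [hy]
  have key := h (fun y => ∑ i, (B i).indicator (fun _ => c i) y)
    (Finset.measurable_sum _ fun i _ => measurable_const.indicator (hB i))
    ⟨∑ i, |c i|, fun y => (Finset.abs_sum_le_sum_abs _ _).trans
      (Finset.sum_le_sum fun i _ => hind i y)⟩
    ⟨m, fun y hy => Finset.sum_eq_zero fun i _ =>
      Set.indicator_of_notMem (fun hyi => hy (hm i hyi)) _⟩
  simp_rw [integral_sum_indicator_window hB hm] at key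
  rw [key, ← Complex.exp_sum]
  congr 1
  have hfin : ∀ i, ν (B i) ≠ ⊤ := fun i =>
    ((measure_mono (hm i)).trans_lt (measure_window_lt_top _ m)).ne
  have hpt : ∀ y, Complex.exp (Complex.I * ((∑ i, (B i).indicator (fun _ => c i) y : ℝ) : ℂ)) - 1 =
      ∑ i, (B i).indicator (fun _ => Complex.exp (c i * Complex.I) - 1) y := by
    intro y
    by_cases hy : ∃ i, y ∈ B i
    · obtain ⟨i, hi⟩ := hy
      have hne : ∀ j, j ≠ i → y ∉ B j := fun j hj hyj => (hd hj).le_bot ⟨hyj, hi⟩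
      rw [Finset.sum_eq_single i (fun j _ hj => Set.indicator_of_notMem (hne j hj) _) (by simp),
        Finset.sum_eq_single i (fun j _ hj => Set.indicator_of_notMem (hne j hj) _) (by simp)]
      simp [hi, mul_comm]
    · push Not at hy
      simp [hy]
  simp_rw [hpt]
  rw [integral_finsetSum _ fun i _ => (integrable_indicator_iff (hB i)).2
    (integrableOn_const (hfin i))]
  refine Finset.sum_congr rfl fun i _ => ?_
  rw [integral_indicator (hB i), setIntegral_const, measureReal_def, Complex.real_smul]

lemma HasPoissonCharFunctional.map_count_toReal [IsProbabilityMeasure Λ]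
    (h : HasPoissonCharFunctional ν Λ) {B : Set ℝ}
    (hB : MeasurableSet B) {m : ℕ} (hm : B ⊆ window m) :
    Λ.map (fun μ => (μ.1 B).toReal) =
      (poissonMeasure (ν B).toNNReal).map (Nat.cast : ℕ → ℝ) := by
  have hmeas : Measurable fun μ : LocFinMeasure => (μ.1 B).toReal :=
    (measurable_eval_locFin hB).ennreal_toReal
  have := Measure.isProbabilityMeasure_map (μ := Λ) hmeas.aemeasurable
  have := Measure.isProbabilityMeasure_map (μ := poissonMeasure (ν B).toNNReal)
    (f := (Nat.cast : ℕ → ℝ)) (Measurable.of_discrete).aemeasurable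
  refine Measure.ext_of_charFun (funext fun t => ?_)
  rw [charFun_map_cast_poissonMeasure, charFun_apply_real, integral_map hmeas.aemeasurable
    (Measurable.aestronglyMeasurable (by fun_prop))]
  have := h.charFun_counts (B := fun _ : Unit => B) (fun _ => hB) (fun _ => hm)
    (fun i j hij => (hij rfl).elim) (fun _ => t)
  simp only [Finset.univ_unique, Finset.sum_singleton, Finset.prod_singleton] at this
  have hr : (((ν B).toNNReal : ℝ) : ℂ) = ((ν B).toReal : ℂ) := rfl
  rw [hr, ← this]
  refine integral_congr_ae (ae_of_all _ fun μ => ?_)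
  push_cast
  ring_nf

lemma HasPoissonCharFunctional.map_count [IsProbabilityMeasure Λ]
    (h : HasPoissonCharFunctional ν Λ) {B : Set ℝ}
    (hB : MeasurableSet B) {m : ℕ} (hm : B ⊆ window m) :
    Λ.map (fun μ => μ.1 B) =
      (poissonMeasure (ν B).toNNReal).map (Nat.cast : ℕ → ENNReal) := by
  have h1 := congrArg (Measure.map ENNReal.ofReal) (h.map_count_toReal hB hm)
  rw [Measure.map_map ENNReal.measurable_ofReal (measurable_eval_locFin hB).ennreal_toReal,
    Measure.map_map ENNReal.measurable_ofReal Measurable.of_discrete] at h1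
  convert h1 using 2
  · ext μ
    have := μ.2
    exact (ENNReal.ofReal_toReal
      ((measure_mono hm).trans_lt (measure_window_lt_top μ.1 m)).ne).symm
  · ext k
    simp

lemma HasPoissonCharFunctional.indep_counts [IsProbabilityMeasure Λ]
    (h : HasPoissonCharFunctional ν Λ)
    {ι : Type*} [Fintype ι] {B : ι → Set ℝ} (hB : ∀ i, MeasurableSet (B i))
    {m : ℕ} (hm : ∀ i, B i ⊆ window m) (hd : Pairwise fun i j => Disjoint (B i) (B j)) :
    iIndepFun (fun i (μ : LocFinMeasure) => μ.1 (B i)) Λ := by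
  have hmeas : ∀ i, Measurable fun μ : LocFinMeasure => (μ.1 (B i)).toReal := fun i =>
    (measurable_eval_locFin (hB i)).ennreal_toReal
  have h1 : iIndepFun (fun i (μ : LocFinMeasure) => (μ.1 (B i)).toReal) Λ := by
    rw [iIndepFun_iff_charFun_pi fun i => (hmeas i).aemeasurable]
    intro t
    have hm2 : Measurable fun (μ : LocFinMeasure) => WithLp.toLp 2 fun i => (μ.1 (B i)).toReal :=
      (WithLp.measurable_toLp 2 _).comp (measurable_pi_lambda _ hmeas)
    rw [charFun_apply, integral_map hm2.aemeasurable
      (Measurable.aestronglyMeasurable (by fun_prop))]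
    have h2 : ∀ i, charFun (Λ.map fun μ => (μ.1 (B i)).toReal) (t i) =
        Complex.exp ((ν (B i)).toReal * (Complex.exp (t i * Complex.I) - 1)) := fun i => by
      rw [h.map_count_toReal (hB i) (hm i), charFun_map_cast_poissonMeasure]
      rfl
    rw [Finset.prod_congr rfl fun i _ => h2 i, ← h.charFun_counts hB hm hd]
    refine integral_congr_ae (ae_of_all _ fun μ => ?_)
    simp [PiLp.inner_apply, mul_comm]
  have h3 := h1.comp (fun _ => ENNReal.ofReal) fun _ => ENNReal.measurable_ofReal
  convert h3 using 2 with i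
  ext μ
  have := μ.2
  exact (ENNReal.ofReal_toReal
    ((measure_mono (hm i)).trans_lt (measure_window_lt_top μ.1 m)).ne).symm

theorem HasPoissonCharFunctional.isPoissonProcessLaw [IsProbabilityMeasure Λ]
    (h : HasPoissonCharFunctional ν Λ) :
    IsPoissonProcessLaw ν Λ where
  count B hB hνB := by
    have hmeas := measurable_eval_locFin hB
    refine ⟨hmeas.aemeasurable, ?_⟩
    have := Measure.isProbabilityMeasure_map (μ := Λ) hmeas.aemeasurable
    refine Measure.ext_of_Iic _ _ fun c => ?_
    rw [Measure.map_apply hmeas measurableSet_Iic,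
      Measure.map_apply Measurable.of_discrete measurableSet_Iic]
    have h1 := tendsto_measure_iInter_count_le (Λ := Λ) (Finset.univ : Finset Unit)
      (B := fun _ => B) (fun _ => hB) (fun _ => c)
    simp only [Finset.mem_univ, Set.iInter_const] at h1
    refine tendsto_nhds_unique h1 ?_
    have h2 : ∀ m, Λ {μ : LocFinMeasure | μ.1 (B ∩ window m) ≤ c} =
        poissonMeasure (ν (B ∩ window m)).toNNReal (Nat.cast ⁻¹' Set.Iic c) := fun m => by
      have h3 := h.map_count (hB.inter (measurableSet_window m)) (m := m) Set.inter_subset_right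
      have h4 := congrArg (fun M : Measure ENNReal => M (Set.Iic c)) h3
      beta_reduce at h4
      rwa [Measure.map_apply (measurable_eval_locFin (hB.inter (measurableSet_window m)))
        measurableSet_Iic, Measure.map_apply Measurable.of_discrete measurableSet_Iic] at h4
    simp_rw [h2]
    refine ((continuous_poissonMeasure_Iic c).tendsto _).comp ?_
    refine (ENNReal.tendsto_toNNReal hνB).comp ?_
    have h5 := tendsto_measure_iUnion_atTop (μ := ν)
      ((monotone_const (c := B)).inter window_mono)
    rwa [iUnion_inter_window] at h5
  indep k B hB hd := by
    -- Half-lines generate the σ-algebra of each count, so it suffices to factorize probabilities of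
    -- events `μ (B i) ≤ c i`, first in a window and then in the limit.
    rw [iIndepFun_iff_iIndep]
    refine iIndepSets.iIndep (fun i => (measurable_eval_locFin (hB i)).comap_le)
      (fun i => Set.preimage (fun μ : LocFinMeasure => μ.1 (B i)) '' Set.range Set.Iic)
      (fun i => ?_) (fun i => ?_) ?_
    · have := (isPiSystem_Iic (α := ENNReal)).comap fun μ : LocFinMeasure => μ.1 (B i)
      exact this
    · rw [BorelSpace.measurable_eq (α := ENNReal), borel_eq_generateFrom_Iic,
        MeasurableSpace.comap_generateFrom]
    · rw [iIndepSets_iff]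
      intro S f hf
      choose! g hg hgf using hf
      choose! c hc using hg
      have hf' : ∀ i ∈ S, f i = {μ : LocFinMeasure | μ.1 (B i) ≤ c i} := fun i hi => by
        rw [← hgf i hi, ← hc i hi]
        rfl
      rw [Set.iInter₂_congr hf', Finset.prod_congr rfl fun i hi => by rw [hf' i hi]]
      refine tendsto_nhds_unique (tendsto_measure_iInter_count_le S hB c) ?_
      have hprod : ∀ m, Λ (⋂ i ∈ S, {μ : LocFinMeasure | μ.1 (B i ∩ window m) ≤ c i}) =
          ∏ i ∈ S, Λ {μ : LocFinMeasure | μ.1 (B i ∩ window m) ≤ c i} := fun m => by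
        have h1 := h.indep_counts (B := fun i => B i ∩ window m) (m := m)
          (fun i => (hB i).inter (measurableSet_window m)) (fun i => Set.inter_subset_right)
          (fun i j hij => (hd hij).mono Set.inter_subset_left Set.inter_subset_left)
        exact h1.measure_inter_preimage_eq_mul S (sets := fun i => Set.Iic (c i))
          fun i _ => measurableSet_Iic
      simp_rw [hprod]
      refine ENNReal.tendsto_finsetProd_of_ne_top S (fun i hi => ?_) fun i _ => measure_ne_top _ _
      have h1 := tendsto_measure_iInter_count_le (Λ := Λ) {i} hB c
      simpa using h1

end

/-! ### Construction of Poisson point processes on the line -/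

lemma integral_infinitePi_prod {ι : Type*} {X : ι → Type*} {mX : ∀ i, MeasurableSpace (X i)}
    (μ : ∀ i, Measure (X i)) [∀ i, IsProbabilityMeasure (μ i)] (I : Finset ι)
    (F : ∀ i, X i → ℂ) (hF : ∀ i, Measurable (F i)) :
    ∫ ω, ∏ i ∈ I, F i (ω i) ∂Measure.infinitePi μ = ∏ i ∈ I, ∫ x, F i x ∂μ i := by
  have h1 : ∀ ω : ∀ i, X i, ∏ i ∈ I, F i (ω i) = ∏ i : I, F i.1 (I.restrict ω i) := fun ω =>
    (Finset.prod_coe_sort I fun i => F i (ω i)).symm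
  simp_rw [h1]
  have h2 : Measurable (I.restrict : (∀ i, X i) → ∀ i : I, X i) := Finset.measurable_restrict I
  have h3 := integral_map (μ := Measure.infinitePi μ) h2.aemeasurable
    (f := fun y : (∀ i : I, X i) => ∏ i : I, F i.1 (y i))
    (Finset.measurable_prod _ fun i _ =>
      (hF i.1).comp (measurable_pi_apply i)).aestronglyMeasurable
  rw [← h3, Measure.infinitePi_map_restrict]
  exact (integral_fintype_prod_eq_prod (𝕜 := ℂ) fun (i : I) => F i.1).trans
    (Finset.prod_coe_sort I fun i => ∫ x, F i x ∂μ i)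

lemma integral_pow_poissonMeasure (r : NNReal) (z : ℂ) :
    ∫ k, z ^ k ∂poissonMeasure r = Complex.exp (r * (z - 1)) := by
  rw [integral_poissonMeasure, mul_sub, mul_one, sub_eq_add_neg, add_comm, Complex.exp_add,
    Complex.exp_eq_exp_ℂ, ← (NormedSpace.expSeries_div_hasSum_exp ((r : ℂ) * z)).tsum_eq,
    ← tsum_mul_left, ← Complex.exp_eq_exp_ℂ]
  refine tsum_congr fun k => ?_
  rw [Complex.real_smul]
  push_cast
  ring

/-- The cells `[i, i + 1)` partitioning the line. -/
def cell (i : ℤ) : Set ℝ := Set.Ico (i : ℝ) (i + 1)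

lemma measurableSet_cell (i : ℤ) : MeasurableSet (cell i) := measurableSet_Ico

lemma mem_cell_iff {i : ℤ} {y : ℝ} : y ∈ cell i ↔ ⌊y⌋ = i := by
  rw [Int.floor_eq_iff]; rfl

variable (ν : Measure ℝ) [IsLocallyFiniteMeasure ν]

lemma measure_cell_ne_top (i : ℤ) : ν (cell i) ≠ ⊤ :=
  ((measure_mono Set.Ico_subset_Icc_self).trans_lt isCompact_Icc.measure_lt_top).ne

open Classical in
/-- The normalized restriction of `ν` to a cell. -/
def cellProb (i : ℤ) : Measure ℝ :=
  if ν (cell i) = 0 then Measure.dirac 0 else (ν (cell i))⁻¹ • ν.restrict (cell i)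

instance (i : ℤ) : IsProbabilityMeasure (cellProb ν i) := by
  unfold cellProb
  split_ifs with h
  · infer_instance
  · exact ⟨by simp [ENNReal.inv_mul_cancel h (measure_cell_ne_top ν i)]⟩

/-- The formula survives the arbitrary choice of a Dirac mass on a null cell, where both sides
vanish. -/
lemma smul_integral_cellProb (i : ℤ) (g : ℝ → ℂ) :
    ((ν (cell i)).toReal : ℂ) * ∫ y, g y ∂cellProb ν i = ∫ y in cell i, g y ∂ν := by
  unfold cellProb
  split_ifs with h
  · simp [h, Measure.restrict_eq_zero.2 h]
  · rw [integral_smul_measure, Complex.real_smul, ← mul_assoc, ENNReal.toReal_inv,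
      ← Complex.ofReal_mul, mul_inv_cancel₀, Complex.ofReal_one, one_mul]
    exact ENNReal.toReal_ne_zero.2 ⟨h, measure_cell_ne_top ν i⟩

/-- The law of a Poisson number of points together with an i.i.d. sequence of positions. -/
def cellLaw (i : ℤ) : Measure (ℕ × (ℕ → ℝ)) :=
  (poissonMeasure (ν (cell i)).toNNReal).prod (Measure.infinitePi fun _ => cellProb ν i)

instance (i : ℤ) : IsProbabilityMeasure (cellLaw ν i) := by unfold cellLaw; infer_instance

lemma measurable_sum_range {g : ℝ → ℝ} (hg : Measurable g) :
    Measurable fun p : ℕ × (ℕ → ℝ) => ∑ k ∈ Finset.range p.1, g (p.2 k) :=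
  measurable_from_prod_countable_right fun k =>
    Finset.measurable_sum (Finset.range k) fun j _ => hg.comp (measurable_pi_apply j)

/-- This is the compound Poisson formula: given `k` points, independence yields the `k`-th power of
a single integral, and the generating function of the Poisson law sums these powers. -/
lemma integral_cellLaw (i : ℤ) {g : ℝ → ℝ} (hg : Measurable g) :
    ∫ p, Complex.exp (Complex.I * ((∑ k ∈ Finset.range p.1, g (p.2 k) : ℝ) : ℂ)) ∂cellLaw ν i =
      Complex.exp (∫ y in cell i, (Complex.exp (Complex.I * g y) - 1) ∂ν) := by
  have hm := measurable_sum_range hg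
  have hint : Integrable (fun p : ℕ × (ℕ → ℝ) =>
      Complex.exp (Complex.I * ((∑ k ∈ Finset.range p.1, g (p.2 k) : ℝ) : ℂ))) (cellLaw ν i) :=
    Integrable.of_bound (Measurable.aestronglyMeasurable (by fun_prop)) 1
      (ae_of_all _ fun p => by rw [mul_comm, Complex.norm_exp_ofReal_mul_I])
  unfold cellLaw at hint ⊢
  rw [integral_prod _ hint]
  have h1 : ∀ k : ℕ, ∫ x : ℕ → ℝ, Complex.exp (Complex.I *
      ((∑ j ∈ Finset.range k, g (x j) : ℝ) : ℂ)) ∂(Measure.infinitePi fun _ => cellProb ν i) =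
      (∫ y, Complex.exp (Complex.I * g y) ∂cellProb ν i) ^ k := fun k => by
    have h2 := integral_infinitePi_prod (fun _ : ℕ => cellProb ν i) (Finset.range k)
      (fun _ y => Complex.exp (Complex.I * g y)) (fun _ => by fun_prop)
    rw [Finset.prod_const, Finset.card_range] at h2
    rw [← h2]
    refine integral_congr_ae (ae_of_all _ fun x => ?_)
    beta_reduce
    rw [← Complex.exp_sum]
    push_cast
    rw [Finset.mul_sum]
  simp only [h1]
  rw [integral_pow_poissonMeasure, mul_sub, mul_one]
  have h3 : (((ν (cell i)).toNNReal : ℝ) : ℂ) = ((ν (cell i)).toReal : ℂ) := rfl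
  have h4 := smul_integral_cellProb ν i fun y => Complex.exp (Complex.I * g y)
  have hfin : IsFiniteMeasure (ν.restrict (cell i)) :=
    isFiniteMeasure_restrict.2 (measure_cell_ne_top ν i)
  rw [h3, h4, integral_sub _ (integrable_const _)]
  · congr 2
    simp [measureReal_def]
  · exact Integrable.of_bound (Measurable.aestronglyMeasurable (by fun_prop)) 1
      (ae_of_all _ fun p => by rw [mul_comm, Complex.norm_exp_ofReal_mul_I])

/-- The points of a sample lying in the cell `i`. -/
def cellPoints (i : ℤ) (p : ℕ × (ℕ → ℝ)) : Measure ℝ :=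
  (∑ k ∈ Finset.range p.1, Measure.dirac (p.2 k)).restrict (cell i)

instance (i : ℤ) (p : ℕ × (ℕ → ℝ)) : IsFiniteMeasure (cellPoints i p) := by
  unfold cellPoints; infer_instance

lemma cellPoints_apply_eq_zero {i : ℤ} {p : ℕ × (ℕ → ℝ)} {B : Set ℝ} (hB : MeasurableSet B)
    (h : Disjoint B (cell i)) : cellPoints i p B = 0 := by
  rw [cellPoints, Measure.restrict_apply hB, h.inter_eq, measure_empty]

lemma disjoint_cell_of_notMem {m : ℕ} {i : ℤ} (hi : i ∉ Finset.Ico (-(m : ℤ)) m) :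
    Disjoint (window m) (cell i) := by
  rw [Set.disjoint_left]
  intro y hy hyi
  rw [mem_cell_iff] at hyi
  apply hi
  rw [Finset.mem_Ico, ← hyi]
  exact ⟨Int.le_floor.2 (by push_cast; exact hy.1.le), Int.floor_lt.2 (by exact_mod_cast hy.2)⟩

/-- A window meets finitely many cells. Since `cellPoints` restricts to the cell, this holds for
every sample, not only for those whose points fall where they should, and no null set has to be
discarded. -/
lemma sum_cellPoints_window_lt_top (ω : ℤ → ℕ × (ℕ → ℝ)) (m : ℕ) :
    Measure.sum (fun i => cellPoints i (ω i)) (window m) < ⊤ := by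
  rw [Measure.sum_apply _ (measurableSet_window m), tsum_eq_sum (s := Finset.Ico (-(m : ℤ)) m)
    fun i hi => cellPoints_apply_eq_zero (measurableSet_window m) (disjoint_cell_of_notMem hi)]
  exact ENNReal.sum_lt_top.2 fun i _ => measure_lt_top _ _

/-- The superposition of the points in all cells. -/
def superpose (ω : ℤ → ℕ × (ℕ → ℝ)) : LocFinMeasure :=
  ⟨Measure.sum fun i => cellPoints i (ω i), ⟨fun y => by
    obtain ⟨m, hm⟩ := exists_nat_gt |y|
    exact ⟨window m, isOpen_Ioo.mem_nhds (abs_lt.1 hm), sum_cellPoints_window_lt_top ω m⟩⟩⟩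

lemma integral_superpose {f : ℝ → ℝ} (hf : Measurable f) {C : ℝ} (hC : ∀ y, |f y| ≤ C) {m : ℕ}
    (hm : ∀ y ∉ window m, f y = 0) (ω : ℤ → ℕ × (ℕ → ℝ)) :
    ∫ y, f y ∂(superpose ω).1 = ∑ i ∈ Finset.Ico (-(m : ℤ)) m,
      ∑ k ∈ Finset.range (ω i).1, (cell i).indicator f ((ω i).2 k) := by
  have hint : Integrable f (Measure.sum fun i => cellPoints i (ω i)) := by
    rw [← integrableOn_iff_integrable_of_support_subset (s := window m)
      (fun y hy => by by_contra h; exact hy (hm y h))]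
    exact Measure.integrableOn_of_bounded (sum_cellPoints_window_lt_top ω m).ne
      hf.aestronglyMeasurable (M := C) (ae_of_all _ hC)
  change ∫ y, f y ∂(Measure.sum fun i => cellPoints i (ω i)) = _
  have hcell : ∀ i, ∫ y, f y ∂cellPoints i (ω i) =
      ∑ k ∈ Finset.range (ω i).1, (cell i).indicator f ((ω i).2 k) := fun i => by
    rw [cellPoints, ← integral_indicator (measurableSet_cell i), integral_finsetSum_measure]
    · simp [integral_dirac]
    · exact fun k _ => Integrable.of_bound
        (hf.indicator (measurableSet_cell i)).aestronglyMeasurable C (ae_of_all _ fun y => by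
          by_cases hy : y ∈ cell i
          · simpa [hy] using hC y
          · simpa [hy] using (abs_nonneg _).trans (hC y))
  rw [integral_sum_measure hint, tsum_eq_sum (s := Finset.Ico (-(m : ℤ)) m)]
  · exact Finset.sum_congr rfl fun i _ => hcell i
  · intro i hi
    rw [hcell]
    refine Finset.sum_eq_zero fun k _ => ?_
    by_cases hy : (ω i).2 k ∈ cell i
    · rw [Set.indicator_of_mem hy]
      exact hm _ fun hw => (disjoint_cell_of_notMem hi).le_bot ⟨hw, hy⟩
    · exact Set.indicator_of_notMem hy _

lemma exists_window_of_cc (φ : C_c(ℝ, ℝ)) : ∃ m : ℕ, ∀ y ∉ window m, φ y = 0 := by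
  obtain ⟨m, hm⟩ := exists_support_bound φ
  refine ⟨m + 1, fun y hy => ?_⟩
  by_contra h
  apply hy
  have := abs_le.1 (hm y h)
  constructor <;> push_cast <;> linarith [this.1, this.2]

lemma exists_bound_of_cc (φ : C_c(ℝ, ℝ)) : ∃ C, ∀ y, |φ y| ≤ C :=
  φ.hasCompactSupport.exists_bound_of_continuous φ.continuous

lemma measurable_sum_points {f : ℝ → ℝ} (hf : Measurable f) (I : Finset ℤ) :
    Measurable fun ω : ℤ → ℕ × (ℕ → ℝ) => ∑ i ∈ I,
      ∑ k ∈ Finset.range (ω i).1, (cell i).indicator f ((ω i).2 k) :=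
  Finset.measurable_sum _ fun i _ =>
    (measurable_sum_range (hf.indicator (measurableSet_cell i))).comp (measurable_pi_apply i)

lemma measurable_superpose : Measurable superpose := by
  refine measurable_toLocFin fun φ => ?_
  obtain ⟨m, hm⟩ := exists_window_of_cc φ
  obtain ⟨C, hC⟩ := exists_bound_of_cc φ
  rw [show (fun ω => ∫ y, φ y ∂(superpose ω).1) = _ from
    funext fun ω => integral_superpose φ.continuous.measurable hC hm ω]
  exact measurable_sum_points φ.continuous.measurable _

/-- The law of the Poisson point process with intensity measure `ν`. -/
def poissonLaw : Measure LocFinMeasure := (Measure.infinitePi (cellLaw ν)).map superpose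

instance : IsProbabilityMeasure (poissonLaw ν) :=
  Measure.isProbabilityMeasure_map measurable_superpose.aemeasurable

lemma measurable_integral_locFin {f : ℝ → ℝ} (hf : Measurable f) {C : ℝ} (hC : ∀ y, |f y| ≤ C)
    {m : ℕ} (hm : ∀ y ∉ window m, f y = 0) :
    Measurable fun μ : LocFinMeasure => ∫ y, f y ∂μ.1 := by
  have hval : Measurable fun μ : LocFinMeasure => μ.1 :=
    Measure.measurable_of_measurable_coe _ fun B hB => measurable_eval_locFin hB
  have h1 : (fun μ : LocFinMeasure => ∫ y, f y ∂μ.1) = fun μ =>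
      (∫⁻ y, ENNReal.ofReal (f y) ∂μ.1).toReal - (∫⁻ y, ENNReal.ofReal (-f y) ∂μ.1).toReal := by
    ext μ
    have := μ.2
    refine integral_eq_lintegral_pos_part_sub_lintegral_neg_part ?_
    rw [← integrableOn_iff_integrable_of_support_subset (s := window m)
      (fun y hy => by by_contra h; exact hy (hm y h))]
    exact Measure.integrableOn_of_bounded (measure_window_lt_top μ.1 m).ne
      hf.aestronglyMeasurable (M := C) (ae_of_all _ hC)
  rw [h1]
  exact (((Measure.measurable_lintegral hf.ennreal_ofReal).comp hval).ennreal_toReal).sub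
    (((Measure.measurable_lintegral hf.neg.ennreal_ofReal).comp hval).ennreal_toReal)

lemma sum_setIntegral_cell {g : ℝ → ℂ} (hg : Measurable g) {C : ℝ} (hC : ∀ y, ‖g y‖ ≤ C) {m : ℕ}
    (hm : ∀ y ∉ window m, g y = 0) :
    ∑ i ∈ Finset.Ico (-(m : ℤ)) m, ∫ y in cell i, g y ∂ν = ∫ y, g y ∂ν := by
  rw [← integral_biUnion_finset _ (fun i _ => measurableSet_cell i)]
  · refine setIntegral_eq_integral_of_forall_compl_eq_zero fun y hy => hm y fun hw => hy ?_
    simp only [Set.mem_iUnion]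
    refine ⟨⌊y⌋, ?_, mem_cell_iff.2 rfl⟩
    by_contra h
    exact (disjoint_cell_of_notMem h).le_bot ⟨hw, mem_cell_iff.2 rfl⟩
  · intro i _ j _ hij
    rw [Function.onFun, Set.disjoint_left]
    intro y hy hy'
    exact hij ((mem_cell_iff.1 hy).symm.trans (mem_cell_iff.1 hy'))
  · exact fun i _ => Measure.integrableOn_of_bounded (measure_cell_ne_top ν i)
      hg.aestronglyMeasurable (ae_of_all _ hC)

lemma norm_exp_I_mul_sub_one_le (x : ℝ) : ‖Complex.exp (Complex.I * x) - 1‖ ≤ 2 := by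
  refine (norm_sub_le _ _).trans ?_
  rw [mul_comm, Complex.norm_exp_ofReal_mul_I, norm_one]
  norm_num

/-- A function supported in a window sees finitely many cells. These are independent and compound
Poisson, so their exponents add up to the integral over the line. -/
theorem hasPoissonCharFunctional_poissonLaw : HasPoissonCharFunctional ν (poissonLaw ν) := by
  intro f hf ⟨C, hC⟩ ⟨m, hm⟩
  have hmeas := measurable_integral_locFin hf hC hm
  rw [poissonLaw, integral_map measurable_superpose.aemeasurable
    (Measurable.aestronglyMeasurable (by fun_prop))]
  have h1 := integral_infinitePi_prod (cellLaw ν) (Finset.Ico (-(m : ℤ)) m)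
    (fun i p => Complex.exp (Complex.I *
      ((∑ k ∈ Finset.range p.1, (cell i).indicator f (p.2 k) : ℝ) : ℂ)))
    (fun i => by
      have := measurable_sum_range (hf.indicator (measurableSet_cell i))
      fun_prop)
  simp_rw [integral_cellLaw ν _ (hf.indicator (measurableSet_cell _)), ← Complex.exp_sum] at h1
  have h2 : ∀ ω, Complex.exp (Complex.I * ((∫ y, f y ∂(superpose ω).1 : ℝ) : ℂ)) =
      Complex.exp (∑ i ∈ Finset.Ico (-(m : ℤ)) m, Complex.I *
        ((∑ k ∈ Finset.range (ω i).1, (cell i).indicator f ((ω i).2 k) : ℝ) : ℂ)) := fun ω => by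
    rw [integral_superpose hf hC hm, Complex.ofReal_sum, Finset.mul_sum]
  rw [integral_congr_ae (ae_of_all _ h2), h1, ← sum_setIntegral_cell ν (m := m) (by fun_prop)
    (fun y => norm_exp_I_mul_sub_one_le _) (fun y hy => by simp [hm y hy])]
  congr 1
  refine Finset.sum_congr rfl fun i _ => setIntegral_congr_fun (measurableSet_cell i)
    fun y hy => ?_
  simp [Set.indicator_of_mem hy]

lemma isPoissonProcessLaw_poissonLaw : IsPoissonProcessLaw ν (poissonLaw ν) :=
  (hasPoissonCharFunctional_poissonLaw ν).isPoissonProcessLaw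

lemma charFunctional_poissonLaw (φ : C_c(ℝ, ℝ)) : charFunctional (poissonLaw ν) φ =
    Complex.exp (∫ y, (Complex.exp (Complex.I * φ y) - 1) ∂ν) :=
  hasPoissonCharFunctional_poissonLaw ν φ φ.continuous.measurable (exists_bound_of_cc φ)
    (exists_window_of_cc φ)

/-! ### Convergence of finite point processes -/

lemma continuous_pointMeasure {ι : Type*} [Fintype ι] :
    Continuous (pointMeasure : (ι → ℝ) → LocFinMeasure) := by
  refine continuous_induced_rng.2 (continuous_pi fun φ => ?_)
  have : ∀ y : ι → ℝ, ∫ z, φ z ∂(∑ i, Measure.dirac (y i)) = ∑ i, φ (y i) := fun y => by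
    rw [integral_finsetSum_measure fun i _ => by
      exact φ.continuous.integrable_of_hasCompactSupport φ.hasCompactSupport]
    simp [integral_dirac]
  change Continuous fun y : ι → ℝ => ∫ z, φ z ∂(∑ i, Measure.dirac (y i))
  simp_rw [this]
  fun_prop

lemma integral_pointMeasure {ι : Type*} [Fintype ι] (y : ι → ℝ) (φ : C_c(ℝ, ℝ)) :
    ∫ z, φ z ∂(pointMeasure y).1 = ∑ i, φ (y i) := by
  change ∫ z, φ z ∂(∑ i, Measure.dirac (y i)) = _
  rw [integral_finsetSum_measure fun i _ => by
    exact φ.continuous.integrable_of_hasCompactSupport φ.hasCompactSupport]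
  simp [integral_dirac]

variable {ν} in
/-- Convergence to a Poisson point process from convergence of characteristic functionals. -/
theorem tendstoPPP_pointMeasure {Ω : ℕ → Type*} [∀ α, MeasurableSpace (Ω α)]
    (P : ∀ α, Measure (Ω α)) [∀ α, IsProbabilityMeasure (P α)] {ι : ℕ → Type*}
    [∀ α, Fintype (ι α)] (y : ∀ α, Ω α → ι α → ℝ) (hy : ∀ α, AEMeasurable (y α) (P α))
    (h : ∀ φ : C_c(ℝ, ℝ), Tendsto
      (fun α => ∫ ω, ∏ i, Complex.exp (Complex.I * φ (y α ω i)) ∂P α) atTop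
      (𝓝 (Complex.exp (∫ z, (Complex.exp (Complex.I * φ z) - 1) ∂ν)))) :
    TendstoPPP P (fun α ω => pointMeasure (y α ω)) ν := by
  have hae : ∀ α, AEMeasurable (fun ω => pointMeasure (y α ω)) (P α) := fun α =>
    continuous_pointMeasure.measurable.comp_aemeasurable (hy α)
  refine ⟨poissonLaw ν, inferInstance, isPoissonProcessLaw_poissonLaw ν, hae,
    aemeasurable_id, tendsto_of_tendsto_charFunctional fun φ => ?_⟩
  simp only [ProbabilityMeasure.coe_mk, Measure.map_id, charFunctional_poissonLaw]
  refine (h φ).congr fun α => ?_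
  have hm : Measurable fun μ : LocFinMeasure => ∫ y, φ y ∂μ.1 :=
    (continuous_integral_locFin φ).measurable
  rw [charFunctional, integral_map (hae α) (Measurable.aestronglyMeasurable (by fun_prop))]
  refine integral_congr_ae (ae_of_all _ fun ω => ?_)
  simp only [integral_pointMeasure, ← Complex.exp_sum]
  push_cast
  rw [Finset.mul_sum]

/-! ### Hierarchical Gaussian fields -/

/-- The number of spins in the first `k` blocks. -/
def blockSum (d : ℕ → ℕ) : ℕ → ℕ
  | 0 => 0
  | k + 1 => blockSum d k + d k

section Blocks

variable {d : ℕ → ℕ} {k : ℕ}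

/-- Appending a block of spins. -/
def joinSpins (u : Spins (blockSum d k)) (v : Spins (d k)) : Spins (blockSum d (k + 1)) :=
  Fin.append (m := blockSum d k) (n := d k) u v

/-- The spins of the first `k` blocks. -/
def headSpins (σ : Spins (blockSum d (k + 1))) : Spins (blockSum d k) :=
  fun i => σ (Fin.castAdd (d k) i)

/-- The spins of the last block. -/
def tailSpins (σ : Spins (blockSum d (k + 1))) : Spins (d k) :=
  fun i => σ (Fin.natAdd (blockSum d k) i)

lemma headSpins_join (u : Spins (blockSum d k)) (v : Spins (d k)) :
    headSpins (joinSpins u v) = u :=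
  funext fun i => Fin.append_left u v i

lemma tailSpins_join (u : Spins (blockSum d k)) (v : Spins (d k)) :
    tailSpins (joinSpins u v) = v :=
  funext fun i => Fin.append_right u v i

lemma prod_join {M : Type*} [CommMonoid M] (g : Spins (blockSum d (k + 1)) → M) :
    ∏ σ, g σ = ∏ u, ∏ v, g (joinSpins u v) := by
  rw [← Fintype.prod_prod_type']
  exact (Fintype.prod_equiv (Fin.appendEquiv (blockSum d k) (d k)) _ _ fun _ => rfl).symm

lemma sum_join {M : Type*} [AddCommMonoid M] (g : Spins (blockSum d (k + 1)) → M) :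
    ∑ σ, g σ = ∑ u, ∑ v, g (joinSpins u v) := by
  rw [← Fintype.sum_prod_type']
  exact (Fintype.sum_equiv (Fin.appendEquiv (blockSum d k) (d k)) _ _ fun _ => rfl).symm

end Blocks

/-- The law of the hierarchical Gaussian field with block sizes `d` and level variances `a`:
at level `k` an independent centered Gaussian of variance `a k` is added for each configuration of
the first `k + 1` blocks. -/
def treeLaw (d : ℕ → ℕ) (a : ℕ → NNReal) : ∀ k, Measure (Spins (blockSum d k) → ℝ)
  | 0 => Measure.dirac 0
  | k + 1 => ((treeLaw d a k).prod
      (Measure.pi fun _ : Spins (blockSum d (k + 1)) => gaussianReal 0 (a k))).map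
      fun p σ => p.1 (headSpins (d := d) (k := k) σ) + p.2 σ

lemma measurable_treeStep (d : ℕ → ℕ) (k : ℕ) :
    Measurable fun (p : (Spins (blockSum d k) → ℝ) × (Spins (blockSum d (k + 1)) → ℝ)) σ =>
      p.1 (headSpins (d := d) (k := k) σ) + p.2 σ :=
  measurable_pi_lambda _ fun _ => ((measurable_pi_apply _).comp measurable_fst).add
    ((measurable_pi_apply _).comp measurable_snd)

instance (d : ℕ → ℕ) (a : ℕ → NNReal) (k : ℕ) : IsProbabilityMeasure (treeLaw d a k) := by
  induction k with
  | zero => unfold treeLaw; infer_instance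
  | succ k ih =>
    unfold treeLaw
    exact Measure.isProbabilityMeasure_map (measurable_treeStep d k).aemeasurable

/-- Given the first `k` levels, the variables added at the last level are independent, so the inner
integral is a product over configurations. -/
lemma integral_treeLaw_succ (d : ℕ → ℕ) (a : ℕ → NNReal) (k : ℕ)
    (F : Spins (blockSum d (k + 1)) → ℝ → ℂ) (hF : ∀ σ, Measurable (F σ))
    (hF1 : ∀ σ x, ‖F σ x‖ ≤ 1) :
    ∫ X, ∏ σ, F σ (X σ) ∂treeLaw d a (k + 1) =
      ∫ X, ∏ u, ∏ v : Spins (d k), ∫ z, F (joinSpins u v) (X u + z) ∂gaussianReal 0 (a k)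
        ∂treeLaw d a k := by
  have hm : Measurable fun X : Spins (blockSum d (k + 1)) → ℝ => ∏ σ, F σ (X σ) :=
    Finset.measurable_prod _ fun σ _ => (hF σ).comp (measurable_pi_apply σ)
  conv_lhs => unfold treeLaw
  rw [integral_map (measurable_treeStep d k).aemeasurable hm.aestronglyMeasurable, integral_prod]
  · refine integral_congr_ae (ae_of_all _ fun X => ?_)
    beta_reduce
    rw [integral_fintype_prod_eq_prod (𝕜 := ℂ) (μ := fun _ => gaussianReal 0 (a k))
      fun σ z => F σ (X (headSpins σ) + z), prod_join]
    simp_rw [headSpins_join]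
  · refine Integrable.of_bound (hm.comp (measurable_treeStep d k)).aestronglyMeasurable 1
      (ae_of_all _ fun p => ?_)
    rw [norm_prod]
    exact Finset.prod_le_one (fun _ _ => norm_nonneg _) fun σ _ => hF1 σ _

/-- The covariance of the hierarchical field. -/
def treeCov (d : ℕ → ℕ) (a : ℕ → NNReal) (k : ℕ) {M : ℕ} (σ τ : Spins M) : ℝ := by
  classical
  exact ∑ j ∈ Finset.range k,
    if ∀ i : Fin M, (i : ℕ) < blockSum d (j + 1) → σ i = τ i then (a j : ℝ) else 0

lemma blockSum_mono (d : ℕ → ℕ) : Monotone (blockSum d) :=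
  monotone_nat_of_le_succ fun _ => Nat.le_add_right _ _

open Classical in
lemma treeCov_succ (d : ℕ → ℕ) (a : ℕ → NNReal) (k : ℕ) (u u' : Spins (blockSum d k))
    (v v' : Spins (d k)) :
    treeCov d a (k + 1) (joinSpins u v) (joinSpins u' v') =
      treeCov d a k u u' + if u = u' ∧ v = v' then (a k : ℝ) else 0 := by
  unfold treeCov
  rw [Finset.sum_range_succ]
  congr 1
  · refine Finset.sum_congr rfl fun j hj => ?_
    have hj' : blockSum d (j + 1) ≤ blockSum d k :=
      blockSum_mono d (Nat.succ_le_of_lt (Finset.mem_range.1 hj))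
    congr 1
    refine propext ⟨fun h i hi => ?_, fun h i hi => ?_⟩
    · exact (Fin.append_left u v i).symm.trans
        ((h (Fin.castAdd (d k) i) hi).trans (Fin.append_left u' v' i))
    · have := h ⟨i, hi.trans_le hj'⟩ hi
      have hi' : i = Fin.castAdd (d k) ⟨i, hi.trans_le hj'⟩ := rfl
      rw [hi']
      exact (Fin.append_left u v _).trans (this.trans (Fin.append_left u' v' _).symm)
  · congr 1
    refine propext ⟨fun h => ?_, ?_⟩
    · have h2 : joinSpins u v = joinSpins u' v' := funext fun i => h i i.2
      have h3 := (Fin.appendEquiv (blockSum d k) (d k)).injective (a₁ := (u, v)) (a₂ := (u', v')) h2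
      exact ⟨congrArg Prod.fst h3, congrArg Prod.snd h3⟩
    · rintro ⟨rfl, rfl⟩ i _
      rfl

lemma integral_exp_gaussianReal (v : NNReal) (t x : ℝ) :
    ∫ z, Complex.exp (Complex.I * ((t * (x + z) : ℝ) : ℂ)) ∂gaussianReal 0 v =
      Complex.exp (Complex.I * (t * x : ℝ)) * Complex.exp ((-(1 / 2 * (v * t ^ 2)) : ℝ) : ℂ) := by
  have h := charFun_gaussianReal (μ := 0) (v := v) t
  rw [charFun_apply_real] at h
  have h2 : ∀ z : ℝ, Complex.exp (Complex.I * ((t * (x + z) : ℝ) : ℂ)) =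
      Complex.exp (Complex.I * (t * x : ℝ)) * Complex.exp (t * z * Complex.I) := fun z => by
    rw [← Complex.exp_add]
    push_cast
    ring_nf
  simp_rw [h2]
  rw [integral_const_mul, h]
  congr 2
  push_cast
  ring

/-- Integrating out the last level produces its Gaussian factor and replaces the coefficient of `u`
by the sum of `t` over all continuations of `u`, to which the induction hypothesis applies. -/
lemma charFun_treeLaw (d : ℕ → ℕ) (a : ℕ → NNReal) (k : ℕ) (t : Spins (blockSum d k) → ℝ) :
    ∫ X, ∏ σ, Complex.exp (Complex.I * (t σ * X σ : ℝ)) ∂treeLaw d a k =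
      Complex.exp ((-(1 / 2 * ∑ σ, ∑ τ, t σ * t τ * treeCov d a k σ τ) : ℝ) : ℂ) := by
  classical
  induction k with
  | zero => simp [treeLaw, treeCov]
  | succ k ih =>
    rw [integral_treeLaw_succ d a k (fun σ x => Complex.exp (Complex.I * (t σ * x : ℝ)))
      (fun σ => by fun_prop) (fun σ x => by rw [mul_comm, Complex.norm_exp_ofReal_mul_I])]
    set T : Spins (blockSum d k) → Spins (d k) → ℝ := fun u v => t (joinSpins u v)
    have h1 : ∀ X : Spins (blockSum d k) → ℝ, ∏ u, ∏ v : Spins (d k),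
        ∫ z, Complex.exp (Complex.I * (t (joinSpins u v) * (X u + z) : ℝ)) ∂gaussianReal 0 (a k) =
        Complex.exp ((-(1 / 2 * ∑ u, ∑ v, a k * T u v ^ 2) : ℝ) : ℂ) *
          ∏ u, Complex.exp (Complex.I * ((∑ v, T u v) * X u : ℝ)) := fun X => by
      simp_rw [integral_exp_gaussianReal, Finset.prod_mul_distrib, ← Complex.exp_sum]
      rw [mul_comm]
      congr 2
      · push_cast
        simp_rw [Finset.mul_sum, Finset.sum_neg_distrib]
        rfl
      · refine Finset.sum_congr rfl fun u _ => ?_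
        push_cast
        rw [Finset.sum_mul, Finset.mul_sum]
    simp_rw [h1]
    rw [integral_const_mul, ih, ← Complex.exp_add, ← Complex.ofReal_add]
    congr 2
    have h2 : ∑ σ, ∑ τ, t σ * t τ * treeCov d a (k + 1) σ τ =
        ∑ u, ∑ v, ∑ u', ∑ v', (T u v * T u' v' * treeCov d a k u u' +
          T u v * T u' v' * if u = u' ∧ v = v' then (a k : ℝ) else 0) := by
      rw [sum_join]
      refine Finset.sum_congr rfl fun u _ => Finset.sum_congr rfl fun v _ => ?_
      rw [sum_join]
      refine Finset.sum_congr rfl fun u' _ => Finset.sum_congr rfl fun v' _ => ?_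
      rw [treeCov_succ, mul_add]
    rw [h2, ← neg_add, ← mul_add]
    congr 2
    simp_rw [Finset.sum_add_distrib]
    rw [add_comm]
    congr 1
    · refine Finset.sum_congr rfl fun u _ => ?_
      rw [Finset.sum_comm]
      refine Finset.sum_congr rfl fun u' _ => ?_
      rw [Finset.sum_mul_sum, Finset.sum_mul]
      refine Finset.sum_congr rfl fun v _ => ?_
      rw [Finset.sum_mul]
    · refine Finset.sum_congr rfl fun u _ => Finset.sum_congr rfl fun v _ => ?_
      rw [Finset.sum_eq_single u, Finset.sum_eq_single v]
      · simp; ring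
      · intro v' _ hv'; simp [hv'.symm]
      · simp
      · intro u' _ hu'; simp [hu'.symm]
      · simp

/-! ### The law of a Gaussian process with hierarchical covariance -/

/-- A centered Gaussian law is determined by its covariance. Any realization of the process may
therefore be replaced by the explicit tree construction. -/
theorem map_eq_treeLaw {Ω : Type*} [MeasurableSpace Ω] {P : Measure Ω} [IsProbabilityMeasure P]
    (d : ℕ → ℕ) (a : ℕ → NNReal) (k : ℕ) {G : Spins (blockSum d k) → Ω → ℝ}
    (hG : IsGaussianProcess G P) (h0 : ∀ σ, ∫ ω, G σ ω ∂P = 0)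
    (hcov : ∀ σ τ, ∫ ω, G σ ω * G τ ω ∂P = treeCov d a k σ τ) :
    P.map (fun ω σ => G σ ω) = treeLaw d a k := by
  classical
  have hm : AEMeasurable (fun ω σ => G σ ω) P := aemeasurable_pi_lambda _ fun σ => hG.aemeasurable σ
  have := Measure.isProbabilityMeasure_map hm
  refine Measure.ext_of_charFunDual (funext fun L => ?_)
  set t : Spins (blockSum d k) → ℝ := fun σ => L (Pi.single σ 1) with ht
  have hL : ∀ x, L x = ∑ σ, t σ * x σ := fun x => by
    conv_lhs => rw [pi_eq_sum_univ' x]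
    rw [map_sum]
    refine Finset.sum_congr rfl fun σ _ => ?_
    rw [map_smul, smul_eq_mul, mul_comm]
  have hR : charFunDual (treeLaw d a k) L =
      Complex.exp ((-(1 / 2 * ∑ σ, ∑ τ, t σ * t τ * treeCov d a k σ τ) : ℝ) : ℂ) := by
    rw [← charFun_treeLaw, charFunDual_apply]
    refine integral_congr_ae (ae_of_all _ fun X => ?_)
    beta_reduce
    rw [hL, ← Complex.exp_sum]
    push_cast
    rw [Finset.sum_mul]
    simp_rw [mul_comm Complex.I]
  rw [hR]
  have hsum : HasGaussianLaw (fun ω => ∑ σ, t σ * G σ ω) P :=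
    (hG.smul t).hasGaussianLaw_fun_sum (I := Finset.univ)
  have hmean : ∫ ω, ∑ σ, t σ * G σ ω ∂P = 0 := by
    rw [integral_finsetSum _ fun σ _ => ((hG.hasGaussianLaw_eval σ).integrable).const_mul _]
    simp [integral_const_mul, h0]
  have hvar : Var[fun ω => ∑ σ, t σ * G σ ω; P] =
      ∑ σ, ∑ τ, t σ * t τ * treeCov d a k σ τ := by
    rw [variance_of_integral_eq_zero hsum.aemeasurable hmean]
    have h1 : ∀ ω, (∑ σ, t σ * G σ ω) ^ 2 = ∑ σ, ∑ τ, t σ * t τ * (G σ ω * G τ ω) := fun ω => by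
      rw [sq, Finset.sum_mul_sum]
      refine Finset.sum_congr rfl fun σ _ => Finset.sum_congr rfl fun τ _ => by ring
    have hint : ∀ σ τ, Integrable (fun ω => t σ * t τ * (G σ ω * G τ ω)) P := fun σ τ =>
      ((hG.hasGaussianLaw_eval σ).memLp_two.integrable_mul
        (hG.hasGaussianLaw_eval τ).memLp_two).const_mul _
    simp_rw [h1]
    rw [integral_finsetSum _ fun σ _ => integrable_finsetSum _ fun τ _ => hint σ τ]
    refine Finset.sum_congr rfl fun σ _ => ?_
    rw [integral_finsetSum _ fun τ _ => hint σ τ]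
    refine Finset.sum_congr rfl fun τ _ => ?_
    rw [integral_const_mul, hcov]
  have hchar := hsum.charFun_map_eq 1
  rw [charFunDual_apply, integral_map hm (Measurable.aestronglyMeasurable (by fun_prop))]
  rw [charFun_apply_real, integral_map hsum.aemeasurable
    (Measurable.aestronglyMeasurable (by fun_prop))] at hchar
  simp only [hL]
  simp only [Complex.ofReal_one, one_mul, RCLike.inner_apply, conj_trivial, mul_one, hmean, hvar] at hchar
  rw [hchar]
  congr 1
  push_cast
  ring

/-! ### The branching recursion -/

/-- Backward iteration: `backward T F n n = F` and `backward T F n k = T k (backward T F n (k + 1))`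
for `k < n`. -/
def backward {X : Type*} (T : ℕ → X → X) (F : X) (n k : ℕ) : X :=
  Nat.rec F (fun r x => T (n - 1 - r) x) (n - k)

lemma backward_self {X : Type*} (T : ℕ → X → X) (F : X) (n : ℕ) : backward T F n n = F := by
  simp [backward]

lemma backward_of_lt {X : Type*} (T : ℕ → X → X) (F : X) {n k : ℕ} (hk : k < n) :
    backward T F n k = T k (backward T F n (k + 1)) := by
  unfold backward
  rw [show n - k = (n - (k + 1)) + 1 by omega]
  change T (n - 1 - (n - (k + 1))) _ = _
  rw [show n - 1 - (n - (k + 1)) = k by omega]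

lemma backward_induction {X : Type*} {T : ℕ → X → X} {F : X} {n : ℕ} {p : ℕ → X → Prop}
    (h0 : p n F) (hs : ∀ k < n, ∀ x, p (k + 1) x → p k (T k x)) {k : ℕ} (hk : k ≤ n) :
    p k (backward T F n k) := by
  induction hk using Nat.decreasingInduction with
  | self => rwa [backward_self]
  | of_succ k hk ih => rw [backward_of_lt T F hk]; exact hs k hk _ ih

section Recursion

variable (d : ℕ → ℕ) (a : ℕ → NNReal) (b : ∀ k, Spins (d k) → ℝ)

/-- One step of the branching recursion. -/
def branchStep (k : ℕ) (Ψ : ℝ → ℂ) (s : ℝ) : ℂ :=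
  ∏ v : Spins (d k), ∫ y, Ψ (s + y) ∂gaussianReal (b k v) (a k)

/-- Measurable functions with values in the closed unit disc. -/
def IsDiscValued (Ψ : ℝ → ℂ) : Prop := Measurable Ψ ∧ ∀ s, ‖Ψ s‖ ≤ 1

lemma measurable_integral_add {E : Type*} [NormedAddCommGroup E] [NormedSpace ℝ E]
    [MeasurableSpace E] [BorelSpace E] [SecondCountableTopology E]
    {f : ℝ → E} (hf : Measurable f) (μ : Measure ℝ) [SFinite μ] :
    Measurable fun s => ∫ y, f (s + y) ∂μ := by
  have h : StronglyMeasurable fun p : ℝ × ℝ => f (p.1 + p.2) :=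
    (hf.comp (measurable_fst.add measurable_snd)).stronglyMeasurable
  exact (h.integral_prod_right' (ν := μ)).measurable

lemma IsDiscValued.norm_integral_le {Ψ : ℝ → ℂ} (h : IsDiscValued Ψ) (s : ℝ) (μ : Measure ℝ)
    [IsProbabilityMeasure μ] : ‖∫ y, Ψ (s + y) ∂μ‖ ≤ 1 := by
  simpa using norm_integral_le_of_norm_le_const (μ := μ) (ae_of_all _ fun y => h.2 (s + y))

lemma IsDiscValued.branchStep {Ψ : ℝ → ℂ} (h : IsDiscValued Ψ) (k : ℕ) :
    IsDiscValued (branchStep d a b k Ψ) := by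
  refine ⟨Finset.measurable_prod _ fun v _ => measurable_integral_add h.1 _, fun s => ?_⟩
  rw [GREM.branchStep, norm_prod]
  exact Finset.prod_le_one (fun _ _ => norm_nonneg _) fun v _ => h.norm_integral_le s _

lemma IsDiscValued.backward {F : ℝ → ℂ} (h : IsDiscValued F) {n k : ℕ} (hk : k ≤ n) :
    IsDiscValued (backward (GREM.branchStep d a b) F n k) :=
  backward_induction (p := fun _ Ψ => IsDiscValued Ψ) h (fun k _ _ hx => hx.branchStep d a b k) hk

/-- The sum of the fields over the first `k` blocks. -/
def fieldSum : ∀ k, Spins (blockSum d k) → ℝ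
  | 0, _ => 0
  | k + 1, σ => fieldSum k (headSpins σ) + b k (tailSpins σ)

/-- The tower property along the tree: conditionally on the first `k` levels, the subtrees below
distinct configurations are independent. A deterministic field is absorbed as the mean of the
Gaussian increment. -/
theorem integral_treeLaw_eq_backward {F : ℝ → ℂ} (hF : IsDiscValued F) {n k : ℕ} (hk : k ≤ n) :
    ∫ X, ∏ σ, backward (branchStep d a b) F n k (X σ + fieldSum d b k σ) ∂treeLaw d a k =
      backward (branchStep d a b) F n 0 0 := by
  induction k with
  | zero =>
    have : Unique (Spins (blockSum d 0)) := inferInstanceAs (Unique (Fin 0 → ℤˣ))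
    rw [treeLaw, integral_dirac]
    simp [fieldSum]
  | succ k ih =>
    have hΨ := hF.backward d a b hk
    rw [integral_treeLaw_succ d a k
      (fun σ x => backward (branchStep d a b) F n (k + 1) (x + fieldSum d b (k + 1) σ))
      (fun σ => hΨ.1.comp (measurable_id.add_const _)) (fun σ x => hΨ.2 _),
      ← ih (Nat.le_of_succ_le hk)]
    refine integral_congr_ae (ae_of_all _ fun X => ?_)
    beta_reduce
    refine Finset.prod_congr rfl fun u _ => ?_
    rw [backward_of_lt _ _ (Nat.lt_of_succ_le hk), branchStep]
    refine Finset.prod_congr rfl fun v _ => ?_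
    have h1 : gaussianReal (b k v) (a k) = (gaussianReal 0 (a k)).map (b k v + ·) := by
      rw [gaussianReal_map_const_add, zero_add]
    have h2 : Measurable fun y => backward (branchStep d a b) F n (k + 1)
        (X u + fieldSum d b k u + y) := hΨ.1.comp (measurable_const.add measurable_id)
    rw [h1, integral_map (f := fun y => backward (branchStep d a b) F n (k + 1)
      (X u + fieldSum d b k u + y)) (measurable_const_add (b k v)).aemeasurable
      h2.aestronglyMeasurable]
    refine integral_congr_ae (ae_of_all _ fun z => ?_)
    simp only [fieldSum, headSpins_join, tailSpins_join]
    exact congrArg (backward (branchStep d a b) F n (k + 1)) (by ring)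

end Recursion

/-- The numerical value of a spin. -/
def spin (v : ℤˣ) : ℝ := ((v : ℤ) : ℝ)

/-- The centered field `∑ c (v_i - t)`. -/
def centeredField (c t : ℝ) {d : ℕ} (v : Spins d) : ℝ := ∑ i, c * (spin (v i) - t)

/-- The level-wise centerings add up to the leading order of the maximum. With unit total variance,
`lam = β √N`, `c = h / √N` and `t = tanh (βh)`, the subtracted amount is `M(h) √N`. -/
lemma fieldSum_eq (d : ℕ → ℕ) (a : ℕ → NNReal) (c t lam : ℝ) (k : ℕ) (σ : Spins (blockSum d k)) :
    fieldSum d (fun k v => centeredField c t v - lam * a k) k σ =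
      c * ∑ i, spin (σ i) - c * t * (blockSum d k : ℕ) - lam * ∑ j ∈ Finset.range k, (a j : ℝ) := by
  induction k with
  | zero =>
    have : IsEmpty (Fin (blockSum d 0)) := inferInstanceAs (IsEmpty (Fin 0))
    have h : ∑ i, spin (σ i) = 0 := Finset.sum_eq_zero fun i _ => isEmptyElim i
    rw [h]
    simp [fieldSum, blockSum]
  | succ k ih =>
    have h1 : ∑ i, spin (σ i) = ∑ i, spin (headSpins σ i) + ∑ i, spin (tailSpins σ i) :=
      Fin.sum_univ_add (a := blockSum d k) (b := d k) fun i => spin (σ i)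
    rw [fieldSum, ih, h1, Finset.sum_range_succ, centeredField]
    simp_rw [mul_sub]
    rw [Finset.sum_sub_distrib, ← Finset.mul_sum, Finset.sum_const, Finset.card_univ,
      Fintype.card_fin, nsmul_eq_mul]
    have h2 : ((blockSum d (k + 1) : ℕ) : ℝ) = blockSum d k + d k := by simp [blockSum]
    rw [h2]
    ring

/-- The characteristic functional of a process with hierarchical covariance and an external field,
in centered coordinates. -/
theorem integral_prod_energy {Ω : Type*} [MeasurableSpace Ω] {P : Measure Ω}
    [IsProbabilityMeasure P] {N : ℕ} {G : Spins N → Ω → ℝ} (hG : IsGaussianProcess G P)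
    (h0 : ∀ σ, ∫ ω, G σ ω ∂P = 0) (d : ℕ → ℕ) (a : ℕ → NNReal) (n : ℕ) (hN : N = blockSum d n)
    (hcov : ∀ σ τ, ∫ ω, G σ ω * G τ ω ∂P = treeCov d a n σ τ)
    {F : ℝ → ℂ} (hF : IsDiscValued F) (c t lam : ℝ) :
    ∫ ω, ∏ σ, F (G σ ω + (c * ∑ i, spin (σ i) - c * t * N -
        lam * ∑ j ∈ Finset.range n, (a j : ℝ))) ∂P =
      backward (branchStep d a fun k v => centeredField c t v - lam * a k) F n 0 0 := by
  subst hN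
  have hm : AEMeasurable (fun ω σ => G σ ω) P := aemeasurable_pi_lambda _ fun σ => hG.aemeasurable σ
  rw [← integral_treeLaw_eq_backward d a _ hF le_rfl, ← map_eq_treeLaw d a n hG h0 hcov,
    integral_map hm]
  · simp_rw [backward_self, fieldSum_eq]
  · simp_rw [backward_self]
    exact (Finset.measurable_prod _ fun σ _ =>
      hF.1.comp ((measurable_pi_apply σ).add_const _)).aestronglyMeasurable

/-! ### The covariance of the GREM -/

lemma lexOverlap_ge_iff {N : ℕ} (hN : 0 < N) (σ τ : Spins N) {m : ℕ} (hm : m ≤ N) {x : ℝ}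
    (hx : x * N = m) : x ≤ lexOverlap σ τ ↔ ∀ i : Fin N, (i : ℕ) < m → σ i = τ i := by
  classical
  have hN' : (0 : ℝ) < N := by exact_mod_cast hN
  rw [lexOverlap, le_div_iff₀ hN', hx, Nat.cast_le]
  constructor
  · intro h i hi
    have h2 := Nat.findGreatest_spec (P := fun k => ∀ i : Fin N, (i : ℕ) < k → σ i = τ i)
      (Nat.zero_le N) (fun i hi => absurd hi (Nat.not_lt_zero _))
    refine h2 i (hi.trans_le ?_)
    convert h
  · intro h
    have := Nat.le_findGreatest (P := fun k => ∀ i : Fin N, (i : ℕ) < k → σ i = τ i) hm h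
    convert this

-- The jump of `ϱ` at 1 is shared between the levels `n` and `n + 1`. Level `n + 1` has no spins, so
-- both contribute exactly when the two configurations agree in all coordinates.
open Classical in
lemma treeCov_eq_toFun {n : ℕ} (ϱ : OrderParameter (n + 1)) {N : ℕ} (hN : 0 < N) (d : ℕ → ℕ)
    (a : ℕ → NNReal) (hd : ∀ k ≤ n + 1, ϱ.x k * N = blockSum d k) (hd' : d (n + 1) = 0)
    (ha : ∀ k < n, (a k : ℝ) = ϱ.q (k + 1) - ϱ.q k) (ha' : (a n : ℝ) + a (n + 1) = 1 - ϱ.q n)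
    (σ τ : Spins N) : treeCov d a (n + 2) σ τ = ϱ.toFun (lexOverlap σ τ) := by
  have hxle : ∀ k ≤ n + 1, ϱ.x k ≤ 1 := fun k hk => by
    rw [← ϱ.x_last]
    exact ϱ.x_strictMono.monotoneOn (Set.mem_Iic.2 hk) (Set.mem_Iic.2 le_rfl) hk
  have hiff : ∀ k ≤ n + 1, ϱ.x k ≤ lexOverlap σ τ ↔
      ∀ i : Fin N, (i : ℕ) < blockSum d k → σ i = τ i := fun k hk => by
    refine lexOverlap_ge_iff hN σ τ ?_ (hd k hk)
    have h1 : ((blockSum d k : ℕ) : ℝ) ≤ N := by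
      rw [← hd k hk]
      exact mul_le_of_le_one_left (Nat.cast_nonneg _) (hxle k hk)
    exact_mod_cast h1
  have hlast : blockSum d (n + 2) = blockSum d (n + 1) := by
    change blockSum d (n + 1) + d (n + 1) = _
    rw [hd', add_zero]
  have h1 : ϱ.toFun (lexOverlap σ τ) = ∑ j ∈ Finset.range (n + 1),
      if ϱ.x (j + 1) ≤ lexOverlap σ τ then ϱ.q (j + 1) - ϱ.q j else 0 := by
    rw [OrderParameter.toFun, Finset.range_eq_Ico]
    exact (Finset.sum_Ico_add' (fun k => if ϱ.x k ≤ lexOverlap σ τ then ϱ.q k - ϱ.q (k - 1) else 0)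
      0 (n + 1) 1).symm
  rw [h1, treeCov, Finset.sum_range_succ, Finset.sum_range_succ, Finset.sum_range_succ, hlast,
    add_assoc]
  congr 1
  · refine Finset.sum_congr rfl fun j hj => ?_
    have hj' := Finset.mem_range.1 hj
    simp_rw [hiff (j + 1) (by omega), ha j hj']
  · simp_rw [hiff (n + 1) le_rfl]
    have hq : ϱ.q (n + 1) - ϱ.q n = a n + a (n + 1) := by rw [ha', ϱ.q_last]
    rw [hq]
    split_ifs <;> simp

/-! ### The critical inverse temperature -/

/-- The entropy `log (2 cosh u) - u tanh u` of a tilted spin. -/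
def spinEntropy (u : ℝ) : ℝ := Real.log (2 * Real.cosh u) - u * Real.tanh u

lemma continuous_tanh : Continuous Real.tanh := by
  have : Real.tanh = fun x => Real.sinh x / Real.cosh x := funext Real.tanh_eq_sinh_div_cosh
  rw [this]
  exact Real.continuous_sinh.div Real.continuous_cosh fun x => (Real.cosh_pos x).ne'

lemma tanh_monotone : Monotone Real.tanh := by
  intro u v huv
  have hu := Real.cosh_pos u
  have hv := Real.cosh_pos v
  rw [Real.tanh_eq_sinh_div_cosh, Real.tanh_eq_sinh_div_cosh, div_le_div_iff₀ hu hv]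
  have h := Real.sinh_nonneg_iff.2 (sub_nonneg.2 huv)
  rw [Real.sinh_sub] at h
  linarith

lemma one_add_tanh (u : ℝ) : 1 + Real.tanh u = Real.exp u / Real.cosh u := by
  rw [Real.tanh_eq_sinh_div_cosh, ← Real.cosh_add_sinh, add_div, div_self (Real.cosh_pos u).ne']

lemma one_sub_tanh (u : ℝ) : 1 - Real.tanh u = Real.exp (-u) / Real.cosh u := by
  rw [Real.tanh_eq_sinh_div_cosh, ← Real.cosh_sub_sinh, sub_div, div_self (Real.cosh_pos u).ne']

/-- The pointwise inequality behind strict positivity of relative entropy. The value `x = 0` is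
admitted because the endpoints `s = ±1` need it. -/
lemma sub_lt_mul_log_sub {x y : ℝ} (hx : 0 ≤ x) (hy : 0 < y) (hne : x ≠ y) :
    x - y < x * (Real.log x - Real.log y) := by
  rcases hx.eq_or_lt with rfl | hx
  · simpa using hy
  · have h1 : Real.log (y / x) < y / x - 1 :=
      Real.log_lt_sub_one_of_pos (div_pos hy hx) fun h => hne ((div_eq_one_iff_eq hx.ne').1 h).symm
    rw [Real.log_div hy.ne' hx.ne'] at h1
    have h2 := mul_lt_mul_of_pos_left h1 hx
    have h3 : x * (y / x - 1) = y - x := by field_simp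
    linarith

/-- Strict Young inequality for the Cramér entropy. -/
lemma mul_lt_cramerEntropy_add {s u : ℝ} (hs : s ∈ Set.Icc (-1 : ℝ) 1) (hne : s ≠ Real.tanh u) :
    u * s < cramerEntropy s + Real.log (Real.cosh u) := by
  have ht := abs_lt.1 (Real.abs_tanh_lt_one u)
  have h1 := sub_lt_mul_log_sub (x := 1 + s) (y := 1 + Real.tanh u) (by linarith [hs.1])
    (by linarith [ht.1]) fun h => hne (by linarith)
  have h2 := sub_lt_mul_log_sub (x := 1 - s) (y := 1 - Real.tanh u) (by linarith [hs.2])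
    (by linarith [ht.2]) fun h => hne (by linarith)
  rw [one_add_tanh, Real.log_div (Real.exp_pos _).ne' (Real.cosh_pos u).ne', Real.log_exp,
    ← one_add_tanh] at h1
  rw [one_sub_tanh, Real.log_div (Real.exp_pos _).ne' (Real.cosh_pos u).ne', Real.log_exp,
    ← one_sub_tanh] at h2
  rw [cramerEntropy]
  linarith

lemma cramerEntropy_nonneg {s : ℝ} (hs : s ∈ Set.Icc (-1 : ℝ) 1) : 0 ≤ cramerEntropy s := by
  by_cases h : s = Real.tanh 0
  · simp [h, cramerEntropy]
  · simpa using (mul_lt_cramerEntropy_add hs h).le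

lemma cramerEntropy_le_log_two {s : ℝ} (hs : s ∈ Set.Icc (-1 : ℝ) 1) :
    cramerEntropy s ≤ Real.log 2 := by
  have aux : ∀ x : ℝ, 0 ≤ x → x ≤ 2 → x * Real.log x ≤ x * Real.log 2 := fun x h0 h2 => by
    rcases h0.eq_or_lt with rfl | h0
    · simp
    · exact mul_le_mul_of_nonneg_left (Real.log_le_log h0 h2) h0.le
  have h1 := aux (1 - s) (by linarith [hs.2]) (by linarith [hs.1])
  have h2 := aux (1 + s) (by linarith [hs.1]) (by linarith [hs.2])
  rw [cramerEntropy]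
  linarith

lemma cramerEntropy_tanh (u : ℝ) :
    cramerEntropy (Real.tanh u) = u * Real.tanh u - Real.log (Real.cosh u) := by
  rw [cramerEntropy, one_add_tanh, one_sub_tanh, Real.log_div (Real.exp_pos _).ne' (Real.cosh_pos u).ne',
    Real.log_div (Real.exp_pos _).ne' (Real.cosh_pos u).ne', Real.log_exp, Real.log_exp,
    ← one_sub_tanh, ← one_add_tanh]
  ring

lemma log_two_sub_cramerEntropy_tanh (u : ℝ) :
    Real.log 2 - cramerEntropy (Real.tanh u) = spinEntropy u := by
  rw [cramerEntropy_tanh, spinEntropy, Real.log_mul two_ne_zero (Real.cosh_pos u).ne']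
  ring

lemma continuous_spinEntropy : Continuous spinEntropy :=
  (Continuous.log (by fun_prop) fun u => (by positivity)).sub (continuous_id.mul continuous_tanh)

lemma tanh_mem_Icc (u : ℝ) : Real.tanh u ∈ Set.Icc (-1 : ℝ) 1 := abs_le.1 (Real.abs_tanh_lt_one u).le

lemma spinEntropy_le_log_two (u : ℝ) : spinEntropy u ≤ Real.log 2 := by
  rw [← log_two_sub_cramerEntropy_tanh]
  linarith [cramerEntropy_nonneg (tanh_mem_Icc u)]

/-- Young's inequality says that `u` is a subgradient of `I` at `tanh u`, so `I (tanh v) - I (tanh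
u) ≥ u (tanh v - tanh u) ≥ 0` for `0 ≤ u ≤ v`. -/
lemma spinEntropy_antitoneOn : AntitoneOn spinEntropy (Set.Ici 0) := by
  intro u hu v _ huv
  rw [← log_two_sub_cramerEntropy_tanh, ← log_two_sub_cramerEntropy_tanh]
  by_cases h : Real.tanh v = Real.tanh u
  · rw [h]
  · have h1 := mul_lt_cramerEntropy_add (tanh_mem_Icc v) h
    have h2 := mul_le_mul_of_nonneg_left (tanh_monotone huv) (Set.mem_Ici.1 hu)
    linarith [cramerEntropy_tanh u]

/-- `β` is the critical inverse temperature for the field `h`. -/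
def IsCritical (β h : ℝ) : Prop := 0 < β ∧ spinEntropy (β * h) = β ^ 2 / 2

lemma exists_isCritical (h : ℝ) : ∃ β, IsCritical β h := by
  have hlog := Real.log_pos (one_lt_two)
  have hcont : ContinuousOn (fun β => spinEntropy (β * h) - β ^ 2 / 2) (Set.Icc 0 2) :=
    ((continuous_spinEntropy.comp (continuous_id.mul continuous_const)).sub
      (by fun_prop)).continuousOn
  have h0 : spinEntropy (0 * h) - 0 ^ 2 / 2 = Real.log 2 := by simp [spinEntropy]
  -- The entropy never exceeds `log 2`, which is below `2 ^ 2 / 2`; this makes 2 an upper endpoint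
  -- for every field.
  have h2 : spinEntropy (2 * h) - 2 ^ 2 / 2 ≤ 0 := by
    have := spinEntropy_le_log_two (2 * h)
    have := Real.log_two_lt_d9
    linarith
  obtain ⟨β, hβ, hβ0⟩ := intermediate_value_Icc' (by norm_num) hcont
    (show (0 : ℝ) ∈ Set.Icc _ _ from ⟨h2, h0.symm ▸ hlog.le⟩)
  refine ⟨β, lt_of_le_of_ne hβ.1 ?_, by linarith⟩
  rintro rfl
  simp only [h0] at hβ0
  exact hlog.ne' hβ0

section

variable {β h : ℝ}

lemma rho_tanh (hc : IsCritical β h) : rho (Real.tanh (β * h)) = β := by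
  rw [rho, log_two_sub_cramerEntropy_tanh, hc.2, mul_div_cancel₀ _ two_ne_zero,
    Real.sqrt_sq hc.1.le]

/-- Combine `β ρ ≤ (ρ² + β²) / 2` with strict Young at `u = βh`. Criticality makes the two bounds
sharp together at `tanh (βh)`, which gives both the value of the maximum and uniqueness of the
maximizer. -/
lemma rho_add_lt (hc : IsCritical β h) {s : ℝ} (hs : s ∈ Set.Icc (-1 : ℝ) 1)
    (hne : s ≠ Real.tanh (β * h)) : rho s + h * s < β + h * Real.tanh (β * h) := by
  have hβ := hc.1
  have hy := mul_lt_cramerEntropy_add hs hne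
  have hcrit := hc.2
  rw [spinEntropy, Real.log_mul two_ne_zero (Real.cosh_pos _).ne'] at hcrit
  have h1 : β * rho s ≤ Real.log 2 - cramerEntropy s + β ^ 2 / 2 := by
    have h2 : rho s ^ 2 = 2 * (Real.log 2 - cramerEntropy s) :=
      Real.sq_sqrt (by linarith [cramerEntropy_le_log_two hs])
    nlinarith [sq_nonneg (rho s - β)]
  have h3 : β * (rho s + h * s) < β * (β + h * Real.tanh (β * h)) := by nlinarith
  exact lt_of_mul_lt_mul_left h3 hβ.le

lemma tStar_eq (hc : IsCritical β h) : tStar h = Real.tanh (β * h) := by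
  by_contra hne
  have h1 := rho_add_lt hc (tStar_spec h).1 hne
  have h2 : rho (Real.tanh (β * h)) + h * Real.tanh (β * h) ≤ rho (tStar h) + h * tStar h :=
    (tStar_spec h).2 (tanh_mem_Icc _)
  rw [rho_tanh hc] at h2
  exact absurd h1 (not_lt.2 h2)

lemma maxM_eq (hc : IsCritical β h) : maxM h = β + h * Real.tanh (β * h) := by
  have hmem : Real.tanh (β * h) ∈ Set.Icc (-1 : ℝ) 1 := tanh_mem_Icc _
  refine IsGreatest.csSup_eq ⟨⟨_, hmem, by simp only [rho_tanh hc]⟩, ?_⟩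
  rintro _ ⟨s, hs, rfl⟩
  by_cases hne : s = Real.tanh (β * h)
  · subst hne
    simp only [rho_tanh hc, le_refl]
  · exact (rho_add_lt hc hs hne).le

lemma entropy_tStar (hc : IsCritical β h) :
    Real.log 2 - cramerEntropy (tStar h) = β ^ 2 / 2 := by
  rw [tStar_eq hc, log_two_sub_cramerEntropy_tanh, hc.2]

lemma rho_tStar (hc : IsCritical β h) : rho (tStar h) = β := by
  rw [tStar_eq hc, rho_tanh hc]

end

lemma iteratedDeriv_two_cramerEntropy {t : ℝ} (ht : |t| < 1) :
    iteratedDeriv 2 cramerEntropy t = 1 / (1 - t ^ 2) := by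
  have h1 : ∀ s : ℝ, |s| < 1 →
      HasDerivAt cramerEntropy (1 / 2 * (Real.log (1 + s) - Real.log (1 - s))) s := by
    intro s hs
    have hs' := abs_lt.1 hs
    have ha : HasDerivAt (fun t : ℝ => 1 - t) (-1) s := by
      simpa using (hasDerivAt_id s).const_sub 1
    have hb : HasDerivAt (fun t : ℝ => 1 + t) 1 s := by
      simpa using (hasDerivAt_id s).const_add 1
    have h2 := (((ha.mul (ha.log (by linarith))).add (hb.mul (hb.log (by linarith)))).const_mul
      (1 / 2 : ℝ))
    refine HasDerivAt.congr_deriv (f' := _) h2 ?_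
    have h3 : (1 - s) * (-1 / (1 - s)) = -1 := mul_div_cancel₀ _ (by linarith)
    have h4 : (1 + s) * (1 / (1 + s)) = 1 := mul_div_cancel₀ _ (by linarith)
    rw [h3, h4]
    ring
  have h2 : deriv cramerEntropy =ᶠ[𝓝 t] fun s => 1 / 2 * (Real.log (1 + s) - Real.log (1 - s)) := by
    filter_upwards [(isOpen_lt continuous_abs continuous_const).mem_nhds ht] with s hs
    exact (h1 s hs).deriv
  rw [iteratedDeriv_succ, iteratedDeriv_one, h2.deriv_eq]
  have ht' := abs_lt.1 ht
  have ha : HasDerivAt (fun t : ℝ => 1 - t) (-1) t := by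
    simpa using (hasDerivAt_id t).const_sub 1
  have hb : HasDerivAt (fun t : ℝ => 1 + t) 1 t := by
    simpa using (hasDerivAt_id t).const_add 1
  have h3 := ((hb.log (by linarith)).sub (ha.log (by linarith))).const_mul (1 / 2 : ℝ)
  refine h3.deriv.trans ?_
  have h4 : 1 - t ≠ 0 := by linarith
  have h5 : 1 + t ≠ 0 := by linarith
  have h6 : 1 - t ^ 2 ≠ 0 := by
    rw [show 1 - t ^ 2 = (1 - t) * (1 + t) by ring]
    exact mul_ne_zero h4 h5
  field_simp
  ring

/-! ### The condition on the order parameter -/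

lemma entropyRatio_eq {n : ℕ} (ϱ : OrderParameter n) {h β β' : ℝ} (l : ℕ) (hc : IsCritical β h)
    (hc' : IsCritical β' ((Real.sqrt (ϱ.slope l n))⁻¹ * h)) :
    entropyRatio ϱ h l = β' ^ 2 / β ^ 2 := by
  rw [entropyRatio, entropy_tStar hc, entropy_tStar hc']
  field_simp

/-- The rescaled value `b = β' θ^{-1/2}` satisfies `s (bh) = θ b² / 2`, and the ratio lies below `θ`
exactly when `b < β`. In that case monotonicity of `s` gives `θ b² ≥ β² > b²`, hence `θ > 1`; if `b
= β`, the two critical equations force `θ = 1`. -/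
lemma slope_comparison {h β β' θ : ℝ} (hh : 0 ≤ h) (hθ : 0 < θ) (hc : IsCritical β h)
    (hc' : IsCritical β' ((Real.sqrt θ)⁻¹ * h)) :
    (β' ^ 2 / β ^ 2 < θ → 1 < θ) ∧ (β' ^ 2 / β ^ 2 = θ → θ = 1) := by
  set b := β' * (Real.sqrt θ)⁻¹ with hb
  have hs : 0 < Real.sqrt θ := Real.sqrt_pos.2 hθ
  have hb0 : 0 < b := mul_pos hc'.1 (inv_pos.2 hs)
  have hβ' : β' ^ 2 = θ * b ^ 2 := by
    rw [hb, mul_pow, inv_pow, Real.sq_sqrt hθ.le]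
    field_simp
  have hβ2 : 0 < β ^ 2 := pow_pos hc.1 2
  have hcb : spinEntropy (b * h) = θ * b ^ 2 / 2 := by
    rw [← hβ', ← hc'.2, hb, mul_assoc]
  constructor
  · intro hlt
    rw [div_lt_iff₀ hβ2, hβ'] at hlt
    have hbβ : b < β := lt_of_pow_lt_pow_left₀ 2 hc.1.le (lt_of_mul_lt_mul_left hlt hθ.le)
    have hanti := spinEntropy_antitoneOn (Set.mem_Ici.2 (mul_nonneg hb0.le hh))
      (Set.mem_Ici.2 (mul_nonneg hc.1.le hh)) (mul_le_mul_of_nonneg_right hbβ.le hh)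
    rw [hcb, hc.2] at hanti
    have hb2 : b ^ 2 < β ^ 2 := pow_lt_pow_left₀ hbβ hb0.le two_ne_zero
    by_contra! hle
    nlinarith [mul_le_mul_of_nonneg_right hle (sq_nonneg b)]
  · intro heq
    rw [div_eq_iff hβ2.ne', hβ'] at heq
    have hbβ : b = β := by
      have h2 : b ^ 2 = β ^ 2 := mul_left_cancel₀ hθ.ne' heq
      exact (pow_left_inj₀ hb0.le hc.1.le two_ne_zero).1 h2
    rw [hbβ, hc.2] at hcb
    have : β ^ 2 * (θ - 1) = 0 := by linarith
    rcases mul_eq_zero.1 this with h | h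
    · exact absurd h hβ2.ne'
    · linarith

/-! ### Exponential tilting of one level -/

lemma sum_prod_spins {R : Type*} [CommSemiring R] (d : ℕ) (f : ℤˣ → R) :
    ∑ v : Spins d, ∏ i, f (v i) = (f 1 + f (-1)) ^ d := by
  rw [← Fintype.sum_pow f d, show (Finset.univ : Finset ℤˣ) = {1, -1} from rfl,
    Finset.sum_pair (by decide)]

lemma spin_one : spin 1 = 1 := by simp [spin]

lemma spin_neg_one : spin (-1) = -1 := by simp [spin]

/-- The law of one tilted spin. -/
def spinWeight (θ : ℝ) (s : ℤˣ) : ℝ := Real.exp (θ * spin s) / (2 * Real.cosh θ)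

/-- The product weights of tilted spins. -/
def tiltWeight (θ : ℝ) {d : ℕ} (v : Spins d) : ℝ := ∏ i, spinWeight θ (v i)

lemma spinWeight_pos (θ : ℝ) (s : ℤˣ) : 0 < spinWeight θ s := by
  have := Real.cosh_pos θ
  unfold spinWeight
  positivity

lemma spinWeight_add (θ : ℝ) : spinWeight θ 1 + spinWeight θ (-1) = 1 := by
  have := Real.cosh_pos θ
  rw [spinWeight, spinWeight, spin_one, spin_neg_one, ← add_div, div_eq_one_iff_eq (by positivity),
    Real.cosh_eq]
  simp
  ring

lemma spinWeight_sub (θ : ℝ) : spinWeight θ 1 - spinWeight θ (-1) = Real.tanh θ := by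
  have := Real.cosh_pos θ
  rw [spinWeight, spinWeight, spin_one, spin_neg_one, ← sub_div, Real.tanh_eq_sinh_div_cosh,
    Real.sinh_eq, div_eq_div_iff (by positivity) (by positivity)]
  simp
  ring

lemma spinWeight_lt_one (θ : ℝ) (s : ℤˣ) : spinWeight θ s < 1 := by
  have h1 := spinWeight_pos θ 1
  have h2 := spinWeight_pos θ (-1)
  have h3 := spinWeight_add θ
  rcases Int.units_eq_one_or s with rfl | rfl <;> linarith

lemma tiltWeight_pos (θ : ℝ) {d : ℕ} (v : Spins d) : 0 < tiltWeight θ v :=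
  Finset.prod_pos fun _ _ => spinWeight_pos θ _

lemma sum_tiltWeight (θ : ℝ) (d : ℕ) : ∑ v : Spins d, tiltWeight θ v = 1 := by
  simp_rw [tiltWeight]
  rw [sum_prod_spins, spinWeight_add, one_pow]

lemma tiltWeight_le (θ : ℝ) {d : ℕ} (v : Spins d) :
    tiltWeight θ v ≤ max (spinWeight θ 1) (spinWeight θ (-1)) ^ d := by
  calc tiltWeight θ v ≤ ∏ _i : Fin d, max (spinWeight θ 1) (spinWeight θ (-1)) := by
        refine Finset.prod_le_prod (fun i _ => (spinWeight_pos θ _).le) fun i _ => ?_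
        rcases Int.units_eq_one_or (v i) with h | h <;> rw [h]
        exacts [le_max_left _ _, le_max_right _ _]
    _ = _ := by simp

/-- The Boltzmann factor of a centered field is a probability weight times the exponential of an
entropy; this is why fields are centered at `tanh θ`. -/
lemma exp_mul_centeredField (lam c : ℝ) {θ : ℝ} (hθ : lam * c = θ) {d : ℕ} (v : Spins d) :
    Real.exp (lam * centeredField c (Real.tanh θ) v) =
      tiltWeight θ v * Real.exp (d * spinEntropy θ) := by
  have hc := Real.cosh_pos θ
  have h1 : Real.exp (d * spinEntropy θ) = ∏ _i : Fin d, Real.exp (spinEntropy θ) := by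
    rw [Finset.prod_const, Finset.card_univ, Fintype.card_fin, ← Real.exp_nat_mul]
  rw [centeredField, Finset.mul_sum, Real.exp_sum, tiltWeight, h1, ← Finset.prod_mul_distrib]
  refine Finset.prod_congr rfl fun i _ => ?_
  rw [spinWeight, spinEntropy, Real.exp_sub, Real.exp_log (by positivity), ← mul_assoc, hθ, mul_sub,
    Real.exp_sub]
  field_simp

/-- The law of the tilted increment at one level. -/
def tiltKernel (θ c : ℝ) (a : NNReal) (d : ℕ) : Measure ℝ :=
  ∑ v : Spins d, ENNReal.ofReal (tiltWeight θ v) • gaussianReal (centeredField c (Real.tanh θ) v) a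

instance (θ c : ℝ) (a : NNReal) (d : ℕ) : IsProbabilityMeasure (tiltKernel θ c a d) := by
  refine ⟨?_⟩
  rw [tiltKernel, Measure.finsetSum_apply]
  simp only [Measure.smul_apply, measure_univ, smul_eq_mul, mul_one]
  rw [← ENNReal.ofReal_sum_of_nonneg fun v _ => (tiltWeight_pos θ v).le, sum_tiltWeight,
    ENNReal.ofReal_one]

lemma integral_tiltKernel {E : Type*} [NormedAddCommGroup E] [NormedSpace ℝ E] (θ c : ℝ)
    (a : NNReal) (d : ℕ) {f : ℝ → E}
    (hf : ∀ v : Spins d, Integrable f (gaussianReal (centeredField c (Real.tanh θ) v) a)) :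
    ∫ y, f y ∂tiltKernel θ c a d = ∑ v : Spins d,
      tiltWeight θ v • ∫ y, f y ∂gaussianReal (centeredField c (Real.tanh θ) v) a := by
  rw [tiltKernel, integral_finsetSum_measure fun v _ => (hf v).smul_measure ENNReal.ofReal_ne_top]
  refine Finset.sum_congr rfl fun v _ => ?_
  rw [integral_smul_measure, ENNReal.toReal_ofReal (tiltWeight_pos θ v).le]

/-- The normalization at one level. -/
def levelWeight (lam γ s : ℝ) : ℝ := Real.exp (lam * s - γ)

lemma levelWeight_pos (lam γ s : ℝ) : 0 < levelWeight lam γ s := Real.exp_pos _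

lemma gaussianPDFReal_tilt (η lam y : ℝ) (a : NNReal) (ha : a ≠ 0) :
    gaussianPDFReal (η - lam * a) a y =
      Real.exp (lam * η - lam ^ 2 * a / 2) * Real.exp (-(lam * y)) * gaussianPDFReal η a y := by
  have ha' : (a : ℝ) ≠ 0 := by exact_mod_cast ha
  rw [gaussianPDFReal, gaussianPDFReal, mul_left_comm, ← Real.exp_add, ← Real.exp_add]
  congr 2
  field_simp
  ring

/-- Change of measure on both sources of randomness: completing the square removes the drift `-lam *
a`, and the Boltzmann factor of the field becomes `tiltWeight`. The relation `hγ` balances entropy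
against Gaussian cost, so that no constant is left and the remaining weights sum to one. -/
lemma integral_gaussianReal_tilt (lam c : ℝ) {θ γ γ' : ℝ} (hθ : lam * c = θ) {a : NNReal}
    (ha : a ≠ 0) {d : ℕ} (hγ : γ' - γ = d * spinEntropy θ - lam ^ 2 * a / 2) (v : Spins d)
    (D : ℝ → ℂ) (s : ℝ) :
    ∫ y, D (s + y) ∂gaussianReal (centeredField c (Real.tanh θ) v - lam * a) a =
      levelWeight lam γ s * (tiltWeight θ v *
        ∫ y, D (s + y) / levelWeight lam γ' (s + y)
          ∂gaussianReal (centeredField c (Real.tanh θ) v) a) := by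
  rw [integral_gaussianReal_eq_integral_smul ha, integral_gaussianReal_eq_integral_smul ha,
    ← integral_const_mul, ← integral_const_mul]
  refine integral_congr_ae (ae_of_all _ fun y => ?_)
  beta_reduce
  rw [gaussianPDFReal_tilt _ _ _ _ ha]
  have hE := (levelWeight_pos lam γ' (s + y)).ne'
  have key : Real.exp (lam * centeredField c (Real.tanh θ) v - lam ^ 2 * a / 2) *
      Real.exp (-(lam * y)) * levelWeight lam γ' (s + y) = levelWeight lam γ s * tiltWeight θ v := by
    rw [Real.exp_sub, exp_mul_centeredField lam c hθ, levelWeight, levelWeight]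
    have : lam * (s + y) - γ' = lam * s - γ + lam * y - d * spinEntropy θ + lam ^ 2 * a / 2 := by
      linarith
    rw [this, Real.exp_add, Real.exp_sub, Real.exp_add, Real.exp_neg]
    field_simp
  rw [Complex.real_smul, Complex.real_smul]
  have hE' : (levelWeight lam γ' (s + y) : ℂ) ≠ 0 := by exact_mod_cast hE
  have key' := congrArg (fun r : ℝ => (r : ℂ)) key
  simp only [Complex.ofReal_mul] at key' ⊢
  rw [← mul_assoc, ← mul_assoc, ← key']
  field_simp

/-! ### Products of numbers close to one -/

lemma norm_one_sub_prod_le {ι : Type*} (S : Finset ι) (z : ι → ℂ) (hz : ∀ i, ‖1 - z i‖ ≤ 1) :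
    ‖1 - ∏ i ∈ S, (1 - z i)‖ ≤ ∑ i ∈ S, ‖z i‖ := by
  classical
  induction S using Finset.induction_on with
  | empty => simp
  | insert i S hi ih =>
    rw [Finset.prod_insert hi, Finset.sum_insert hi]
    calc ‖1 - (1 - z i) * ∏ j ∈ S, (1 - z j)‖ = ‖z i + (1 - z i) * (1 - ∏ j ∈ S, (1 - z j))‖ := by
          congr 1; ring
      _ ≤ ‖z i‖ + ‖1 - z i‖ * ‖1 - ∏ j ∈ S, (1 - z j)‖ := by
          rw [← norm_mul]; exact norm_add_le _ _
      _ ≤ _ := by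
          have := mul_le_mul (hz i) ih (norm_nonneg _) zero_le_one
          linarith

/-- A second-order Bonferroni estimate. It holds for complex factors because all partial products
stay in the unit disc. -/
lemma norm_one_sub_prod_sub_sum_le {ι : Type*} (S : Finset ι) (z : ι → ℂ)
    (hz : ∀ i, ‖1 - z i‖ ≤ 1) :
    ‖1 - ∏ i ∈ S, (1 - z i) - ∑ i ∈ S, z i‖ ≤ (∑ i ∈ S, ‖z i‖) ^ 2 := by
  classical
  induction S using Finset.induction_on with
  | empty => simp
  | insert i S hi ih =>
    rw [Finset.prod_insert hi, Finset.sum_insert hi, Finset.sum_insert hi]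
    have h1 := norm_one_sub_prod_le S z hz
    have h0 : 0 ≤ ∑ j ∈ S, ‖z j‖ := Finset.sum_nonneg fun _ _ => norm_nonneg _
    calc ‖1 - (1 - z i) * ∏ j ∈ S, (1 - z j) - (z i + ∑ j ∈ S, z j)‖
        = ‖(1 - ∏ j ∈ S, (1 - z j) - ∑ j ∈ S, z j) - z i * (1 - ∏ j ∈ S, (1 - z j))‖ := by
          congr 1; ring
      _ ≤ ‖1 - ∏ j ∈ S, (1 - z j) - ∑ j ∈ S, z j‖ + ‖z i‖ * ‖1 - ∏ j ∈ S, (1 - z j)‖ := by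
          rw [← norm_mul]; exact norm_sub_le _ _
      _ ≤ (∑ j ∈ S, ‖z j‖) ^ 2 + ‖z i‖ * ∑ j ∈ S, ‖z j‖ :=
          add_le_add ih (mul_le_mul_of_nonneg_left h1 (norm_nonneg _))
      _ ≤ _ := by nlinarith [norm_nonneg (z i), mul_nonneg (norm_nonneg (z i)) h0]

lemma norm_exp_neg_sub_one_add_le {z : ℂ} (hz : ‖z‖ ≤ 1) : ‖1 - z - Complex.exp (-z)‖ ≤ ‖z‖ ^ 2 := by
  have h := Complex.norm_exp_sub_one_sub_id_le (x := -z) (by rwa [norm_neg])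
  rw [norm_neg] at h
  rwa [← norm_neg, show -(1 - z - Complex.exp (-z)) = Complex.exp (-z) - 1 - -z by ring]

lemma norm_prod_sub_prod_le {ι : Type*} (S : Finset ι) (z w : ι → ℂ) (hz : ∀ i, ‖z i‖ ≤ 1)
    (hw : ∀ i, ‖w i‖ ≤ 1) : ‖∏ i ∈ S, z i - ∏ i ∈ S, w i‖ ≤ ∑ i ∈ S, ‖z i - w i‖ := by
  classical
  induction S using Finset.induction_on with
  | empty => simp
  | insert i S hi ih =>
    rw [Finset.prod_insert hi, Finset.prod_insert hi, Finset.sum_insert hi]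
    have h1 : ‖∏ j ∈ S, w j‖ ≤ 1 := by
      rw [norm_prod]; exact Finset.prod_le_one (fun _ _ => norm_nonneg _) fun _ _ => hw _
    calc ‖z i * ∏ j ∈ S, z j - w i * ∏ j ∈ S, w j‖
        = ‖(z i - w i) * ∏ j ∈ S, w j + z i * (∏ j ∈ S, z j - ∏ j ∈ S, w j)‖ := by congr 1; ring
      _ ≤ ‖z i - w i‖ * ‖∏ j ∈ S, w j‖ + ‖z i‖ * ‖∏ j ∈ S, z j - ∏ j ∈ S, w j‖ := by
          rw [← norm_mul, ← norm_mul]; exact norm_add_le _ _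
      _ ≤ _ := by
          have h2 := mul_le_mul_of_nonneg_left h1 (norm_nonneg (z i - w i))
          have h3 := mul_le_mul (hz i) ih (norm_nonneg _) zero_le_one
          linarith

/-- The condition `‖1 - z i‖ ≤ 1` forces `0 ≤ (z i).re`, so the exponentials also lie in the unit
disc and the products can be compared factor by factor. -/
lemma norm_prod_sub_exp_le {ι : Type*} (S : Finset ι) (z : ι → ℂ) (hz : ∀ i, ‖1 - z i‖ ≤ 1)
    {δ : ℝ} (hδ1 : δ ≤ 1) (hδ : ∀ i, ‖z i‖ ≤ δ) :
    ‖∏ i ∈ S, (1 - z i) - Complex.exp (-∑ i ∈ S, z i)‖ ≤ δ * ∑ i ∈ S, ‖z i‖ := by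
  have hre : ∀ i, 0 ≤ (z i).re := fun i => by
    have h1 := (Complex.abs_re_le_norm (1 - z i)).trans (hz i)
    have h2 := (abs_le.1 h1).2
    simp at h2
    exact h2
  rw [← Finset.sum_neg_distrib, Complex.exp_sum, Finset.mul_sum]
  refine (norm_prod_sub_prod_le S _ _ hz fun i => ?_).trans (Finset.sum_le_sum fun i _ => ?_)
  · rw [Complex.norm_exp]
    simpa using hre i
  · refine (norm_exp_neg_sub_one_add_le ((hδ i).trans hδ1)).trans ?_
    rw [pow_two]
    exact mul_le_mul_of_nonneg_right (hδ i) (norm_nonneg _)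

/-! ### Bounded measurable functions -/

/-- Bounded measurable functions. -/
def IsBddMeas {E : Type*} [NormedAddCommGroup E] [MeasurableSpace E] (f : ℝ → E) : Prop :=
  Measurable f ∧ ∃ C, ∀ s, ‖f s‖ ≤ C

section

variable {E : Type*} [NormedAddCommGroup E] [MeasurableSpace E] [BorelSpace E] {f : ℝ → E}

lemma IsBddMeas.norm (hf : IsBddMeas f) : IsBddMeas fun s => ‖f s‖ := by
  obtain ⟨C, hC⟩ := hf.2
  exact ⟨hf.1.norm, C, fun s => by simpa using hC s⟩

variable [SecondCountableTopology E]

lemma IsBddMeas.integrable (hf : IsBddMeas f) (μ : Measure ℝ) [IsFiniteMeasure μ] (s : ℝ) :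
    Integrable (fun y => f (s + y)) μ := by
  obtain ⟨C, hC⟩ := hf.2
  exact Integrable.of_bound (hf.1.comp (measurable_const_add s)).aestronglyMeasurable C
    (ae_of_all _ fun y => hC _)

lemma IsBddMeas.sub {g : ℝ → E} (hf : IsBddMeas f) (hg : IsBddMeas g) :
    IsBddMeas fun s => f s - g s := by
  obtain ⟨C, hC⟩ := hf.2
  obtain ⟨C', hC'⟩ := hg.2
  exact ⟨hf.1.sub hg.1, C + C', fun s => (norm_sub_le _ _).trans (add_le_add (hC s) (hC' s))⟩

lemma IsBddMeas.integral_add [NormedSpace ℝ E] (hf : IsBddMeas f) (μ : Measure ℝ)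
    [IsProbabilityMeasure μ] :
    IsBddMeas fun s => ∫ y, f (s + y) ∂μ := by
  obtain ⟨C, hC⟩ := hf.2
  refine ⟨measurable_integral_add hf.1 μ, C, fun s => ?_⟩
  simpa using norm_integral_le_of_norm_le_const (μ := μ) (ae_of_all _ fun y => hC (s + y))

end

/-! ### Estimates for the tilted kernel -/

lemma tiltKernel_integral_bdd {E : Type*} [NormedAddCommGroup E] [NormedSpace ℝ E]
    [MeasurableSpace E] [BorelSpace E] [SecondCountableTopology E] {f : ℝ → E} (hf : IsBddMeas f)
    (θ c : ℝ) (a : NNReal) (d : ℕ) (s : ℝ) :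
    ∫ y, f (s + y) ∂tiltKernel θ c a d = ∑ v : Spins d,
      tiltWeight θ v • ∫ y, f (s + y) ∂gaussianReal (centeredField c (Real.tanh θ) v) a :=
  integral_tiltKernel θ c a d fun _ => hf.integrable _ s

lemma gaussianPDFReal_le (η : ℝ) (a : NNReal) (y : ℝ) :
    gaussianPDFReal η a y ≤ (Real.sqrt (2 * Real.pi * a))⁻¹ := by
  rw [gaussianPDFReal]
  refine mul_le_of_le_one_right (by positivity) (Real.exp_le_one_iff.2 ?_)
  rw [neg_div]
  have : 0 ≤ (y - η) ^ 2 / (2 * (a : ℝ)) := by positivity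
  linarith

lemma gaussianReal_le_volume (η : ℝ) {a : NNReal} (ha : a ≠ 0) :
    gaussianReal η a ≤ ENNReal.ofReal (Real.sqrt (2 * Real.pi * a))⁻¹ • volume := by
  rw [gaussianReal_of_var_ne_zero η ha, ← withDensity_const]
  exact withDensity_mono (ae_of_all _ fun y => ENNReal.ofReal_le_ofReal (gaussianPDFReal_le η a y))

/-- A mixture of Gaussians of variance `a` has density at most that of their peak, whatever the
field and the block size. -/
lemma tiltKernel_le_volume (θ c : ℝ) {a : NNReal} (ha : a ≠ 0) (d : ℕ) :
    tiltKernel θ c a d ≤ ENNReal.ofReal (Real.sqrt (2 * Real.pi * a))⁻¹ • volume := by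
  rw [Measure.le_iff]
  intro B _
  rw [tiltKernel, Measure.finsetSum_apply]
  calc ∑ v : Spins d, (ENNReal.ofReal (tiltWeight θ v) •
        gaussianReal (centeredField c (Real.tanh θ) v) a) B
      ≤ ∑ v : Spins d, ENNReal.ofReal (tiltWeight θ v) *
        (ENNReal.ofReal (Real.sqrt (2 * Real.pi * a))⁻¹ • volume) B := by
        refine Finset.sum_le_sum fun v _ => ?_
        rw [Measure.smul_apply, smul_eq_mul]
        gcongr
        exact gaussianReal_le_volume _ ha
    _ = _ := by
        rw [← Finset.sum_mul, ← ENNReal.ofReal_sum_of_nonneg fun v _ => (tiltWeight_pos θ v).le,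
          sum_tiltWeight, ENNReal.ofReal_one, one_mul]

lemma integral_le_of_le_volume {μ : Measure ℝ} {C : ℝ} (hC : 0 ≤ C)
    (hμ : μ ≤ ENNReal.ofReal C • volume) {f : ℝ → ℝ} (hf : Integrable f) (h0 : ∀ y, 0 ≤ f y)
    (s : ℝ) : ∫ y, f (s + y) ∂μ ≤ C * ∫ y, f y := by
  calc ∫ y, f (s + y) ∂μ ≤ ∫ y, f (s + y) ∂(ENNReal.ofReal C • volume) :=
        integral_mono_measure hμ (ae_of_all _ fun y => h0 _)
          ((hf.comp_add_left s).smul_measure ENNReal.ofReal_ne_top)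
    _ = C * ∫ y, f y := by
        rw [integral_smul_measure, ENNReal.toReal_ofReal hC, smul_eq_mul,
          integral_add_left_eq_self (fun y => f y) s]

lemma integrable_exp_gaussianReal (η : ℝ) (a : NNReal) :
    Integrable Real.exp (gaussianReal η a) := by
  simpa using integrable_exp_mul_gaussianReal (μ := η) (v := a) 1

lemma integral_rexp_gaussianReal (η : ℝ) (a : NNReal) :
    ∫ y, Real.exp y ∂gaussianReal η a = Real.exp (η + a / 2) := by
  have h := congrFun (mgf_id_gaussianReal (μ := η) (v := a)) 1
  simpa [mgf] using h

lemma integrable_exp_tiltKernel (θ c : ℝ) (a : NNReal) (d : ℕ) :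
    Integrable Real.exp (tiltKernel θ c a d) := by
  rw [tiltKernel, integrable_finsetSum_measure]
  exact fun v _ => (integrable_exp_gaussianReal _ a).smul_measure ENNReal.ofReal_ne_top

/-- For one spin the exponent is at most `2 * c ≤ 1` in absolute value, so `exp x ≤ 1 + x + x²`
applies; the linear term has mean zero under the tilted law and the quadratic one is at most `4 * c
^ 2`. -/
lemma integral_exp_tiltKernel_le (θ : ℝ) {c : ℝ} (a : NNReal) (d : ℕ) (hc0 : 0 ≤ c) (hc : 2 * c ≤ 1) :
    ∫ y, Real.exp y ∂tiltKernel θ c a d ≤ Real.exp (d * (4 * c ^ 2) + a / 2) := by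
  have ht := abs_lt.1 (Real.abs_tanh_lt_one θ)
  have hexp : ∀ s : ℤˣ, Real.exp (c * (spin s - Real.tanh θ)) ≤
      1 + 4 * c ^ 2 + c * (spin s - Real.tanh θ) := fun s => by
    have h1 : |spin s - Real.tanh θ| ≤ 2 := by
      rcases Int.units_eq_one_or s with rfl | rfl
      · rw [spin_one, abs_le]; constructor <;> linarith
      · rw [spin_neg_one, abs_le]; constructor <;> linarith
    have h2 : |c * (spin s - Real.tanh θ)| ≤ 2 * c := by
      rw [abs_mul, abs_of_nonneg hc0]
      nlinarith
    have h3 := Real.abs_exp_sub_one_sub_id_le (h2.trans hc)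
    have h4 : (c * (spin s - Real.tanh θ)) ^ 2 ≤ (2 * c) ^ 2 := by
      rw [← sq_abs]
      exact pow_le_pow_left₀ (abs_nonneg _) h2 2
    have h5 := (abs_le.1 h3).2
    linarith
  have hstep : spinWeight θ 1 * Real.exp (c * (spin 1 - Real.tanh θ)) +
      spinWeight θ (-1) * Real.exp (c * (spin (-1) - Real.tanh θ)) ≤ Real.exp (4 * c ^ 2) := by
    have h1 := mul_le_mul_of_nonneg_left (hexp 1) (spinWeight_pos θ 1).le
    have h2 := mul_le_mul_of_nonneg_left (hexp (-1)) (spinWeight_pos θ (-1)).le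
    have h3 := spinWeight_add θ
    have h4 := spinWeight_sub θ
    have h5 := Real.add_one_le_exp (4 * c ^ 2)
    rw [spin_one] at h1 ⊢
    rw [spin_neg_one] at h2 ⊢
    rw [← h4] at h1 h2 ⊢
    have h6 : spinWeight θ 1 * (1 + 4 * c ^ 2 + c * (1 - (spinWeight θ 1 - spinWeight θ (-1)))) +
        spinWeight θ (-1) * (1 + 4 * c ^ 2 + c * (-1 - (spinWeight θ 1 - spinWeight θ (-1)))) =
        1 + 4 * c ^ 2 := by
      have h7 : spinWeight θ 1 = 1 - spinWeight θ (-1) := by linarith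
      rw [h7]
      ring
    linarith
  rw [integral_tiltKernel θ c a d fun v => integrable_exp_gaussianReal _ a]
  calc ∑ v : Spins d, tiltWeight θ v • ∫ y, Real.exp y
        ∂gaussianReal (centeredField c (Real.tanh θ) v) a
      = Real.exp (a / 2) * ∑ v : Spins d, ∏ i,
        (spinWeight θ (v i) * Real.exp (c * (spin (v i) - Real.tanh θ))) := by
        rw [Finset.mul_sum]
        refine Finset.sum_congr rfl fun v _ => ?_
        rw [integral_rexp_gaussianReal, Finset.prod_mul_distrib, ← Real.exp_sum, smul_eq_mul,
          Real.exp_add, tiltWeight, centeredField]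
        ring
    _ ≤ Real.exp (a / 2) * Real.exp (4 * c ^ 2) ^ d := by
        rw [sum_prod_spins d fun s => spinWeight θ s * Real.exp (c * (spin s - Real.tanh θ))]
        have h1 := spinWeight_pos θ 1
        have h2 := spinWeight_pos θ (-1)
        gcongr
    _ = _ := by rw [← Real.exp_nat_mul, ← Real.exp_add]; ring_nf

/-! ### One step of the branching recursion in normalized form -/

section Step

variable {lam c θ γ γ' : ℝ} {a : NNReal} {d : ℕ} {Ψ : ℝ → ℂ}

/-- The normalized deviation of `Ψ` from one. -/
def deviation (lam γ : ℝ) (Ψ : ℝ → ℂ) (s : ℝ) : ℂ := (1 - Ψ s) / levelWeight lam γ s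

lemma norm_deviation_le (hΨ : IsDiscValued Ψ) (s : ℝ) :
    ‖deviation lam γ Ψ s‖ ≤ 2 / levelWeight lam γ s := by
  rw [deviation, norm_div, Complex.norm_real, Real.norm_of_nonneg (levelWeight_pos _ _ _).le]
  gcongr
  · exact (levelWeight_pos _ _ _).le
  · refine (norm_sub_le _ _).trans ?_
    have := hΨ.2 s
    rw [norm_one]
    linarith

lemma measurable_deviation (hΨ : IsDiscValued Ψ) : Measurable (deviation lam γ Ψ) := by
  unfold deviation levelWeight
  have := hΨ.1
  fun_prop

lemma integral_gaussianReal_eq_one_sub (hθ : lam * c = θ) (ha : a ≠ 0)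
    (hγ : γ' - γ = d * spinEntropy θ - lam ^ 2 * a / 2) (hΨ : IsDiscValued Ψ) (v : Spins d) (s : ℝ) :
    ∫ y, Ψ (s + y) ∂gaussianReal (centeredField c (Real.tanh θ) v - lam * a) a =
      1 - levelWeight lam γ s * (tiltWeight θ v *
        ∫ y, deviation lam γ' Ψ (s + y) ∂gaussianReal (centeredField c (Real.tanh θ) v) a) := by
  have hint : Integrable (fun y => Ψ (s + y))
      (gaussianReal (centeredField c (Real.tanh θ) v - lam * a) a) :=
    IsBddMeas.integrable ⟨hΨ.1, 1, hΨ.2⟩ _ s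
  have h := integral_gaussianReal_tilt lam c hθ ha hγ v (fun s => 1 - Ψ s) s
  rw [integral_sub (integrable_const _) hint] at h
  simp only [integral_const, probReal_univ, one_smul] at h
  simp only [deviation]
  rw [← h]
  ring

variable (lam c θ γ a d Ψ) in
/-- One step of the branching recursion with centered fields. -/
def tiltStep (s : ℝ) : ℂ :=
  ∏ v : Spins d, ∫ y, Ψ (s + y) ∂gaussianReal (centeredField c (Real.tanh θ) v - lam * a) a

lemma IsDiscValued.tiltStep (hΨ : IsDiscValued Ψ) : IsDiscValued (tiltStep lam c θ a d Ψ) := by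
  refine ⟨Finset.measurable_prod _ fun v _ => measurable_integral_add hΨ.1 _, fun s => ?_⟩
  rw [GREM.tiltStep, norm_prod]
  exact Finset.prod_le_one (fun _ _ => norm_nonneg _) fun v _ => hΨ.norm_integral_le s _

lemma sum_norm_tilt_le (hg : IsBddMeas (deviation lam γ' Ψ)) (s : ℝ) :
    ∑ v : Spins d, ‖(levelWeight lam γ s * (tiltWeight θ v *
      ∫ y, deviation lam γ' Ψ (s + y) ∂gaussianReal (centeredField c (Real.tanh θ) v) a) : ℂ)‖ ≤
      levelWeight lam γ s * ∫ y, ‖deviation lam γ' Ψ (s + y)‖ ∂tiltKernel θ c a d := by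
  rw [tiltKernel_integral_bdd hg.norm, Finset.mul_sum]
  refine Finset.sum_le_sum fun v _ => ?_
  rw [norm_mul, norm_mul, Complex.norm_real, Complex.norm_real,
    Real.norm_of_nonneg (levelWeight_pos _ _ _).le, Real.norm_of_nonneg (tiltWeight_pos _ _).le,
    smul_eq_mul]
  have h1 := (levelWeight_pos lam γ s).le
  have h2 := (tiltWeight_pos θ v).le
  gcongr
  exact norm_integral_le_integral_norm _

lemma sum_tilt_eq (hg : IsBddMeas (deviation lam γ' Ψ)) (s : ℝ) :
    ∑ v : Spins d, (levelWeight lam γ s * (tiltWeight θ v *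
      ∫ y, deviation lam γ' Ψ (s + y) ∂gaussianReal (centeredField c (Real.tanh θ) v) a) : ℂ) =
      levelWeight lam γ s * ∫ y, deviation lam γ' Ψ (s + y) ∂tiltKernel θ c a d := by
  rw [tiltKernel_integral_bdd hg, Finset.mul_sum]
  simp_rw [Complex.real_smul]

/-- A union bound, free of any smallness condition, so it can be iterated through all levels. -/
lemma norm_deviation_tiltStep_le (hθ : lam * c = θ) (ha : a ≠ 0)
    (hγ : γ' - γ = d * spinEntropy θ - lam ^ 2 * a / 2) (hΨ : IsDiscValued Ψ)
    (hg : IsBddMeas (deviation lam γ' Ψ)) (s : ℝ) :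
    ‖deviation lam γ (tiltStep lam c θ a d Ψ) s‖ ≤
      ∫ y, ‖deviation lam γ' Ψ (s + y)‖ ∂tiltKernel θ c a d := by
  have hE := levelWeight_pos lam γ s
  rw [deviation, norm_div, Complex.norm_real, Real.norm_of_nonneg hE.le, div_le_iff₀ hE,
    mul_comm, tiltStep]
  simp_rw [integral_gaussianReal_eq_one_sub hθ ha hγ hΨ]
  refine (norm_one_sub_prod_le _ _ fun v => ?_).trans (sum_norm_tilt_le hg s)
  rw [← integral_gaussianReal_eq_one_sub hθ ha hγ hΨ]
  exact hΨ.norm_integral_le s _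

/-- The linear part of the product is exactly the kernel integral. The remainder is quadratic in
`levelWeight`; dividing by the normalization leaves one factor, which is small for `s` well below `γ
/ lam`. -/
lemma norm_deviation_tiltStep_sub_le (hθ : lam * c = θ) (ha : a ≠ 0)
    (hγ : γ' - γ = d * spinEntropy θ - lam ^ 2 * a / 2) (hΨ : IsDiscValued Ψ)
    (hg : IsBddMeas (deviation lam γ' Ψ)) (s : ℝ) :
    ‖deviation lam γ (tiltStep lam c θ a d Ψ) s -
        ∫ y, deviation lam γ' Ψ (s + y) ∂tiltKernel θ c a d‖ ≤
      levelWeight lam γ s * (∫ y, ‖deviation lam γ' Ψ (s + y)‖ ∂tiltKernel θ c a d) ^ 2 := by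
  have hE := levelWeight_pos lam γ s
  have hE' : (levelWeight lam γ s : ℂ) ≠ 0 := by exact_mod_cast hE.ne'
  have h1 := norm_one_sub_prod_sub_sum_le Finset.univ
    (fun v : Spins d => (levelWeight lam γ s * (tiltWeight θ v *
      ∫ y, deviation lam γ' Ψ (s + y) ∂gaussianReal (centeredField c (Real.tanh θ) v) a) : ℂ))
    fun v => by
      rw [← integral_gaussianReal_eq_one_sub hθ ha hγ hΨ]
      exact hΨ.norm_integral_le s _
  beta_reduce at h1
  rw [sum_tilt_eq hg] at h1
  simp_rw [← integral_gaussianReal_eq_one_sub hθ ha hγ hΨ] at h1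
  have h2 := h1.trans (pow_le_pow_left₀ (Finset.sum_nonneg fun _ _ => norm_nonneg _)
    (sum_norm_tilt_le hg s) 2)
  rw [deviation, div_sub' hE', norm_div, Complex.norm_real, Real.norm_of_nonneg hE.le,
    div_le_iff₀ hE, tiltStep]
  refine h2.trans (le_of_eq ?_)
  ring

/-- At the root the sum of the deviations is of order one, so linearization is not available. Each
single factor is close to one, since every tilted weight is small, and the product becomes an
exponential. -/
lemma norm_tiltStep_sub_exp_le (hθ : lam * c = θ) (ha : a ≠ 0)
    (hγ : γ' = d * spinEntropy θ - lam ^ 2 * a / 2) (hΨ : IsDiscValued Ψ)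
    (hg : Measurable (deviation lam γ' Ψ)) {C δ : ℝ} (hC : ∀ s, ‖deviation lam γ' Ψ s‖ ≤ C)
    (hδ : ∀ v : Spins d, tiltWeight θ v * C ≤ δ) (hδ1 : δ ≤ 1) :
    ‖tiltStep lam c θ a d Ψ 0 - Complex.exp (-∫ y, deviation lam γ' Ψ y ∂tiltKernel θ c a d)‖ ≤
      δ * C := by
  have hg' : IsBddMeas (deviation lam γ' Ψ) := ⟨hg, C, hC⟩
  have hγ0 : γ' - 0 = d * spinEntropy θ - lam ^ 2 * a / 2 := by rw [sub_zero, hγ]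
  have hE : levelWeight lam 0 0 = 1 := by simp [levelWeight]
  have hsum := sum_tilt_eq (γ := 0) (θ := θ) (c := c) (a := a) (d := d) hg' 0
  have hnorm := sum_norm_tilt_le (γ := 0) (θ := θ) (c := c) (a := a) (d := d) hg' 0
  have h1 : ∀ v : Spins d, ‖(levelWeight lam 0 0 * (tiltWeight θ v *
      ∫ y, deviation lam γ' Ψ (0 + y) ∂gaussianReal (centeredField c (Real.tanh θ) v) a) : ℂ)‖ ≤
      δ := fun v => by
    rw [hE, Complex.ofReal_one, one_mul, norm_mul, Complex.norm_real,
      Real.norm_of_nonneg (tiltWeight_pos _ _).le]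
    refine (mul_le_mul_of_nonneg_left ?_ (tiltWeight_pos θ v).le).trans (hδ v)
    simpa using norm_integral_le_of_norm_le_const
      (μ := gaussianReal (centeredField c (Real.tanh θ) v) a)
      (ae_of_all _ fun y => hC (0 + y))
  have h2 := norm_prod_sub_exp_le Finset.univ
    (fun v : Spins d => (levelWeight lam 0 0 * (tiltWeight θ v *
      ∫ y, deviation lam γ' Ψ (0 + y) ∂gaussianReal (centeredField c (Real.tanh θ) v) a) : ℂ))
    (fun v => by
      rw [← integral_gaussianReal_eq_one_sub hθ ha hγ0 hΨ]
      exact hΨ.norm_integral_le 0 _) hδ1 h1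
  rw [hsum] at h2
  simp_rw [← integral_gaussianReal_eq_one_sub hθ ha hγ0 hΨ] at h2
  have hδ0 : 0 ≤ δ := (norm_nonneg _).trans (h1 fun _ => 1)
  have h3 : ∫ y, ‖deviation lam γ' Ψ (0 + y)‖ ∂tiltKernel θ c a d ≤ C := by
    have := norm_integral_le_of_norm_le_const (μ := tiltKernel θ c a d)
      (f := fun y => ‖deviation lam γ' Ψ (0 + y)‖) (C := C) (ae_of_all _ fun y => by
        simpa using hC (0 + y))
    simpa using (Real.le_norm_self _).trans this
  have h3' : levelWeight lam 0 0 * ∫ y, ‖deviation lam γ' Ψ (0 + y)‖ ∂tiltKernel θ c a d ≤ C := by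
    rwa [hE, one_mul]
  have h4 := h2.trans (mul_le_mul_of_nonneg_left (hnorm.trans h3') hδ0)
  rw [hE] at h4
  simpa [tiltStep] using h4

end Step

/-! ### The linearized recursion with cut-offs -/

/-- The cut-off at the origin, present at the levels in `J`. -/
def cut (J : Finset ℕ) (k : ℕ) (s : ℝ) : ℝ := if k ∈ J ∧ 0 < s then 0 else 1

/-- One step of the linearized recursion with cut-offs. -/
def cutStep {E : Type*} [NormedAddCommGroup E] [NormedSpace ℝ E] (J : Finset ℕ)
    (κ : ℕ → Measure ℝ) (k : ℕ) (f : ℝ → E) (s : ℝ) : E :=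
  cut J k s • ∫ y, f (s + y) ∂κ k

/-- The error made by the cut-off, or by the linearization, at level `k`. -/
def cutError (J : Finset ℕ) (lam : ℝ) (γ : ℕ → ℝ) (k : ℕ) (s : ℝ) : ℝ :=
  if k ∈ J then Real.exp (-(lam * |s|)) else min 1 (levelWeight lam (γ k) s)

lemma cut_nonneg (J : Finset ℕ) (k : ℕ) (s : ℝ) : 0 ≤ cut J k s := by
  unfold cut; split_ifs <;> norm_num

lemma cut_le_one (J : Finset ℕ) (k : ℕ) (s : ℝ) : cut J k s ≤ 1 := by
  unfold cut; split_ifs <;> norm_num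

lemma cut_of_notMem {J : Finset ℕ} {k : ℕ} (hk : k ∉ J) (s : ℝ) : cut J k s = 1 := by
  simp [cut, hk]

lemma measurable_cut (J : Finset ℕ) (k : ℕ) : Measurable (cut J k) := by
  unfold cut
  by_cases hk : k ∈ J
  · simp only [hk, true_and]
    exact Measurable.ite (measurableSet_lt measurable_const measurable_id) measurable_const
      measurable_const
  · simp only [hk, false_and, if_false]
    exact measurable_const

section

variable {E : Type*} [NormedAddCommGroup E] [NormedSpace ℝ E]

lemma norm_cutStep_le (J : Finset ℕ) (κ : ℕ → Measure ℝ) (k : ℕ) (f : ℝ → E) (s : ℝ) :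
    ‖cutStep J κ k f s‖ ≤ ‖∫ y, f (s + y) ∂κ k‖ := by
  rw [cutStep, norm_smul, Real.norm_of_nonneg (cut_nonneg J k s)]
  exact mul_le_of_le_one_left (norm_nonneg _) (cut_le_one J k s)

variable [MeasurableSpace E] [BorelSpace E] [SecondCountableTopology E]

lemma IsBddMeas.cutStep {f : ℝ → E} (hf : IsBddMeas f) (J : Finset ℕ) (κ : ℕ → Measure ℝ)
    [∀ k, IsProbabilityMeasure (κ k)] (k : ℕ) : IsBddMeas (cutStep J κ k f) := by
  obtain ⟨C, hC⟩ := (hf.integral_add (κ k)).2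
  exact ⟨(measurable_cut J k).smul (hf.integral_add (κ k)).1, C,
    fun s => (norm_cutStep_le J κ k f s).trans (hC s)⟩

lemma IsBddMeas.backward_cutStep {f : ℝ → E} (hf : IsBddMeas f) (J : Finset ℕ)
    (κ : ℕ → Measure ℝ) [∀ k, IsProbabilityMeasure (κ k)] {n k : ℕ} (hk : k ≤ n) :
    IsBddMeas (backward (GREM.cutStep J κ) f n k) :=
  backward_induction (p := fun _ f => IsBddMeas f) hf (fun k _ _ hf => hf.cutStep J κ k) hk

end

lemma cutError_nonneg (J : Finset ℕ) (lam : ℝ) (γ : ℕ → ℝ) (k : ℕ) (s : ℝ) :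
    0 ≤ cutError J lam γ k s := by
  unfold cutError
  split_ifs
  · exact (Real.exp_pos _).le
  · exact le_min zero_le_one (levelWeight_pos _ _ _).le

lemma isBddMeas_cutError (J : Finset ℕ) {lam : ℝ} (hlam : 0 ≤ lam) (γ : ℕ → ℝ) (k : ℕ) :
    IsBddMeas (cutError J lam γ k) := by
  refine ⟨?_, 1, fun s => ?_⟩
  · unfold cutError levelWeight
    split_ifs
    · fun_prop
    · fun_prop
  · rw [Real.norm_of_nonneg (cutError_nonneg J lam γ k s), cutError]
    split_ifs
    · rw [Real.exp_le_one_iff]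
      have := abs_nonneg s
      have := mul_nonneg hlam this
      linarith
    · exact min_le_left _ _

section

variable {m : ℕ} {κ : ℕ → Measure ℝ} {lam : ℝ} {γ : ℕ → ℝ} {J : Finset ℕ} {g : ℕ → ℝ → ℂ}
  {C C₀ ε : ℝ}

/-- Of the constant, `C ^ 2` pays for the quadratic error, `2 * C` for the difference of two
quantities bounded by `C`, and `2` for the trivial bound on a deviation. -/
lemma norm_sub_cutStep_le (hC : 0 ≤ C) (hγ : ∀ k ∈ J, γ k = 0)
    (h1 : ∀ k ≤ m, ∀ s, ‖g k s‖ ≤ ∫ y, ‖g (k + 1) (s + y)‖ ∂κ k)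
    (h2 : ∀ k ≤ m, ∀ s, ‖g k s - ∫ y, g (k + 1) (s + y) ∂κ k‖ ≤
      levelWeight lam (γ k) s * (∫ y, ‖g (k + 1) (s + y)‖ ∂κ k) ^ 2)
    (h3 : ∀ k ≤ m, ∀ s, ‖g k s‖ ≤ 2 / levelWeight lam (γ k) s)
    (h4 : ∀ k ≤ m, ∀ s, ∫ y, ‖g (k + 1) (s + y)‖ ∂κ k ≤ C) {k : ℕ} (hk : k ≤ m) (s : ℝ) :
    ‖g k s - cutStep J κ k (g (k + 1)) s‖ ≤ (C ^ 2 + 2 * C + 2) * cutError J lam γ k s := by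
  have hE := levelWeight_pos lam (γ k) s
  have h0 : 0 ≤ ∫ y, ‖g (k + 1) (s + y)‖ ∂κ k := integral_nonneg fun _ => norm_nonneg _
  have hsq : ‖g k s - ∫ y, g (k + 1) (s + y) ∂κ k‖ ≤ C ^ 2 * levelWeight lam (γ k) s := by
    refine (h2 k hk s).trans ?_
    rw [mul_comm]
    exact mul_le_mul_of_nonneg_right (pow_le_pow_left₀ h0 (h4 k hk s) 2) hE.le
  rw [cutStep, cutError]
  by_cases hJ : k ∈ J
  · rw [if_pos hJ]
    have hexp := Real.exp_pos (-(lam * |s|))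
    -- Above the cut the function itself is at most `2 exp (-lam s)`; below it the linearization
    -- error carries `exp (lam s)`. Both are multiples of `exp (-lam |s|)`.
    by_cases hs : 0 < s
    · have h := h3 k hk s
      rw [cut, if_pos ⟨hJ, hs⟩, zero_smul, sub_zero]
      rw [levelWeight, hγ k hJ, sub_zero, div_eq_mul_inv, ← Real.exp_neg] at h
      rw [abs_of_pos hs] at hexp ⊢
      nlinarith
    · rw [cut, if_neg fun h => hs h.2, one_smul]
      rw [levelWeight, hγ k hJ, sub_zero] at hsq
      rw [abs_of_nonpos (not_lt.1 hs), mul_neg, neg_neg] at hexp ⊢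
      nlinarith
  · rw [if_neg hJ, cut_of_notMem hJ, one_smul]
    have hlin : ‖g k s - ∫ y, g (k + 1) (s + y) ∂κ k‖ ≤ 2 * C := by
      refine (norm_sub_le _ _).trans ?_
      have h5 := (h1 k hk s).trans (h4 k hk s)
      have h6 := (norm_integral_le_integral_norm (μ := κ k) fun y => g (k + 1) (s + y)).trans
        (h4 k hk s)
      linarith
    rcases min_cases 1 (levelWeight lam (γ k) s) with ⟨h, _⟩ | ⟨h, _⟩ <;> rw [h]
    · nlinarith
    · nlinarith

variable [∀ k, IsProbabilityMeasure (κ k)]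

/-- By the union bounds, a uniform bound after the last smoothing step propagates to all earlier
levels, since averaging does not increase it. -/
lemma integral_norm_le_of_last (hg : ∀ k ≤ m + 1, IsBddMeas (g k))
    (h1 : ∀ k ≤ m, ∀ s, ‖g k s‖ ≤ ∫ y, ‖g (k + 1) (s + y)‖ ∂κ k)
    (hlast : ∀ s, ∫ y, ‖g (m + 1) (s + y)‖ ∂κ m ≤ C) {k : ℕ} (hk : k ≤ m) (s : ℝ) :
    ∫ y, ‖g (k + 1) (s + y)‖ ∂κ k ≤ C := by
  induction hk using Nat.decreasingInduction generalizing s with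
  | self => exact hlast s
  | of_succ k hk ih =>
    refine (integral_mono ((hg (k + 1) (by omega)).norm.integrable _ s) (integrable_const C)
      fun y => (h1 (k + 1) hk _).trans (ih _)).trans (by simp)

/-- The cut-off error is not small pointwise near the origin, only after averaging over a kernel, so
distances are measured in that way. The weight `1 + exp s` grows by at most the factor `C₀` per
level, and `r` levels contribute one error each. -/
theorem integral_norm_sub_backward_cutStep_le (hlam : 0 ≤ lam) (hC : 0 ≤ C) (hC₀ : 1 ≤ C₀)
    (hε : 0 ≤ ε) (hγ : ∀ k ∈ J, γ k = 0) (hg : ∀ k ≤ m + 1, IsBddMeas (g k))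
    (h1 : ∀ k ≤ m, ∀ s, ‖g k s‖ ≤ ∫ y, ‖g (k + 1) (s + y)‖ ∂κ k)
    (h2 : ∀ k ≤ m, ∀ s, ‖g k s - ∫ y, g (k + 1) (s + y) ∂κ k‖ ≤
      levelWeight lam (γ k) s * (∫ y, ‖g (k + 1) (s + y)‖ ∂κ k) ^ 2)
    (h3 : ∀ k ≤ m, ∀ s, ‖g k s‖ ≤ 2 / levelWeight lam (γ k) s)
    (h4 : ∀ k ≤ m, ∀ s, ∫ y, ‖g (k + 1) (s + y)‖ ∂κ k ≤ C)
    (hexp : ∀ k ≤ m, Integrable Real.exp (κ k) ∧ ∫ y, Real.exp y ∂κ k ≤ C₀)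
    (hQ : ∀ k < m, ∀ s, ∫ y, cutError J lam γ (k + 1) (s + y) ∂κ k ≤ ε * (1 + Real.exp s))
    (r k : ℕ) (hk : k + r = m) (s : ℝ) :
    ∫ y, ‖g (k + 1) (s + y) - backward (cutStep J κ) (g (m + 1)) (m + 1) (k + 1) (s + y)‖ ∂κ k ≤
      r * C₀ ^ r * (C ^ 2 + 2 * C + 2) * ε * (1 + Real.exp s) := by
  induction r generalizing k s with
  | zero =>
    obtain rfl : k = m := by omega
    simp [backward_self]
  | succ r ih =>
    set C₁ := C ^ 2 + 2 * C + 2 with hC₁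
    have hC₁0 : 0 ≤ C₁ := by positivity
    have hb := (hg (m + 1) le_rfl).backward_cutStep J κ (n := m + 1) (k := k + 2) (by omega)
    have hb1 := (hg (m + 1) le_rfl).backward_cutStep J κ (n := m + 1) (k := k + 1) (by omega)
    have hpt : ∀ s, ‖g (k + 1) s - backward (cutStep J κ) (g (m + 1)) (m + 1) (k + 1) s‖ ≤
        C₁ * cutError J lam γ (k + 1) s + r * C₀ ^ r * C₁ * ε * (1 + Real.exp s) := fun s => by
      rw [backward_of_lt _ _ (show k + 1 < m + 1 by omega)]
      have ha := norm_sub_cutStep_le hC hγ h1 h2 h3 h4 (show k + 1 ≤ m by omega) s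
      have hc : ‖cutStep J κ (k + 1) (g (k + 2)) s - cutStep J κ (k + 1)
          (backward (cutStep J κ) (g (m + 1)) (m + 1) (k + 2)) s‖ ≤
          r * C₀ ^ r * C₁ * ε * (1 + Real.exp s) := by
        rw [cutStep, cutStep, ← smul_sub, ← integral_sub ((hg (k + 2) (by omega)).integrable _ s)
          (hb.integrable _ s), norm_smul, Real.norm_of_nonneg (cut_nonneg J _ s)]
        refine (mul_le_of_le_one_left (norm_nonneg _) (cut_le_one J _ s)).trans ?_
        exact (norm_integral_le_integral_norm _).trans (ih (k + 1) (by omega) s)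
      calc _ = ‖(g (k + 1) s - cutStep J κ (k + 1) (g (k + 1 + 1)) s) +
            (cutStep J κ (k + 1) (g (k + 2)) s - cutStep J κ (k + 1)
              (backward (cutStep J κ) (g (m + 1)) (m + 1) (k + 2)) s)‖ := by congr 1; abel
        _ ≤ _ := (norm_add_le _ _).trans (add_le_add ha hc)
    have hi1 := (isBddMeas_cutError J hlam γ (k + 1)).integrable (κ k) s
    have hi2 : Integrable (fun y => 1 + Real.exp (s + y)) (κ k) := by
      simp_rw [Real.exp_add]
      exact (integrable_const _).add ((hexp k (by omega)).1.const_mul _)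
    have hval : ∫ y, (1 + Real.exp (s + y)) ∂κ k ≤ C₀ * (1 + Real.exp s) := by
      simp_rw [Real.exp_add]
      rw [integral_add (integrable_const _) ((hexp k (by omega)).1.const_mul _),
        integral_const_mul]
      have h5 := mul_le_mul_of_nonneg_left (hexp k (by omega)).2 (Real.exp_pos s).le
      simp only [integral_const, probReal_univ, one_smul]
      linarith
    calc _ ≤ ∫ y, (C₁ * cutError J lam γ (k + 1) (s + y) +
          r * C₀ ^ r * C₁ * ε * (1 + Real.exp (s + y))) ∂κ k :=
          integral_mono (((hg (k + 1) (by omega)).sub hb1).norm.integrable _ s)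
            ((hi1.const_mul _).add (hi2.const_mul _)) fun y => hpt (s + y)
      _ = C₁ * ∫ y, cutError J lam γ (k + 1) (s + y) ∂κ k +
          r * C₀ ^ r * C₁ * ε * ∫ y, (1 + Real.exp (s + y)) ∂κ k := by
          rw [integral_add (hi1.const_mul _) (hi2.const_mul _), integral_const_mul,
            integral_const_mul]
      _ ≤ C₁ * (ε * (1 + Real.exp s)) + r * C₀ ^ r * C₁ * ε * (C₀ * (1 + Real.exp s)) := by
          have := hQ k (by omega) s
          gcongr
      _ ≤ _ := by
          have h6 : (1 : ℝ) ≤ C₀ ^ (r + 1) := one_le_pow₀ hC₀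
          have h7 : 0 ≤ C₁ * (ε * (1 + Real.exp s)) := by positivity
          have h8 := mul_le_mul_of_nonneg_right h6 h7
          push_cast
          rw [pow_succ] at h8 ⊢
          linarith

end

/-! ### Convolution of Gaussian densities -/

lemma continuous_gaussianPDFReal (η : ℝ) (a : NNReal) : Continuous (gaussianPDFReal η a) := by
  unfold gaussianPDFReal
  fun_prop

lemma gaussianPDFReal_zero_neg (a : NNReal) (y : ℝ) :
    gaussianPDFReal 0 a (-y) = gaussianPDFReal 0 a y := by
  simp [gaussianPDFReal]

lemma gaussianPDFReal_eq_zero_sub (η : ℝ) (a : NNReal) (y : ℝ) :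
    gaussianPDFReal η a y = gaussianPDFReal 0 a (y - η) := by
  simp [gaussianPDFReal]

lemma integral_gaussianPDFReal_sub (V : NNReal) {a : NNReal} (ha : a ≠ 0) (y : ℝ) :
    ∫ z, gaussianPDFReal 0 a (y - z) ∂gaussianReal 0 V = gaussianPDFReal 0 (a + V) y := by
  rcases eq_or_ne V 0 with rfl | hV
  · simp [gaussianReal_zero_var]
  have ha' : (0 : ℝ) < a := by exact_mod_cast pos_iff_ne_zero.2 ha
  have hV' : (0 : ℝ) < V := by exact_mod_cast pos_iff_ne_zero.2 hV
  have hW : a * V / (a + V) ≠ 0 := by positivity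
  have hmul : ∀ z, gaussianPDFReal 0 V z • gaussianPDFReal 0 a (y - z) =
      gaussianPDFReal 0 (a + V) y * gaussianPDFReal (V * y / (a + V)) (a * V / (a + V)) z := fun z => by
    simp only [gaussianPDFReal, smul_eq_mul, NNReal.coe_div, NNReal.coe_mul, NNReal.coe_add, sub_zero]
    rw [mul_mul_mul_comm, mul_mul_mul_comm (Real.sqrt (2 * Real.pi * (a + V)))⁻¹, ← mul_inv, ← mul_inv, ← Real.sqrt_mul (by positivity),
      ← Real.sqrt_mul (by positivity), ← Real.exp_add, ← Real.exp_add]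
    congr 2
    · congr 1
      field_simp
    · field_simp
      ring
  rw [integral_gaussianReal_eq_integral_smul hV]
  simp_rw [hmul]
  rw [integral_const_mul, integral_gaussianPDFReal_eq_one _ hW, mul_one]

lemma integral_gaussianPDFReal_add (V : NNReal) {a : NNReal} (ha : a ≠ 0) (s : ℝ) :
    ∫ y, gaussianPDFReal 0 a (s + y) ∂gaussianReal 0 V = gaussianPDFReal 0 (a + V) s := by
  rw [← gaussianPDFReal_zero_neg, ← integral_gaussianPDFReal_sub V ha]
  refine integral_congr_ae (ae_of_all _ fun y => ?_)
  beta_reduce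
  rw [← gaussianPDFReal_zero_neg]
  congr 1
  ring

/-! ### The central limit theorem for the fields of tilted spins -/

lemma one_sub_tanh_sq_pos (θ : ℝ) : 0 < 1 - Real.tanh θ ^ 2 := by
  have h := (sq_lt_one_iff_abs_lt_one _).2 (Real.abs_tanh_lt_one θ)
  linarith

/-- The law of the centered field of tilted spins. -/
def fieldLaw (θ c : ℝ) (d : ℕ) : Measure ℝ :=
  ∑ v : Spins d, ENNReal.ofReal (tiltWeight θ v) • Measure.dirac (centeredField c (Real.tanh θ) v)

instance (θ c : ℝ) (d : ℕ) : IsProbabilityMeasure (fieldLaw θ c d) := by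
  refine ⟨?_⟩
  rw [fieldLaw, Measure.finsetSum_apply]
  simp only [Measure.smul_apply, measure_univ, smul_eq_mul, mul_one]
  rw [← ENNReal.ofReal_sum_of_nonneg fun v _ => (tiltWeight_pos θ v).le, sum_tiltWeight,
    ENNReal.ofReal_one]

lemma integral_fieldLaw {E : Type*} [NormedAddCommGroup E] [NormedSpace ℝ E] [CompleteSpace E]
    (θ c : ℝ) (d : ℕ) (f : ℝ → E) : ∫ z, f z ∂fieldLaw θ c d =
      ∑ v : Spins d, tiltWeight θ v • f (centeredField c (Real.tanh θ) v) := by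
  rw [fieldLaw, integral_finsetSum_measure fun v _ =>
    (integrable_dirac (by simp)).smul_measure ENNReal.ofReal_ne_top]
  refine Finset.sum_congr rfl fun v _ => ?_
  rw [integral_smul_measure, ENNReal.toReal_ofReal (tiltWeight_pos θ v).le, integral_dirac]

/-- The law of the standardized tilted spin. -/
def stdSpinLaw (θ : ℝ) : Measure ℝ :=
  ∑ s : ℤˣ, ENNReal.ofReal (spinWeight θ s) •
    Measure.dirac ((Real.sqrt (1 - Real.tanh θ ^ 2))⁻¹ * (spin s - Real.tanh θ))

lemma integral_stdSpinLaw {E : Type*} [NormedAddCommGroup E] [NormedSpace ℝ E] [CompleteSpace E]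
    (θ : ℝ) (f : ℝ → E) : ∫ z, f z ∂stdSpinLaw θ = ∑ s : ℤˣ,
      spinWeight θ s • f ((Real.sqrt (1 - Real.tanh θ ^ 2))⁻¹ * (spin s - Real.tanh θ)) := by
  rw [stdSpinLaw, integral_finsetSum_measure fun v _ =>
    (integrable_dirac (by simp)).smul_measure ENNReal.ofReal_ne_top]
  refine Finset.sum_congr rfl fun v _ => ?_
  rw [integral_smul_measure, ENNReal.toReal_ofReal (spinWeight_pos θ v).le, integral_dirac]

lemma sum_units {E : Type*} [AddCommMonoid E] (f : ℤˣ → E) : ∑ s, f s = f 1 + f (-1) := by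
  rw [show (Finset.univ : Finset ℤˣ) = {1, -1} from rfl, Finset.sum_pair (by decide)]

instance (θ : ℝ) : IsProbabilityMeasure (stdSpinLaw θ) := by
  refine ⟨?_⟩
  rw [stdSpinLaw, Measure.finsetSum_apply]
  simp only [Measure.smul_apply, measure_univ, smul_eq_mul, mul_one]
  rw [← ENNReal.ofReal_sum_of_nonneg fun v _ => (spinWeight_pos θ v).le, sum_units, spinWeight_add,
    ENNReal.ofReal_one]

lemma integral_id_stdSpinLaw (θ : ℝ) : ∫ z, id z ∂stdSpinLaw θ = 0 := by
  rw [integral_stdSpinLaw, sum_units, spin_one, spin_neg_one, ← spinWeight_sub]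
  have h := spinWeight_add θ
  simp only [id, smul_eq_mul]
  have h7 : spinWeight θ 1 = 1 - spinWeight θ (-1) := by linarith
  rw [h7]
  ring

lemma integral_sq_stdSpinLaw (θ : ℝ) : ∫ z, (id ^ 2 : ℝ → ℝ) z ∂stdSpinLaw θ = 1 := by
  have hr := one_sub_tanh_sq_pos θ
  rw [integral_stdSpinLaw, sum_units, spin_one, spin_neg_one]
  simp only [Pi.pow_apply, id, smul_eq_mul, mul_pow, inv_pow, Real.sq_sqrt hr.le]
  have h1 := spinWeight_add θ
  have h2 := spinWeight_sub θ
  have h3 : spinWeight θ 1 * (1 - Real.tanh θ) ^ 2 + spinWeight θ (-1) * (-1 - Real.tanh θ) ^ 2 =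
      1 - Real.tanh θ ^ 2 := by
    have h4 : spinWeight θ 1 = (1 + Real.tanh θ) / 2 := by linarith
    have h5 : spinWeight θ (-1) = (1 - Real.tanh θ) / 2 := by linarith
    rw [h4, h5]
    ring
  field_simp
  linarith

lemma charFun_fieldLaw (θ c : ℝ) (d : ℕ) (u : ℝ) : charFun (fieldLaw θ c d) u =
    charFun (stdSpinLaw θ) (c * (Real.sqrt (1 - Real.tanh θ ^ 2) * u)) ^ d := by
  have hr := Real.sqrt_pos.2 (one_sub_tanh_sq_pos θ)
  rw [charFun_apply_real, charFun_apply_real, integral_fieldLaw, integral_stdSpinLaw, sum_units,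
    ← sum_prod_spins d fun s => spinWeight θ s • Complex.exp
      ((c * (Real.sqrt (1 - Real.tanh θ ^ 2) * u) : ℝ) *
        ((Real.sqrt (1 - Real.tanh θ ^ 2))⁻¹ * (spin s - Real.tanh θ) : ℝ) * Complex.I)]
  refine Finset.sum_congr rfl fun v _ => ?_
  simp_rw [Complex.real_smul]
  rw [Finset.prod_mul_distrib, ← Complex.exp_sum, tiltWeight, Complex.ofReal_prod, centeredField]
  congr 2
  rw [Complex.ofReal_sum, Finset.mul_sum, Finset.sum_mul]
  refine Finset.sum_congr rfl fun i _ => ?_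
  rw [← Complex.ofReal_mul, ← Complex.ofReal_mul]
  congr 2
  field_simp

/-- The field is a normalized sum of independent tilted spins, each of variance `1 - tanh² θ`, so
this is the central limit theorem. -/
lemma tendsto_integral_fieldLaw (θ σ : ℝ) (f : BoundedContinuousFunction ℝ ℝ) :
    Tendsto (fun d : ℕ => ∫ z, f z ∂fieldLaw θ ((Real.sqrt d)⁻¹ * σ) d) atTop
      (𝓝 (∫ z, f z ∂gaussianReal 0 (σ ^ 2 * (1 - Real.tanh θ ^ 2)).toNNReal)) := by
  have hr := one_sub_tanh_sq_pos θ
  let μ : ℕ → ProbabilityMeasure ℝ := fun d => ⟨fieldLaw θ ((Real.sqrt d)⁻¹ * σ) d, inferInstance⟩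
  let μ₀ : ProbabilityMeasure ℝ :=
    ⟨gaussianReal 0 (σ ^ 2 * (1 - Real.tanh θ ^ 2)).toNNReal, inferInstance⟩
  have h : Tendsto μ atTop (𝓝 μ₀) := by
    refine ProbabilityMeasure.tendsto_of_tendsto_charFun fun u => ?_
    have h1 := tendsto_charFun_inv_sqrt_mul_pow (P := stdSpinLaw θ) (X := id)
      measurable_id.aemeasurable (integral_id_stdSpinLaw θ) (integral_sq_stdSpinLaw θ)
      (σ * (Real.sqrt (1 - Real.tanh θ ^ 2) * u))
    rw [Measure.map_id] at h1
    change Tendsto (fun d : ℕ => charFun (fieldLaw θ ((Real.sqrt d)⁻¹ * σ) d) u) atTop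
      (𝓝 (charFun (gaussianReal 0 (σ ^ 2 * (1 - Real.tanh θ ^ 2)).toNNReal) u))
    simp_rw [charFun_fieldLaw, mul_assoc]
    rw [charFun_gaussianReal]
    convert h1 using 3
    rw [Real.coe_toNNReal _ (by positivity)]
    have h2 : (σ * (Real.sqrt (1 - Real.tanh θ ^ 2) * u)) ^ 2 =
        σ ^ 2 * (1 - Real.tanh θ ^ 2) * u ^ 2 := by
      rw [mul_pow, mul_pow, Real.sq_sqrt hr.le]
      ring
    rw [← Complex.ofReal_pow (σ * (Real.sqrt (1 - Real.tanh θ ^ 2) * u)), h2]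
    push_cast
    ring
  exact (ProbabilityMeasure.tendsto_iff_forall_integral_tendsto.1 h) f

/-! ### Convergence of the tilted kernels in total variation -/

/-- The density of the tilted kernel. -/
def tiltDensity (θ c : ℝ) (a : NNReal) (d : ℕ) (y : ℝ) : ℝ :=
  ∑ v : Spins d, tiltWeight θ v * gaussianPDFReal (centeredField c (Real.tanh θ) v) a y

lemma integrable_tiltDensity (θ c : ℝ) (a : NNReal) (d : ℕ) :
    Integrable (tiltDensity θ c a d) :=
  integrable_finsetSum _ fun _ _ => (integrable_gaussianPDFReal _ _).const_mul _

lemma tiltDensity_nonneg (θ c : ℝ) (a : NNReal) (d : ℕ) (y : ℝ) : 0 ≤ tiltDensity θ c a d y :=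
  Finset.sum_nonneg fun v _ => mul_nonneg (tiltWeight_pos θ v).le (gaussianPDFReal_nonneg _ _ _)

lemma integral_tiltDensity (θ c : ℝ) {a : NNReal} (ha : a ≠ 0) (d : ℕ) :
    ∫ y, tiltDensity θ c a d y = 1 := by
  unfold tiltDensity
  rw [integral_finsetSum _ fun v _ => (integrable_gaussianPDFReal _ _).const_mul _]
  simp_rw [integral_const_mul, integral_gaussianPDFReal_eq_one _ ha, mul_one]
  exact sum_tiltWeight θ d

/-- The density at `y` is the mean of the bounded continuous function `z ↦ gaussianPDFReal 0 a (y -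
z)` under the law of the field. The Gaussian component thus upgrades weak convergence to pointwise
convergence of densities. -/
lemma tendsto_tiltDensity (θ σ : ℝ) {a : NNReal} (ha : a ≠ 0) (y : ℝ) :
    Tendsto (fun d : ℕ => tiltDensity θ ((Real.sqrt d)⁻¹ * σ) a d y) atTop
      (𝓝 (gaussianPDFReal 0 (a + (σ ^ 2 * (1 - Real.tanh θ ^ 2)).toNNReal) y)) := by
  let f : BoundedContinuousFunction ℝ ℝ := BoundedContinuousFunction.ofNormedAddCommGroup
    (fun z => gaussianPDFReal 0 a (y - z))
    ((continuous_gaussianPDFReal 0 a).comp (continuous_const.sub continuous_id))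
    (Real.sqrt (2 * Real.pi * a))⁻¹ fun z => by
      rw [Real.norm_of_nonneg (gaussianPDFReal_nonneg _ _ _)]
      exact gaussianPDFReal_le _ _ _
  have h := tendsto_integral_fieldLaw θ σ f
  have h1 : ∀ d : ℕ, ∫ z, f z ∂fieldLaw θ ((Real.sqrt d)⁻¹ * σ) d =
      tiltDensity θ ((Real.sqrt d)⁻¹ * σ) a d y := fun d => by
    rw [integral_fieldLaw, tiltDensity]
    refine Finset.sum_congr rfl fun v _ => ?_
    rw [gaussianPDFReal_eq_zero_sub]
    rfl
  simp_rw [h1] at h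
  have h2 : ∫ z, f z ∂gaussianReal 0 (σ ^ 2 * (1 - Real.tanh θ ^ 2)).toNNReal =
      gaussianPDFReal 0 (a + (σ ^ 2 * (1 - Real.tanh θ ^ 2)).toNNReal) y :=
    integral_gaussianPDFReal_sub _ ha y
  rwa [h2] at h

/-- Scheffé's lemma. -/
lemma tendsto_integral_abs_sub {p : ℕ → ℝ → ℝ} {q : ℝ → ℝ} (hp : ∀ n, Integrable (p n))
    (hq : Integrable q) (hp0 : ∀ n y, 0 ≤ p n y) (hq0 : ∀ y, 0 ≤ q y)
    (hpq : ∀ n, ∫ y, p n y = ∫ y, q y) (h : ∀ y, Tendsto (fun n => p n y) atTop (𝓝 (q y))) :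
    Tendsto (fun n => ∫ y, |p n y - q y|) atTop (𝓝 0) := by
  have hi : ∀ n, Integrable fun y => max (q y - p n y) 0 := fun n => (hq.sub (hp n)).pos_part
  have h1 : Tendsto (fun n => ∫ y, max (q y - p n y) 0) atTop (𝓝 (∫ _ : ℝ, (0 : ℝ))) := by
    refine tendsto_integral_of_dominated_convergence q (fun n => (hi n).aestronglyMeasurable) hq
      (fun n => ae_of_all _ fun y => ?_) (ae_of_all _ fun y => ?_)
    · rw [Real.norm_of_nonneg (le_max_right _ _)]
      exact max_le (by linarith [hp0 n y]) (hq0 y)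
    · have := (tendsto_const_nhds (x := q y)).sub (h y)
      rw [sub_self] at this
      simpa using this.max (tendsto_const_nhds (x := (0 : ℝ)))
  rw [integral_zero] at h1
  -- Equal total masses make the positive and negative parts of the difference equally large, and
  -- the part where `q` exceeds `p n` is dominated by `q`.
  have h2 : ∀ n, ∫ y, |p n y - q y| = 2 * ∫ y, max (q y - p n y) 0 := fun n => by
    have h3 : ∀ y, |p n y - q y| = (p n y - q y) + 2 * max (q y - p n y) 0 := fun y => by
      rcases le_total (q y - p n y) 0 with h | h
      · rw [max_eq_right h, abs_of_nonneg (by linarith)]; ring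
      · rw [max_eq_left h, abs_of_nonpos (by linarith)]; ring
    have h4 : Integrable fun y => p n y - q y := (hp n).sub hq
    simp_rw [h3]
    rw [integral_add h4 ((hi n).const_mul 2), integral_sub (hp n) hq, hpq, sub_self,
      zero_add, integral_const_mul]
  simp_rw [h2]
  simpa using h1.const_mul 2

lemma integral_tiltKernel_eq_tiltDensity {f : ℝ → ℂ} (hf : IsBddMeas f) (θ c : ℝ) {a : NNReal}
    (ha : a ≠ 0) (d : ℕ) (s : ℝ) :
    ∫ y, f (s + y) ∂tiltKernel θ c a d = ∫ y, tiltDensity θ c a d y • f (s + y) := by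
  obtain ⟨C, hC⟩ := hf.2
  rw [tiltKernel_integral_bdd hf]
  unfold tiltDensity
  simp_rw [Finset.sum_smul, mul_smul]
  rw [integral_finsetSum]
  · refine Finset.sum_congr rfl fun v _ => ?_
    rw [integral_gaussianReal_eq_integral_smul ha, integral_smul]
  · intro v _
    refine Integrable.smul _ ((integrable_gaussianPDFReal _ _).smul_bdd C
      (hf.1.comp (measurable_const_add s)).aestronglyMeasurable (ae_of_all _ fun y => hC _))

/-- Total variation is the right mode of convergence here: the cut-offs are discontinuous, and the
estimate has to be uniform in the translation `s`. -/
theorem exists_tendsto_tiltKernel (θ σ : ℝ) {a : NNReal} (ha : a ≠ 0) :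
    ∃ δ : ℕ → ℝ, Tendsto δ atTop (𝓝 0) ∧ ∀ (d : ℕ) (f : ℝ → ℂ) (B : ℝ), Measurable f →
      (∀ s, ‖f s‖ ≤ B) → ∀ s,
      ‖∫ y, f (s + y) ∂tiltKernel θ ((Real.sqrt d)⁻¹ * σ) a d -
        ∫ y, f (s + y) ∂gaussianReal 0 (a + (σ ^ 2 * (1 - Real.tanh θ ^ 2)).toNNReal)‖ ≤
      B * δ d := by
  set W := a + (σ ^ 2 * (1 - Real.tanh θ ^ 2)).toNNReal
  have hW : W ≠ 0 := by positivity
  refine ⟨fun d => ∫ y, |tiltDensity θ ((Real.sqrt d)⁻¹ * σ) a d y - gaussianPDFReal 0 W y|,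
    tendsto_integral_abs_sub (fun d => integrable_tiltDensity _ _ _ _)
      (integrable_gaussianPDFReal _ _) (fun d y => tiltDensity_nonneg _ _ _ _ _)
      (fun y => gaussianPDFReal_nonneg _ _ _) (fun d => ?_) (tendsto_tiltDensity θ σ ha), ?_⟩
  · rw [integral_tiltDensity _ _ ha, integral_gaussianPDFReal_eq_one _ hW]
  intro d f B hf hB s
  have hf' : IsBddMeas f := ⟨hf, B, hB⟩
  have hm := (hf.comp (measurable_const_add s)).aestronglyMeasurable (μ := volume)
  have hi1 : Integrable fun y => tiltDensity θ ((Real.sqrt d)⁻¹ * σ) a d y • f (s + y) :=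
    (integrable_tiltDensity _ _ _ _).smul_bdd B hm (ae_of_all _ fun y => hB (s + y))
  have hi2 : Integrable fun y => gaussianPDFReal 0 W y • f (s + y) :=
    (integrable_gaussianPDFReal 0 W).smul_bdd B hm (ae_of_all _ fun y => hB (s + y))
  rw [integral_tiltKernel_eq_tiltDensity hf' _ _ ha, integral_gaussianReal_eq_integral_smul hW,
    ← integral_sub hi1 hi2, ← integral_const_mul]
  refine norm_integral_le_of_norm_le (((integrable_tiltDensity _ _ _ _).sub
    (integrable_gaussianPDFReal _ _)).abs.const_mul B) (ae_of_all _ fun y => ?_)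
  rw [← sub_smul, norm_smul, mul_comm, Real.norm_eq_abs]
  exact mul_le_mul_of_nonneg_right (hB _) (abs_nonneg _)

/-! ### Densities of Gaussian walks with cut-offs -/

/-- The density at `-s` of a Gaussian walk started at level `k` which satisfies the constraints at
the levels in `J`. -/
def cutDensity (J : Finset ℕ) (V : ℕ → NNReal) (m : ℕ) : ℕ → ℝ → ℝ :=
  backward (cutStep J fun k => gaussianReal 0 (V k)) (gaussianPDFReal 0 (V m)) m

section

variable {J : Finset ℕ} {V : ℕ → NNReal} {m : ℕ}

lemma cutDensity_self : cutDensity J V m m = gaussianPDFReal 0 (V m) := backward_self _ _ _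

lemma cutDensity_of_lt {k : ℕ} (hk : k < m) (s : ℝ) : cutDensity J V m k s =
    cut J k s * ∫ y, cutDensity J V m (k + 1) (s + y) ∂gaussianReal 0 (V k) :=
  congrFun (backward_of_lt _ _ hk) s

lemma isBddMeas_gaussianPDFReal (η : ℝ) (a : NNReal) : IsBddMeas (gaussianPDFReal η a) :=
  ⟨measurable_gaussianPDFReal η a, (Real.sqrt (2 * Real.pi * a))⁻¹, fun s => by
    rw [Real.norm_of_nonneg (gaussianPDFReal_nonneg _ _ _)]
    exact gaussianPDFReal_le _ _ _⟩

lemma isBddMeas_cutDensity {k : ℕ} (hk : k ≤ m) : IsBddMeas (cutDensity J V m k) :=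
  (isBddMeas_gaussianPDFReal _ _).backward_cutStep J _ hk

lemma cutDensity_nonneg {k : ℕ} (hk : k ≤ m) (s : ℝ) : 0 ≤ cutDensity J V m k s := by
  induction hk using Nat.decreasingInduction generalizing s with
  | self => rw [cutDensity_self]; exact gaussianPDFReal_nonneg _ _ _
  | of_succ k hk ih =>
    rw [cutDensity_of_lt hk]
    exact mul_nonneg (cut_nonneg _ _ _) (integral_nonneg fun y => ih _)

/-- The variance accumulated from level `k` on. -/
def tailVar (V : ℕ → NNReal) (m k : ℕ) : NNReal := ∑ j ∈ Finset.Ico k (m + 1), V j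

lemma tailVar_self : tailVar V m m = V m := by simp [tailVar]

lemma tailVar_of_lt {k : ℕ} (hk : k < m) : tailVar V m k = tailVar V m (k + 1) + V k := by
  rw [tailVar, tailVar, Finset.sum_eq_sum_Ico_succ_bot (by omega), add_comm]

lemma tailVar_ne_zero (hV : V m ≠ 0) {k : ℕ} (hk : k ≤ m) : tailVar V m k ≠ 0 := fun h =>
  hV (Finset.sum_eq_zero_iff.1 h m (Finset.mem_Ico.2 ⟨hk, Nat.lt_succ_self m⟩))

lemma integral_gaussianPDFReal_tailVar (hV : V m ≠ 0) {k : ℕ} (hk : k < m) (s : ℝ) :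
    ∫ y, gaussianPDFReal 0 (tailVar V m (k + 1)) (s + y) ∂gaussianReal 0 (V k) =
      gaussianPDFReal 0 (tailVar V m k) s := by
  rw [integral_gaussianPDFReal_add _ (tailVar_ne_zero hV hk), tailVar_of_lt hk]

lemma cutDensity_le (hV : V m ≠ 0) {k : ℕ} (hk : k ≤ m) (s : ℝ) :
    cutDensity J V m k s ≤ gaussianPDFReal 0 (tailVar V m k) s := by
  induction hk using Nat.decreasingInduction generalizing s with
  | self => rw [cutDensity_self, tailVar_self]
  | of_succ k hk ih =>
    rw [cutDensity_of_lt hk, ← integral_gaussianPDFReal_tailVar hV hk]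
    refine (mul_le_of_le_one_left (integral_nonneg fun y => cutDensity_nonneg hk _)
      (cut_le_one _ _ _)).trans ?_
    exact integral_mono ((isBddMeas_cutDensity hk).integrable _ s)
      ((isBddMeas_gaussianPDFReal _ _).integrable _ s) fun y => ih _

lemma cutDensity_eq (hV : V m ≠ 0) (hJ : J = ∅) {k : ℕ} (hk : k ≤ m) (s : ℝ) :
    cutDensity J V m k s = gaussianPDFReal 0 (tailVar V m k) s := by
  induction hk using Nat.decreasingInduction generalizing s with
  | self => rw [cutDensity_self, tailVar_self]
  | of_succ k hk ih =>
    rw [cutDensity_of_lt hk, ← integral_gaussianPDFReal_tailVar hV hk,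
      cut_of_notMem (by simp [hJ]), one_mul]
    simp_rw [ih]

lemma integral_gaussianReal_pos {a : NNReal} (ha : a ≠ 0) {f : ℝ → ℝ} (hf : IsBddMeas f)
    (h0 : ∀ s, 0 ≤ f s) (s : ℝ) {U : Set ℝ} (hU : volume U ≠ 0) (h : ∀ y ∈ U, 0 < f (s + y)) :
    0 < ∫ y, f (s + y) ∂gaussianReal 0 a := by
  rw [integral_pos_iff_support_of_nonneg (fun y => h0 _) (hf.integrable _ s), pos_iff_ne_zero]
  intro hz
  refine hU (measure_mono_null (fun y hy => ?_) (gaussianReal_absolutelyContinuous' 0 ha hz))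
  exact (h y hy).ne'

/-- From a nonpositive position the walk stays nonpositive at the next level with positive
probability, and the last step has a positive density. -/
lemma cutDensity_pos (hV : ∀ k ≤ m, V k ≠ 0) {k : ℕ} (hk : k ≤ m) {s : ℝ} (hs : s ≤ 0) :
    0 < cutDensity J V m k s := by
  induction hk using Nat.decreasingInduction generalizing s with
  | self => rw [cutDensity_self]; exact gaussianPDFReal_pos _ _ _ (hV m le_rfl)
  | of_succ k hk ih =>
    rw [cutDensity_of_lt hk, cut, if_neg fun h => absurd h.2 (not_lt.2 hs), one_mul]
    refine integral_gaussianReal_pos (hV k hk.le) (isBddMeas_cutDensity hk)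
      (fun s => cutDensity_nonneg hk s) s (U := Set.Iio (-s)) (by simp) fun y hy => ih ?_
    rw [Set.mem_Iio] at hy
    linarith

/-- The cut at level `j` destroys the density on the positive half-line. One nondegenerate Gaussian
step backwards spreads this deficit to every starting point. -/
lemma cutDensity_lt (hV : ∀ k ≤ m, V k ≠ 0) {j : ℕ} (hj : j ∈ J) (hjm : j < m) {k : ℕ}
    (hk : k ≤ j) {s : ℝ} (hs : 0 < s ∨ k < j) :
    cutDensity J V m k s < gaussianPDFReal 0 (tailVar V m k) s := by
  induction hk using Nat.decreasingInduction generalizing s with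
  | self =>
    have hs' : 0 < s := by simpa using hs
    rw [cutDensity_of_lt hjm, cut, if_pos ⟨hj, hs'⟩, zero_mul]
    exact gaussianPDFReal_pos _ _ _ (tailVar_ne_zero (hV m le_rfl) hjm.le)
  | of_succ k hk ih =>
    have hkm : k < m := hk.trans hjm
    rw [cutDensity_of_lt hkm, ← integral_gaussianPDFReal_tailVar (hV m le_rfl) hkm]
    refine (mul_le_of_le_one_left (integral_nonneg fun y => cutDensity_nonneg hkm _)
      (cut_le_one _ _ _)).trans_lt ?_
    rw [← sub_pos, ← integral_sub ((isBddMeas_gaussianPDFReal _ _).integrable _ s)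
      ((isBddMeas_cutDensity hkm).integrable _ s)]
    refine integral_gaussianReal_pos (hV k hkm.le)
      ((isBddMeas_gaussianPDFReal _ _).sub (isBddMeas_cutDensity hkm))
      (fun s => sub_nonneg.2 (cutDensity_le (hV m le_rfl) hkm s)) s (U := Set.Ioi (-s)) (by simp)
      fun y hy => sub_pos.2 (ih (Or.inl ?_))
    rw [Set.mem_Ioi] at hy
    linarith

/-- The factor by which the constraints at the levels in `J` reduce the density at the origin. -/
def cutConstant (J : Finset ℕ) (V : ℕ → NNReal) (m : ℕ) : ℝ :=
  Real.sqrt (2 * Real.pi * tailVar V m 0) * cutDensity J V m 0 0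

lemma sqrt_mul_gaussianPDFReal_zero {a : NNReal} (ha : a ≠ 0) :
    Real.sqrt (2 * Real.pi * a) * gaussianPDFReal 0 a 0 = 1 := by
  have h : 0 < Real.sqrt (2 * Real.pi * a) := Real.sqrt_pos.2 (by positivity)
  simp [gaussianPDFReal]
  field_simp

lemma cutConstant_eq_one (hV : V m ≠ 0) (hJ : J = ∅) : cutConstant J V m = 1 := by
  rw [cutConstant, cutDensity_eq hV hJ (Nat.zero_le m),
    sqrt_mul_gaussianPDFReal_zero (tailVar_ne_zero hV (Nat.zero_le m))]

lemma cutConstant_pos (hV : ∀ k ≤ m, V k ≠ 0) : 0 < cutConstant J V m := by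
  have h := tailVar_ne_zero (hV m le_rfl) (Nat.zero_le m)
  exact mul_pos (Real.sqrt_pos.2 (by positivity)) (cutDensity_pos hV (Nat.zero_le m) le_rfl)

lemma cutConstant_lt_one (hV : ∀ k ≤ m, V k ≠ 0) {j : ℕ} (hj : j ∈ J) (hj0 : 0 < j) (hjm : j < m) :
    cutConstant J V m < 1 := by
  have h := tailVar_ne_zero (hV m le_rfl) (Nat.zero_le m)
  rw [← sqrt_mul_gaussianPDFReal_zero h]
  exact mul_lt_mul_of_pos_left (cutDensity_lt hV hj hjm hj0.le (Or.inr hj0))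
    (Real.sqrt_pos.2 (by positivity))

end

/-! ### The test functional at the last level -/

/-- The function `(1 - exp (i φ)) exp (-y)`. -/
def expDefect (φ : C_c(ℝ, ℝ)) (y : ℝ) : ℂ := (1 - Complex.exp (Complex.I * φ y)) * Real.exp (-y)

lemma continuous_expDefect (φ : C_c(ℝ, ℝ)) : Continuous (expDefect φ) := by
  have := φ.continuous
  unfold expDefect
  fun_prop

lemma expDefect_eq_zero {φ : C_c(ℝ, ℝ)} {y : ℝ} (h : φ y = 0) : expDefect φ y = 0 := by
  simp [expDefect, h]

lemma hasCompactSupport_expDefect (φ : C_c(ℝ, ℝ)) : HasCompactSupport (expDefect φ) :=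
  φ.hasCompactSupport.mono fun _ hy h => hy (expDefect_eq_zero h)

lemma integrable_expDefect (φ : C_c(ℝ, ℝ)) : Integrable (expDefect φ) :=
  (continuous_expDefect φ).integrable_of_hasCompactSupport (hasCompactSupport_expDefect φ)

/-- The functional `exp (i φ)` in centered coordinates. -/
def testFunctional (φ : C_c(ℝ, ℝ)) (A B s : ℝ) : ℂ := Complex.exp (Complex.I * φ ((s - B) / A))

lemma isDiscValued_testFunctional (φ : C_c(ℝ, ℝ)) (A B : ℝ) :
    IsDiscValued (testFunctional φ A B) := by
  have := φ.continuous
  refine ⟨?_, fun s => ?_⟩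
  · have h : Continuous (testFunctional φ A B) := by
      unfold testFunctional
      fun_prop
    exact h.measurable
  · rw [testFunctional, mul_comm, Complex.norm_exp_ofReal_mul_I]

/-- The centering in centered coordinates. -/
def centering (v A : ℝ) : ℝ := A / 2 * Real.log (A ^ 2 / (2 * Real.pi * v))

/-- The logarithmic correction in `B_N` is designed for this identity: the factor `1 / A`
compensates the width of the test functional, and `√(2πv)` the Gaussian density of variance `v` at
0. -/
lemma exp_neg_centering_div {v A : ℝ} (hv : 0 < v) (hA : 0 < A) :
    Real.exp (-(centering v A / A)) = Real.sqrt (2 * Real.pi * v) / A := by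
  have h1 : (0 : ℝ) < 2 * Real.pi * v := by positivity
  have h2 : -(centering v A / A) = Real.log (Real.sqrt (2 * Real.pi * v) / A) := by
    rw [centering, Real.log_div (by positivity) (by positivity), Real.log_pow,
      Real.log_div (Real.sqrt_pos.2 h1).ne' hA.ne', Real.log_sqrt h1.le]
    field_simp
    push_cast
    ring
  rw [h2, Real.exp_log (div_pos (Real.sqrt_pos.2 h1) hA)]

lemma tendsto_centering (v : ℝ) {ι : Type*} {l : Filter ι} {A : ι → ℝ} (hv : 0 < v)
    (hA : Tendsto A l (𝓝 0)) (hA0 : ∀ᶠ i in l, 0 < A i) :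
    Tendsto (fun i => centering v (A i)) l (𝓝 0) := by
  have h1 : Tendsto (fun i => A i * Real.log (A i) - A i * (Real.log (2 * Real.pi * v) / 2)) l
      (𝓝 0) := by
    have h := ((Real.continuous_mul_log.tendsto 0).comp hA).sub
      (hA.mul_const (Real.log (2 * Real.pi * v) / 2))
    simpa using h
  refine h1.congr' ?_
  filter_upwards [hA0] with i hi
  rw [centering, Real.log_div (by positivity) (by positivity), Real.log_pow]
  push_cast
  ring

section

variable (φ : C_c(ℝ, ℝ)) {v A : ℝ}

/-- With tilt `A⁻¹` the deviation is one fixed profile, rescaled to width `A` and height of order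
`A⁻¹`: an approximate point mass. -/
lemma deviation_testFunctional (hv : 0 < v) (hA : 0 < A) (s : ℝ) :
    deviation A⁻¹ 0 (testFunctional φ A (centering v A)) s =
      ((Real.sqrt (2 * Real.pi * v) / A : ℝ) : ℂ) * expDefect φ ((s - centering v A) / A) := by
  have h : (levelWeight A⁻¹ 0 s)⁻¹ =
      Real.sqrt (2 * Real.pi * v) / A * Real.exp (-((s - centering v A) / A)) := by
    rw [← exp_neg_centering_div hv hA, ← Real.exp_add, levelWeight, ← Real.exp_neg]
    congr 1
    field_simp
    ring
  rw [deviation, div_eq_mul_inv, ← Complex.ofReal_inv, h, expDefect, testFunctional]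
  push_cast
  ring

lemma integral_comp_sub_div {E : Type*} [NormedAddCommGroup E] [NormedSpace ℝ E] (f : ℝ → E)
    (hA : 0 < A) (B : ℝ) : ∫ s, f ((s - B) / A) = A • ∫ y, f y := by
  rw [integral_sub_right_eq_self (fun s => f (s / A)) B, Measure.integral_comp_div f A,
    abs_of_pos hA]

lemma integrable_deviation_testFunctional (hv : 0 < v) (hA : 0 < A) :
    Integrable (deviation A⁻¹ 0 (testFunctional φ A (centering v A))) := by
  rw [funext (deviation_testFunctional φ hv hA)]
  exact (((integrable_expDefect φ).comp_div hA.ne').comp_sub_right _).const_mul _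

lemma integral_deviation_testFunctional (hv : 0 < v) (hA : 0 < A) :
    ∫ s, deviation A⁻¹ 0 (testFunctional φ A (centering v A)) s =
      (Real.sqrt (2 * Real.pi * v) : ℂ) * ∫ y, expDefect φ y := by
  simp_rw [deviation_testFunctional φ hv hA]
  rw [integral_const_mul, integral_comp_sub_div _ hA, Complex.real_smul, ← mul_assoc,
    ← Complex.ofReal_mul, div_mul_cancel₀ _ hA.ne']

lemma integral_norm_deviation_testFunctional (hv : 0 < v) (hA : 0 < A) :
    ∫ s, ‖deviation A⁻¹ 0 (testFunctional φ A (centering v A)) s‖ =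
      Real.sqrt (2 * Real.pi * v) * ∫ y, ‖expDefect φ y‖ := by
  simp_rw [deviation_testFunctional φ hv hA, norm_mul, Complex.norm_real]
  rw [integral_const_mul, integral_comp_sub_div (fun y => ‖expDefect φ y‖) hA, smul_eq_mul,
    ← mul_assoc, Real.norm_of_nonneg (by positivity), div_mul_cancel₀ _ hA.ne']

lemma isBddMeas_deviation_testFunctional (hv : 0 < v) (hA : 0 < A) :
    IsBddMeas (deviation A⁻¹ 0 (testFunctional φ A (centering v A))) := by
  obtain ⟨C, hC⟩ := (hasCompactSupport_expDefect φ).exists_bound_of_continuous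
    (continuous_expDefect φ)
  refine ⟨measurable_deviation (isDiscValued_testFunctional φ _ _),
    ‖((Real.sqrt (2 * Real.pi * v) / A : ℝ) : ℂ)‖ * C, fun s => ?_⟩
  rw [deviation_testFunctional φ hv hA, norm_mul]
  exact mul_le_mul_of_nonneg_left (hC _) (norm_nonneg _)

lemma exists_lipschitz_gaussianPDFReal (a : NNReal) :
    ∃ K : NNReal, LipschitzWith K (gaussianPDFReal 0 a) := by
  rcases eq_or_ne a 0 with rfl | ha
  · refine ⟨0, ?_⟩
    rw [gaussianPDFReal_zero_var]
    exact LipschitzWith.const 0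
  have ha' : (0 : ℝ) < a := by exact_mod_cast pos_iff_ne_zero.2 ha
  set r := (Real.sqrt (2 * Real.pi * a))⁻¹ with hr
  have hr0 : 0 ≤ r := by positivity
  have hd : ∀ y, HasDerivAt (gaussianPDFReal 0 a)
      (r * (Real.exp (-(y - 0) ^ 2 / (2 * a)) * (-(2 * (y - 0) * 1) / (2 * a)))) y := fun y => by
    have h := (((((hasDerivAt_id y).sub_const 0).pow 2).neg.div_const (2 * (a : ℝ))).exp).const_mul r
    have hf : gaussianPDFReal 0 a = fun y => r * Real.exp (-(y - 0) ^ 2 / (2 * a)) := rfl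
    rw [hf]
    simpa using h
  refine ⟨Real.toNNReal (r * ((1 + 2 * a) / a)), lipschitzWith_of_nnnorm_deriv_le
    (fun y => (hd y).differentiableAt) fun y => ?_⟩
  rw [← NNReal.coe_le_coe, coe_nnnorm, Real.coe_toNNReal _ (by positivity), (hd y).deriv, norm_mul,
    norm_mul, Real.norm_of_nonneg hr0, Real.norm_of_nonneg (Real.exp_pos _).le]
  refine mul_le_mul_of_nonneg_left ?_ hr0
  have h1 : ‖-(2 * (y - 0) * 1) / (2 * (a : ℝ))‖ = |y| / a := by
    rw [norm_div, Real.norm_of_nonneg (by positivity : (0 : ℝ) ≤ 2 * a), norm_neg, Real.norm_eq_abs,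
      sub_zero, mul_one, abs_mul, abs_two]
    field_simp
  have h2 : Real.exp (-(y - 0) ^ 2 / (2 * (a : ℝ))) * (1 + y ^ 2 / (2 * a)) ≤ 1 := by
    have h3 := Real.add_one_le_exp (y ^ 2 / (2 * (a : ℝ)))
    have h4 : Real.exp (-(y - 0) ^ 2 / (2 * (a : ℝ))) * Real.exp (y ^ 2 / (2 * (a : ℝ))) = 1 := by
      rw [← Real.exp_add, sub_zero, neg_div, neg_add_cancel, Real.exp_zero]
    rw [← h4]
    exact mul_le_mul_of_nonneg_left (by linarith) (Real.exp_pos _).le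
  -- The factor `1 + y ^ 2 / (2 * a)` is absorbed by the Gaussian weight; a crude `1 + 2 * a`
  -- suffices because `|y| ≤ 1 + y ^ 2`.
  have h5 : |y| ≤ (1 + 2 * a) * (1 + y ^ 2 / (2 * a)) := by
    have h6 : (1 + 2 * (a : ℝ)) * (1 + y ^ 2 / (2 * a)) = 1 + 2 * a + y ^ 2 / (2 * a) + y ^ 2 := by
      field_simp
      ring
    have h7 : 0 ≤ y ^ 2 / (2 * (a : ℝ)) := by positivity
    rw [h6]
    nlinarith [sq_abs y, sq_nonneg (|y| - 1), abs_nonneg y]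
  rw [h1]
  have h8 := mul_le_mul_of_nonneg_left h5 (Real.exp_pos (-(y - 0) ^ 2 / (2 * (a : ℝ)))).le
  rw [← mul_div_assoc]
  refine div_le_div_of_nonneg_right ?_ ha'.le
  nlinarith

/-- All mass of the deviation sits within `A * R + |centering v A|` of the origin, so the Lipschitz
density may be frozen there at a cost proportional to this radius. -/
lemma norm_integral_deviation_testFunctional_sub_le {a : NNReal} (ha : a ≠ 0) {K : NNReal}
    (hK : LipschitzWith K (gaussianPDFReal 0 a)) {R : ℝ} (hR : ∀ y, φ y ≠ 0 → |y| ≤ R)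
    (hv : 0 < v) (hA : 0 < A) (s : ℝ) :
    ‖∫ y, deviation A⁻¹ 0 (testFunctional φ A (centering v A)) (s + y) ∂gaussianReal 0 a -
      ((Real.sqrt (2 * Real.pi * v) : ℂ) * ∫ y, expDefect φ y) * gaussianPDFReal 0 a s‖ ≤
      K * (A * R + |centering v A|) * (Real.sqrt (2 * Real.pi * v) * ∫ y, ‖expDefect φ y‖) := by
  set D := deviation A⁻¹ 0 (testFunctional φ A (centering v A)) with hD
  have hint : Integrable D := integrable_deviation_testFunctional φ hv hA
  have hsupp : ∀ z, D z ≠ 0 → |z| ≤ A * R + |centering v A| := fun z hz => by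
    rw [hD, deviation_testFunctional φ hv hA] at hz
    have h1 := hR _ fun h => hz (by rw [expDefect_eq_zero h, mul_zero])
    rw [abs_div, abs_of_pos hA, div_le_iff₀ hA] at h1
    have h2 := abs_add_le (z - centering v A) (centering v A)
    rw [sub_add_cancel] at h2
    linarith
  have h1 : ∫ y, D (s + y) ∂gaussianReal 0 a = ∫ z, gaussianPDFReal 0 a (z - s) • D z := by
    rw [integral_gaussianReal_eq_integral_smul ha,
      ← integral_add_left_eq_self (fun z => gaussianPDFReal 0 a (z - s) • D z) s]
    simp_rw [add_sub_cancel_left]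
  have hi1 : Integrable fun z => gaussianPDFReal 0 a (z - s) • D z :=
    hint.bdd_smul (Real.sqrt (2 * Real.pi * a))⁻¹
      ((measurable_gaussianPDFReal 0 a).comp (measurable_sub_const s)).aestronglyMeasurable
      (ae_of_all _ fun z => by
        rw [Function.comp_apply, Real.norm_of_nonneg (gaussianPDFReal_nonneg _ _ _)]
        exact gaussianPDFReal_le _ _ _)
  rw [h1, ← integral_deviation_testFunctional φ hv hA, ← integral_mul_const,
    ← integral_norm_deviation_testFunctional φ hv hA, ← integral_const_mul, ← hD,
    ← integral_sub hi1 (hint.mul_const _)]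
  refine norm_integral_le_of_norm_le (hint.norm.const_mul _) (ae_of_all _ fun z => ?_)
  by_cases hz : D z = 0
  · simp [hz]
  have h2 : gaussianPDFReal 0 a (z - s) • D z - D z * gaussianPDFReal 0 a s =
      ((gaussianPDFReal 0 a (z - s) - gaussianPDFReal 0 a (-s) : ℝ) : ℂ) * D z := by
    rw [gaussianPDFReal_zero_neg, Complex.real_smul]
    push_cast
    ring
  rw [h2, norm_mul, Complex.norm_real]
  refine mul_le_mul_of_nonneg_right ?_ (norm_nonneg _)
  have h3 := hK.dist_le_mul (z - s) (-s)
  rw [Real.dist_eq, Real.dist_eq, show z - s - -s = z by ring] at h3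
  exact h3.trans (mul_le_mul_of_nonneg_left (hsupp z hz) K.2)

end

/-! ### Hierarchies -/

/-- The levels of a hierarchical field whose last level carries no spins. -/
structure Hierarchy (m : ℕ) where
  x : ℕ → ℝ
  q : ℕ → ℝ
  pos : 0 < m
  x_zero : x 0 = 0
  q_zero : q 0 = 0
  x_self : x m = 1
  x_last : x (m + 1) = 1
  q_last : q (m + 1) = 1
  x_lt : ∀ k < m, x k < x (k + 1)
  q_lt : ∀ k ≤ m, q k < q (k + 1)
  q_le : ∀ k ≤ m, q k ≤ x k

namespace Hierarchy

variable {m : ℕ} (H : Hierarchy m)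

lemma q_nonneg {k : ℕ} (hk : k ≤ m + 1) : 0 ≤ H.q k := by
  induction k with
  | zero => exact H.q_zero.ge
  | succ k ih => exact (ih (by omega)).trans (H.q_lt k (by omega)).le

lemma x_nonneg {k : ℕ} (hk : k ≤ m + 1) : 0 ≤ H.x k := by
  rcases hk.lt_or_eq with hk | rfl
  · exact (H.q_nonneg hk.le).trans (H.q_le k (by omega))
  · exact H.x_last ▸ zero_le_one

lemma q_le_one {k : ℕ} (hk : k ≤ m + 1) : H.q k ≤ 1 := by
  induction hk using Nat.decreasingInduction with
  | self => exact H.q_last.le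
  | of_succ k hk ih => exact (H.q_lt k (by omega)).le.trans ih

lemma x_le_succ {k : ℕ} (hk : k ≤ m) : H.x k ≤ H.x (k + 1) := by
  rcases hk.lt_or_eq with hk | rfl
  · exact (H.x_lt k hk).le
  · rw [H.x_self, H.x_last]

lemma x_le_one {k : ℕ} (hk : k ≤ m + 1) : H.x k ≤ 1 := by
  induction hk using Nat.decreasingInduction with
  | self => exact H.x_last.le
  | of_succ k hk ih => exact (H.x_le_succ (by omega)).trans ih

/-- The variance of the Gaussian variables at one level. -/
def inc (k : ℕ) : NNReal := (H.q (k + 1) - H.q k).toNNReal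

lemma coe_inc {k : ℕ} (hk : k ≤ m) : (H.inc k : ℝ) = H.q (k + 1) - H.q k :=
  Real.coe_toNNReal _ (sub_nonneg.2 (H.q_lt k hk).le)

lemma inc_ne_zero {k : ℕ} (hk : k ≤ m) : H.inc k ≠ 0 := by
  rw [inc, Ne, Real.toNNReal_eq_zero, not_le]
  exact sub_pos.2 (H.q_lt k hk)

open Classical in
/-- The intermediate levels at which the order parameter touches the diagonal. -/
def tight : Finset ℕ := (Finset.Ico 1 m).filter fun k => H.q k = H.x k

lemma mem_tight {k : ℕ} : k ∈ H.tight ↔ (1 ≤ k ∧ k < m) ∧ H.q k = H.x k := by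
  simp [tight]

lemma zero_notMem_tight : 0 ∉ H.tight := fun h => by simp [mem_tight] at h

lemma self_notMem_tight : m ∉ H.tight := fun h => by simp [mem_tight] at h

lemma q_lt_x {k : ℕ} (hk0 : 1 ≤ k) (hk : k ≤ m) (h : k ∉ H.tight) : H.q k < H.x k := by
  refine lt_of_le_of_ne (H.q_le k hk) fun heq => ?_
  rcases hk.lt_or_eq with hk' | rfl
  · exact h (H.mem_tight.2 ⟨⟨hk0, hk'⟩, heq⟩)
  · have := H.q_lt k le_rfl
    rw [heq, H.x_self, H.q_last] at this
    exact lt_irrefl _ this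

/-- The standard deviation of the field at one level is `sigma` times that of a tilted spin. -/
def sigma (h : ℝ) (k : ℕ) : ℝ := h * Real.sqrt (H.x (k + 1) - H.x k)

/-- The limiting variance of the increment at one level. -/
def stepVar (θ h : ℝ) (k : ℕ) : NNReal :=
  H.inc k + (H.sigma h k ^ 2 * (1 - Real.tanh θ ^ 2)).toNNReal

lemma stepVar_ne_zero (θ h : ℝ) {k : ℕ} (hk : k ≤ m) : H.stepVar θ h k ≠ 0 := by
  have := pos_iff_ne_zero.2 (H.inc_ne_zero hk)
  unfold stepVar
  positivity

lemma stepVar_self (θ h : ℝ) : H.stepVar θ h m = H.inc m := by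
  simp [stepVar, sigma, H.x_self, H.x_last]

/-- The level variances telescope to the `v` of the centering; this is what gives the constant 1 in
the absence of tight levels. -/
lemma coe_tailVar_stepVar (θ h : ℝ) :
    (tailVar (H.stepVar θ h) m 0 : ℝ) = 1 + h ^ 2 * (1 - Real.tanh θ ^ 2) := by
  have hr := one_sub_tanh_sq_pos θ
  have h1 : ∀ k ∈ Finset.range (m + 1), (H.stepVar θ h k : ℝ) =
      (H.q (k + 1) - H.q k) + (H.x (k + 1) - H.x k) * (h ^ 2 * (1 - Real.tanh θ ^ 2)) := fun k hk => by
    have hk' : k ≤ m := Nat.lt_succ_iff.1 (Finset.mem_range.1 hk)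
    rw [stepVar, NNReal.coe_add, H.coe_inc hk', Real.coe_toNNReal _ (by positivity), sigma, mul_pow,
      Real.sq_sqrt (sub_nonneg.2 (H.x_le_succ hk'))]
    ring
  rw [tailVar, NNReal.coe_sum, ← Finset.range_eq_Ico, Finset.sum_congr rfl h1,
    Finset.sum_add_distrib, ← Finset.sum_mul, Finset.sum_range_sub, Finset.sum_range_sub, H.q_last,
    H.q_zero, H.x_last, H.x_zero]
  ring

/-- The exponential rate at one level. -/
def rate (β : ℝ) (N k : ℕ) : ℝ := N * ((H.x k - H.q k) * β ^ 2 / 2)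

lemma rate_zero (β : ℝ) (N : ℕ) : H.rate β N 0 = 0 := by simp [rate, H.x_zero, H.q_zero]

lemma rate_last (β : ℝ) (N : ℕ) : H.rate β N (m + 1) = 0 := by simp [rate, H.x_last, H.q_last]

lemma rate_of_mem_tight (β : ℝ) (N : ℕ) {k : ℕ} (hk : k ∈ H.tight) : H.rate β N k = 0 := by
  simp [rate, (H.mem_tight.1 hk).2]

/-- Criticality turns the entropy of a block into `β² / 2` per spin, the same unit as the Gaussian
cost. The rates therefore measure the distance of `q` from the diagonal. -/
lemma rate_succ_sub {β h : ℝ} (hc : IsCritical β h) {N : ℕ} {d : ℕ → ℕ}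
    (hd : ∀ k ≤ m, (H.x (k + 1) - H.x k) * N = d k) {k : ℕ} (hk : k ≤ m) :
    H.rate β N (k + 1) - H.rate β N k =
      d k * spinEntropy (β * h) - (β * Real.sqrt N) ^ 2 * H.inc k / 2 := by
  rw [rate, rate, hc.2, ← hd k hk, H.coe_inc hk, mul_pow, Real.sq_sqrt (Nat.cast_nonneg _)]
  ring

/-! ### The recursion at finite size -/

/-- The field coefficient. -/
def fieldCoeff (h : ℝ) (N : ℕ) : ℝ := h / Real.sqrt N

/-- The generating functional from level `k` on. -/
def genFun (β h : ℝ) (N : ℕ) (d : ℕ → ℕ) (F : ℝ → ℂ) (k : ℕ) : ℝ → ℂ :=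
  backward (fun k Ψ => tiltStep (β * Real.sqrt N) (fieldCoeff h N) (β * h) (H.inc k) (d k) Ψ) F
    (m + 1) k

/-- The normalized deviation from one of the generating functional at level `k`. -/
def dev (β h : ℝ) (N : ℕ) (d : ℕ → ℕ) (F : ℝ → ℂ) (k : ℕ) : ℝ → ℂ :=
  deviation (β * Real.sqrt N) (H.rate β N k) (H.genFun β h N d F k)

/-- The tilted kernels. -/
def kernel (β h : ℝ) (N : ℕ) (d : ℕ → ℕ) (k : ℕ) : Measure ℝ :=
  tiltKernel (β * h) (fieldCoeff h N) (H.inc k) (d k)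

instance (β h : ℝ) (N : ℕ) (d : ℕ → ℕ) (k : ℕ) : IsProbabilityMeasure (H.kernel β h N d k) :=
  inferInstanceAs (IsProbabilityMeasure (tiltKernel _ _ _ _))

section FiniteSize

variable {β h : ℝ} {N : ℕ} {d : ℕ → ℕ} {F : ℝ → ℂ}

lemma isDiscValued_genFun (hF : IsDiscValued F) {k : ℕ} (hk : k ≤ m + 1) :
    IsDiscValued (H.genFun β h N d F k) :=
  backward_induction (p := fun _ Ψ => IsDiscValued Ψ) hF (fun _ _ _ hΨ => hΨ.tiltStep) hk

lemma genFun_of_le {k : ℕ} (hk : k ≤ m) : H.genFun β h N d F k =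
    tiltStep (β * Real.sqrt N) (fieldCoeff h N) (β * h) (H.inc k) (d k)
      (H.genFun β h N d F (k + 1)) :=
  backward_of_lt _ _ (Nat.lt_succ_of_le hk)

lemma mul_fieldCoeff (hN : 0 < N) : β * Real.sqrt N * fieldCoeff h N = β * h := by
  have : 0 < Real.sqrt N := Real.sqrt_pos.2 (by exact_mod_cast hN)
  rw [fieldCoeff]
  field_simp

lemma norm_dev_le_two_div (hF : IsDiscValued F) {k : ℕ} (hk : k ≤ m + 1) (s : ℝ) :
    ‖H.dev β h N d F k s‖ ≤ 2 / levelWeight (β * Real.sqrt N) (H.rate β N k) s :=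
  norm_deviation_le (H.isDiscValued_genFun hF hk) s

lemma dev_last : H.dev β h N d F (m + 1) = deviation (β * Real.sqrt N) 0 F := by
  rw [dev, H.rate_last, genFun, backward_self]

lemma isBddMeas_dev (hc : IsCritical β h) (hN : 0 < N)
    (hd : ∀ k ≤ m, (H.x (k + 1) - H.x k) * N = d k) (hF : IsDiscValued F)
    (hb : IsBddMeas (deviation (β * Real.sqrt N) 0 F)) {k : ℕ} (hk : k ≤ m + 1) :
    IsBddMeas (H.dev β h N d F k) := by
  induction hk using Nat.decreasingInduction with
  | self => rwa [dev_last]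
  | of_succ k hk ih =>
    have hk' := Nat.lt_succ_iff.1 hk
    obtain ⟨C, hC⟩ := (ih.norm.integral_add (H.kernel β h N d k)).2
    refine ⟨measurable_deviation (H.isDiscValued_genFun hF hk.le), C, fun s => ?_⟩
    rw [dev, H.genFun_of_le hk']
    exact (norm_deviation_tiltStep_le (mul_fieldCoeff hN) (H.inc_ne_zero hk')
      (H.rate_succ_sub hc hd hk') (H.isDiscValued_genFun hF hk) ih s).trans
      ((Real.le_norm_self _).trans (hC s))

lemma norm_dev_le (hc : IsCritical β h) (hN : 0 < N)
    (hd : ∀ k ≤ m, (H.x (k + 1) - H.x k) * N = d k) (hF : IsDiscValued F)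
    (hb : IsBddMeas (deviation (β * Real.sqrt N) 0 F)) {k : ℕ} (hk : k ≤ m) (s : ℝ) :
    ‖H.dev β h N d F k s‖ ≤ ∫ y, ‖H.dev β h N d F (k + 1) (s + y)‖ ∂H.kernel β h N d k := by
  rw [dev, H.genFun_of_le hk]
  exact norm_deviation_tiltStep_le (mul_fieldCoeff hN) (H.inc_ne_zero hk)
    (H.rate_succ_sub hc hd hk) (H.isDiscValued_genFun hF (Nat.succ_le_succ hk))
    (H.isBddMeas_dev hc hN hd hF hb (Nat.succ_le_succ hk)) s

lemma norm_dev_sub_le (hc : IsCritical β h) (hN : 0 < N)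
    (hd : ∀ k ≤ m, (H.x (k + 1) - H.x k) * N = d k) (hF : IsDiscValued F)
    (hb : IsBddMeas (deviation (β * Real.sqrt N) 0 F)) {k : ℕ} (hk : k ≤ m) (s : ℝ) :
    ‖H.dev β h N d F k s - ∫ y, H.dev β h N d F (k + 1) (s + y) ∂H.kernel β h N d k‖ ≤
      levelWeight (β * Real.sqrt N) (H.rate β N k) s *
        (∫ y, ‖H.dev β h N d F (k + 1) (s + y)‖ ∂H.kernel β h N d k) ^ 2 := by
  rw [dev, H.genFun_of_le hk]
  exact norm_deviation_tiltStep_sub_le (mul_fieldCoeff hN) (H.inc_ne_zero hk)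
    (H.rate_succ_sub hc hd hk) (H.isDiscValued_genFun hF (Nat.succ_le_succ hk))
    (H.isBddMeas_dev hc hN hd hF hb (Nat.succ_le_succ hk)) s

/-- The error of the linearized recursion with cut-offs. -/
lemma norm_integral_dev_sub_le (hc : IsCritical β h) (hN : 0 < N)
    (hd : ∀ k ≤ m, (H.x (k + 1) - H.x k) * N = d k) (hF : IsDiscValued F)
    (hb : IsBddMeas (deviation (β * Real.sqrt N) 0 F)) {C C₀ ε : ℝ} (hC : 0 ≤ C) (hC₀ : 1 ≤ C₀)
    (hε : 0 ≤ ε)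
    (hlast : ∀ s, ∫ y, ‖H.dev β h N d F (m + 1) (s + y)‖ ∂H.kernel β h N d m ≤ C)
    (hexp : ∀ k ≤ m, ∫ y, Real.exp y ∂H.kernel β h N d k ≤ C₀)
    (hQ : ∀ k < m, ∀ s, ∫ y, cutError H.tight (β * Real.sqrt N) (H.rate β N) (k + 1) (s + y)
      ∂H.kernel β h N d k ≤ ε * (1 + Real.exp s)) :
    ‖∫ y, H.dev β h N d F 1 y ∂H.kernel β h N d 0 -
      backward (cutStep H.tight (H.kernel β h N d)) (deviation (β * Real.sqrt N) 0 F) (m + 1) 0 0‖ ≤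
      m * C₀ ^ m * (C ^ 2 + 2 * C + 2) * ε * 2 := by
  have hg := fun k hk => H.isBddMeas_dev (k := k) hc hN hd hF hb hk
  have hlam : 0 ≤ β * Real.sqrt N := mul_nonneg hc.1.le (Real.sqrt_nonneg _)
  have h1 := fun k hk => H.norm_dev_le (k := k) hc hN hd hF hb hk
  have key := integral_norm_sub_backward_cutStep_le (κ := H.kernel β h N d) (m := m)
    (g := H.dev β h N d F) hlam hC hC₀ hε (fun k hk => H.rate_of_mem_tight β N hk) hg h1
    (fun k hk => H.norm_dev_sub_le hc hN hd hF hb hk)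
    (fun k hk => H.norm_dev_le_two_div hF (hk.trans (Nat.le_succ m)))
    (fun k hk => integral_norm_le_of_last hg h1 hlast hk)
    (fun k hk => ⟨integrable_exp_tiltKernel _ _ _ _, hexp k hk⟩) hQ m 0 (zero_add m) 0
  have hb1 := (hg (m + 1) le_rfl).backward_cutStep H.tight (H.kernel β h N d) (n := m + 1) (k := 1)
    (by omega)
  rw [Real.exp_zero, one_add_one_eq_two] at key
  rw [backward_of_lt _ _ (Nat.succ_pos m), cutStep, cut_of_notMem H.zero_notMem_tight, one_smul]
  have hz : ∫ y, H.dev β h N d F 1 y ∂H.kernel β h N d 0 =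
      ∫ y, H.dev β h N d F 1 (0 + y) ∂H.kernel β h N d 0 := by simp_rw [zero_add]
  rw [hz, ← H.dev_last, ← integral_sub ((hg 1 (by omega)).integrable _ 0) (hb1.integrable _ 0)]
  exact (norm_integral_le_integral_norm _).trans key

lemma norm_genFun_sub_exp_le (hc : IsCritical β h) (hN : 0 < N)
    (hd : ∀ k ≤ m, (H.x (k + 1) - H.x k) * N = d k) (hF : IsDiscValued F)
    (hb : IsBddMeas (deviation (β * Real.sqrt N) 0 F)) {C δ : ℝ}
    (hlast : ∀ s, ∫ y, ‖H.dev β h N d F (m + 1) (s + y)‖ ∂H.kernel β h N d m ≤ C)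
    (hδ : ∀ v : Spins (d 0), tiltWeight (β * h) v * C ≤ δ) (hδ1 : δ ≤ 1) :
    ‖H.genFun β h N d F 0 0 - Complex.exp (-∫ y, H.dev β h N d F 1 y ∂H.kernel β h N d 0)‖ ≤
      δ * C := by
  have hg := fun k hk => H.isBddMeas_dev (k := k) hc hN hd hF hb hk
  have h1 := fun k hk => H.norm_dev_le (k := k) hc hN hd hF hb hk
  have hrate := H.rate_succ_sub hc hd (Nat.zero_le m)
  rw [H.rate_zero, sub_zero] at hrate
  rw [H.genFun_of_le (Nat.zero_le m)]
  exact norm_tiltStep_sub_exp_le (mul_fieldCoeff hN) (H.inc_ne_zero (Nat.zero_le m)) hrate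
    (H.isDiscValued_genFun hF (by omega)) (hg 1 (by omega)).1
    (fun s => (h1 1 H.pos s).trans (integral_norm_le_of_last hg h1 hlast H.pos s)) hδ hδ1

end FiniteSize

end Hierarchy

/-! ### Uniform bounds and limits of the linearized recursion for large size -/

lemma tiltKernel_zero (θ c : ℝ) (a : NNReal) : tiltKernel θ c a 0 = gaussianReal 0 a := by
  rw [tiltKernel, Fintype.sum_unique]
  simp [tiltWeight, centeredField]

lemma integral_exp_neg_mul_abs {lam : ℝ} (hlam : 0 < lam) :
    ∫ y : ℝ, Real.exp (-(lam * |y|)) = 2 / lam := by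
  rw [integral_comp_abs (f := fun y => Real.exp (-(lam * y)))]
  simp_rw [← neg_mul]
  rw [integral_exp_mul_Ioi (neg_neg_of_pos hlam), mul_zero, Real.exp_zero]
  field_simp

lemma integrable_exp_neg_mul_abs {lam : ℝ} (hlam : 0 < lam) :
    Integrable fun y : ℝ => Real.exp (-(lam * |y|)) := by
  -- The integral of a non-integrable function is zero by convention, while this one equals `2 /
  -- lam`.
  by_contra h
  have h1 := integral_undef h
  rw [integral_exp_neg_mul_abs hlam] at h1
  exact (div_pos two_pos hlam).ne' h1

namespace Hierarchy

variable {m : ℕ} (H : Hierarchy m)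

section FiniteSize

variable {β h : ℝ} {N : ℕ} {d : ℕ → ℕ}

lemma kernel_self (hd : ∀ k ≤ m, (H.x (k + 1) - H.x k) * N = d k) :
    H.kernel β h N d m = gaussianReal 0 (H.inc m) := by
  have h0 : d m = 0 := by
    have := hd m le_rfl
    rw [H.x_self, H.x_last, sub_self, zero_mul] at this
    exact_mod_cast this.symm
  rw [kernel, h0, tiltKernel_zero]

lemma kernel_le_volume {k : ℕ} (hk : k ≤ m) : H.kernel β h N d k ≤
    ENNReal.ofReal (Real.sqrt (2 * Real.pi * H.inc k))⁻¹ • volume :=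
  tiltKernel_le_volume _ _ (H.inc_ne_zero hk) _

/-- The bound does not depend on `N`: the block size times the squared field coefficient is `(x (k +
1) - x k) * h ^ 2`. -/
lemma integral_exp_kernel_le (hh : 0 ≤ h) (hN : 0 < N) (hc : 2 * fieldCoeff h N ≤ 1)
    (hd : ∀ k ≤ m, (H.x (k + 1) - H.x k) * N = d k) {k : ℕ} (hk : k ≤ m) :
    ∫ y, Real.exp y ∂H.kernel β h N d k ≤ Real.exp (4 * h ^ 2 + 1 / 2) := by
  have hN' : (0 : ℝ) < N := by exact_mod_cast hN
  refine (integral_exp_tiltKernel_le _ (c := fieldCoeff h N) _ _ (div_nonneg hh (Real.sqrt_nonneg _)) hc).trans ?_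
  rw [Real.exp_le_exp, H.coe_inc hk, fieldCoeff, div_pow, Real.sq_sqrt hN'.le, ← hd k hk]
  have h1 := H.x_le_one (Nat.succ_le_succ hk)
  have h2 := H.x_nonneg (hk.trans (Nat.le_succ m))
  have h3 := H.q_le_one (Nat.succ_le_succ hk)
  have h4 := H.q_nonneg (hk.trans (Nat.le_succ m))
  have h5 : (H.x (k + 1) - H.x k) * N * (4 * (h ^ 2 / N)) =
      (H.x (k + 1) - H.x k) * (4 * h ^ 2) := by
    field_simp
  rw [h5]
  nlinarith [sq_nonneg h]

end FiniteSize

/-- The function in the linearized recursion with cut-offs at level `k`. -/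
def linearized (β h : ℝ) (N : ℕ) (d : ℕ → ℕ) (φ : C_c(ℝ, ℝ)) (v : ℝ) : ℕ → ℝ → ℂ :=
  backward (cutStep H.tight (H.kernel β h N d)) (deviation (β * Real.sqrt N) 0
    (testFunctional φ (β * Real.sqrt N)⁻¹ (centering v (β * Real.sqrt N)⁻¹))) (m + 1)

section Limit

variable {β h : ℝ} {N : ℕ → ℕ} {d : ℕ → ℕ → ℕ}

lemma tendsto_natCast_comp (hN : Tendsto N atTop atTop) :
    Tendsto (fun α => (N α : ℝ)) atTop atTop := tendsto_natCast_atTop_atTop.comp hN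

lemma tendsto_mul_sqrt (hβ : 0 < β) (hN : Tendsto N atTop atTop) :
    Tendsto (fun α => β * Real.sqrt (N α)) atTop atTop :=
  (Real.tendsto_sqrt_atTop.comp (tendsto_natCast_comp hN)).const_mul_atTop hβ

lemma tendsto_two_mul_fieldCoeff (h : ℝ) (hN : Tendsto N atTop atTop) :
    Tendsto (fun α => 2 * fieldCoeff h (N α)) atTop (𝓝 0) := by
  have h1 : Tendsto (fun α => fieldCoeff h (N α)) atTop (𝓝 0) :=
    (Real.tendsto_sqrt_atTop.comp (tendsto_natCast_comp hN)).const_div_atTop h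
  simpa using h1.const_mul 2

lemma tendsto_block (hN : Tendsto N atTop atTop)
    (hd : ∀ α, ∀ k ≤ m, (H.x (k + 1) - H.x k) * N α = d α k) {k : ℕ} (hk : k < m) :
    Tendsto (fun α => d α k) atTop atTop := by
  rw [← tendsto_natCast_atTop_iff (R := ℝ)]
  simp_rw [← hd _ k hk.le]
  exact (tendsto_natCast_comp hN).const_mul_atTop (sub_pos.2 (H.x_lt k hk))

lemma fieldCoeff_eq {N d k : ℕ} (hN : 0 < N) (hk : k < m) (hd : (H.x (k + 1) - H.x k) * N = d) :
    fieldCoeff h N = (Real.sqrt d)⁻¹ * H.sigma h k := by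
  have h1 := Real.sqrt_pos.2 (sub_pos.2 (H.x_lt k hk))
  have h2 : 0 < Real.sqrt N := Real.sqrt_pos.2 (by exact_mod_cast hN)
  rw [fieldCoeff, sigma, ← hd, Real.sqrt_mul (sub_pos.2 (H.x_lt k hk)).le]
  field_simp

lemma isBddMeas_linearized (hβ : 0 < β) {N : ℕ} (hN : 0 < N) (d : ℕ → ℕ) (φ : C_c(ℝ, ℝ)) {v : ℝ}
    (hv : 0 < v) {k : ℕ} (hk : k ≤ m + 1) : IsBddMeas (H.linearized β h N d φ v k) := by
  have hA : 0 < (β * Real.sqrt N)⁻¹ :=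
    inv_pos.2 (mul_pos hβ (Real.sqrt_pos.2 (by exact_mod_cast hN)))
  have hb := isBddMeas_deviation_testFunctional φ hv hA
  rw [inv_inv] at hb
  exact hb.backward_cutStep _ _ hk

/-- Backward induction on the level, uniformly in `s`: the top level smooths an approximate point
mass into a Gaussian density, and each further level exchanges the tilted kernel for its Gaussian
limit in total variation. -/
lemma exists_tendsto_linearized (hβ : 0 < β) (hN : Tendsto N atTop atTop)
    (hd : ∀ α, ∀ k ≤ m, (H.x (k + 1) - H.x k) * N α = d α k) (φ : C_c(ℝ, ℝ)) {v : ℝ} (hv : 0 < v)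
    {k : ℕ} (hk : k ≤ m) :
    ∃ δ : ℕ → ℝ, Tendsto δ atTop (𝓝 0) ∧ ∀ᶠ α in atTop, ∀ s,
      ‖H.linearized β h (N α) (d α) φ v k s - ((Real.sqrt (2 * Real.pi * v) : ℂ) *
        ∫ y, expDefect φ y) * cutDensity H.tight (H.stepVar (β * h) h) m k s‖ ≤ δ α := by
  induction hk using Nat.decreasingInduction with
  | self =>
    obtain ⟨K, hK⟩ := exists_lipschitz_gaussianPDFReal (H.inc m)
    obtain ⟨R, hR⟩ := exists_support_bound φ
    have hA : Tendsto (fun α => (β * Real.sqrt (N α))⁻¹) atTop (𝓝 0) :=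
      tendsto_inv_atTop_zero.comp (tendsto_mul_sqrt hβ hN)
    have hA0 : ∀ᶠ α in atTop, 0 < (β * Real.sqrt (N α))⁻¹ :=
      ((tendsto_mul_sqrt hβ hN).eventually_gt_atTop 0).mono fun α hα => inv_pos.2 hα
    refine ⟨fun α => K * ((β * Real.sqrt (N α))⁻¹ * R + |centering v (β * Real.sqrt (N α))⁻¹|) *
      (Real.sqrt (2 * Real.pi * v) * ∫ y, ‖expDefect φ y‖), ?_, ?_⟩
    · have h1 := (((hA.mul_const (R : ℝ)).add (tendsto_centering v hv hA hA0).abs).const_mul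
        (K : ℝ)).mul_const (Real.sqrt (2 * Real.pi * v) * ∫ y, ‖expDefect φ y‖)
      simpa using h1
    · filter_upwards [hA0] with α hα s
      have h1 := norm_integral_deviation_testFunctional_sub_le φ (H.inc_ne_zero le_rfl) hK hR hv hα s
      rw [inv_inv] at h1
      -- The top level carries no spins and is not tight, so its step is a pure Gaussian average
      -- without cut.
      rwa [linearized, backward_of_lt _ _ (Nat.lt_succ_self m), cutStep,
        cut_of_notMem H.self_notMem_tight, one_smul, backward_self, cutDensity_self, H.stepVar_self,
        H.kernel_self (hd α)]
  | of_succ k hk ih =>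
    obtain ⟨δ, hδ, hδb⟩ := ih
    obtain ⟨δ', hδ', hδb'⟩ := exists_tendsto_tiltKernel (β * h) (H.sigma h k)
      (H.inc_ne_zero hk.le)
    have hP := isBddMeas_cutDensity (J := H.tight) (V := H.stepVar (β * h) h)
      (Nat.succ_le_of_lt hk)
    obtain ⟨B, hB⟩ := hP.2
    set I : ℂ := (Real.sqrt (2 * Real.pi * v) : ℂ) * ∫ y, expDefect φ y with hI
    let f : ℝ → ℂ := fun s => I * cutDensity H.tight (H.stepVar (β * h) h) m (k + 1) s
    have hfm : Measurable f := (Complex.measurable_ofReal.comp hP.1).const_mul I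
    have hfb : ∀ s, ‖f s‖ ≤ ‖I‖ * B := fun s => by
      rw [norm_mul, Complex.norm_real]
      exact mul_le_mul_of_nonneg_left (hB s) (norm_nonneg _)
    refine ⟨fun α => δ α + ‖I‖ * B * δ' (d α k), ?_, ?_⟩
    · simpa using hδ.add ((hδ'.comp (H.tendsto_block hN hd hk)).const_mul (‖I‖ * B))
    · filter_upwards [hδb, hN.eventually_gt_atTop 0] with α hα hNα s
      have h1 := hδb' (d α k) f (‖I‖ * B) hfm hfb s
      rw [← H.fieldCoeff_eq hNα hk (hd α k hk.le)] at h1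
      have hl := H.isBddMeas_linearized (h := h) hβ hNα (d α) φ hv
        (show k + 1 ≤ m + 1 by omega)
      have hfB : IsBddMeas f := ⟨hfm, _, hfb⟩
      have h2 : ‖∫ y, H.linearized β h (N α) (d α) φ v (k + 1) (s + y) ∂H.kernel β h (N α) (d α) k -
          ∫ y, f (s + y) ∂H.kernel β h (N α) (d α) k‖ ≤ δ α := by
        rw [← integral_sub (hl.integrable _ s) (hfB.integrable _ s)]
        simpa using norm_integral_le_of_norm_le_const (μ := H.kernel β h (N α) (d α) k)
          (ae_of_all _ fun y => hα (s + y))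
      have h3 : I * (cutDensity H.tight (H.stepVar (β * h) h) m k s : ℂ) =
          cut H.tight k s • ∫ y, f (s + y) ∂gaussianReal 0 (H.stepVar (β * h) h k) := by
        rw [cutDensity_of_lt hk, integral_const_mul, integral_complex_ofReal, Complex.real_smul]
        push_cast
        ring
      rw [h3, linearized, backward_of_lt _ _ (show k < m + 1 by omega), cutStep, ← smul_sub,
        norm_smul, Real.norm_of_nonneg (cut_nonneg _ _ _)]
      refine (mul_le_of_le_one_left (norm_nonneg _) (cut_le_one _ _ _)).trans ?_
      refine (norm_sub_le_norm_sub_add_norm_sub _ (∫ y, f (s + y) ∂H.kernel β h (N α) (d α) k)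
        _).trans (add_le_add h2 h1)

/-- At a tight level the error lives in a strip of width `1 / λ` around the origin, which a kernel
of bounded density charges little. Otherwise the error is of order one only beyond a height of order
`√N`, which the exponential moment makes improbable. -/
lemma exists_integral_cutError_le (hβ : 0 < β) (hh : 0 ≤ h) (hN : Tendsto N atTop atTop)
    (hd : ∀ α, ∀ k ≤ m, (H.x (k + 1) - H.x k) * N α = d α k) {k : ℕ} (hk : k < m) :
    ∃ ε : ℕ → ℝ, Tendsto ε atTop (𝓝 0) ∧ ∀ᶠ α in atTop, ∀ s,
      ∫ y, cutError H.tight (β * Real.sqrt (N α)) (H.rate β (N α)) (k + 1) (s + y)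
        ∂H.kernel β h (N α) (d α) k ≤ ε α * (1 + Real.exp s) := by
  have hlam := tendsto_mul_sqrt hβ hN
  by_cases hJ : k + 1 ∈ H.tight
  · refine ⟨fun α => (Real.sqrt (2 * Real.pi * H.inc k))⁻¹ * (2 / (β * Real.sqrt (N α))), ?_, ?_⟩
    · simpa using (hlam.const_div_atTop 2).const_mul (Real.sqrt (2 * Real.pi * H.inc k))⁻¹
    · filter_upwards [hlam.eventually_gt_atTop 0] with α hα s
      simp only [cutError, if_pos hJ]
      have h1 := integral_le_of_le_volume (by positivity)
        (H.kernel_le_volume (β := β) (h := h) (N := N α) (d := d α) hk.le)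
        (integrable_exp_neg_mul_abs hα) (fun y => (Real.exp_pos _).le) s
      rw [integral_exp_neg_mul_abs hα] at h1
      refine h1.trans (le_mul_of_one_le_right (by positivity) ?_)
      linarith [Real.exp_pos s]
  -- The rate equals `λ g √N`, so the barrier sits at height `g √N`.
  · set g := (H.x (k + 1) - H.q (k + 1)) * β / 2 with hg
    have hg0 : 0 < g := by
      have := H.q_lt_x (Nat.succ_pos k) hk hJ
      have := sub_pos.2 this
      positivity
    have hc := tendsto_two_mul_fieldCoeff h hN
    refine ⟨fun α => Real.exp (-(g * Real.sqrt (N α))) * Real.exp (4 * h ^ 2 + 1 / 2), ?_, ?_⟩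
    · have h1 : Tendsto (fun α => g * Real.sqrt (N α)) atTop atTop := tendsto_mul_sqrt hg0 hN
      simpa using (Real.tendsto_exp_neg_atTop_nhds_zero.comp h1).mul_const
        (Real.exp (4 * h ^ 2 + 1 / 2))
    · filter_upwards [hlam.eventually_ge_atTop 1, hN.eventually_gt_atTop 0,
        hc.eventually_le_const one_pos] with α hα hNα hcα s
      have hpt : ∀ z, cutError H.tight (β * Real.sqrt (N α)) (H.rate β (N α)) (k + 1) z ≤
          Real.exp (-(g * Real.sqrt (N α))) * Real.exp z := fun z => by
        rw [cutError, if_neg hJ, ← Real.exp_add, levelWeight]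
        have h1 : β * Real.sqrt (N α) * z - H.rate β (N α) (k + 1) =
            β * Real.sqrt (N α) * (-(g * Real.sqrt (N α)) + z) := by
          have h2 : (N α : ℝ) = Real.sqrt (N α) ^ 2 := (Real.sq_sqrt (Nat.cast_nonneg _)).symm
          rw [rate, h2, Real.sqrt_sq (Real.sqrt_nonneg _), hg]
          ring
        rw [h1]
        -- Below the barrier, `λ ≥ 1` allows `λ` to be lowered to 1 in the exponent.
        rcases le_total 0 (-(g * Real.sqrt (N α)) + z) with h0 | h0
        · exact (min_le_left _ _).trans (Real.one_le_exp h0)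
        · refine (min_le_right _ _).trans (Real.exp_le_exp.2 ?_)
          nlinarith
      have hi := integrable_exp_tiltKernel (β * h) (fieldCoeff h (N α)) (H.inc k) (d α k)
      calc _ ≤ ∫ y, Real.exp (-(g * Real.sqrt (N α))) * (Real.exp s * Real.exp y)
            ∂H.kernel β h (N α) (d α) k := by
            refine integral_mono ((isBddMeas_cutError _ (by linarith) _ _).integrable _ s)
              ((hi.const_mul _).const_mul _) fun y => ?_
            rw [← Real.exp_add s y]
            exact hpt (s + y)
        _ = Real.exp (-(g * Real.sqrt (N α))) *
            (Real.exp s * ∫ y, Real.exp y ∂H.kernel β h (N α) (d α) k) := by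
            rw [integral_const_mul, integral_const_mul]
        _ ≤ Real.exp (-(g * Real.sqrt (N α))) * (Real.exp s * Real.exp (4 * h ^ 2 + 1 / 2)) := by
            have := H.integral_exp_kernel_le (β := β) hh hNα hcα (hd α) hk.le
            gcongr
        _ ≤ _ := by
            have h1 := mul_pos (Real.exp_pos (-(g * Real.sqrt (N α))))
              (Real.exp_pos (4 * h ^ 2 + 1 / 2))
            linarith

end Limit

end Hierarchy

/-! ### Convergence of the generating functional -/

namespace Hierarchy

variable {m : ℕ} (H : Hierarchy m) {β h : ℝ} {N : ℕ → ℕ} {d : ℕ → ℕ → ℕ}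

/-- The last deviation has unbounded height but a fixed `L¹` norm, so one step with bounded density
bounds it uniformly in `N`. The top level without spins supplies this step, with an explicit
Gaussian kernel. -/
lemma integral_norm_dev_last_le {N : ℕ} {d : ℕ → ℕ} (hβ : 0 < β) (hN : 0 < N) (φ : C_c(ℝ, ℝ))
    {v : ℝ} (hv : 0 < v) (s : ℝ) :
    ∫ y, ‖H.dev β h N d (testFunctional φ (β * Real.sqrt N)⁻¹ (centering v (β * Real.sqrt N)⁻¹))
        (m + 1) (s + y)‖ ∂H.kernel β h N d m ≤
      (Real.sqrt (2 * Real.pi * H.inc m))⁻¹ *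
        (Real.sqrt (2 * Real.pi * v) * ∫ y, ‖expDefect φ y‖) := by
  have hA : 0 < (β * Real.sqrt N)⁻¹ :=
    inv_pos.2 (mul_pos hβ (Real.sqrt_pos.2 (by exact_mod_cast hN)))
  have h1 := integrable_deviation_testFunctional φ hv hA
  have h2 := integral_norm_deviation_testFunctional φ hv hA
  rw [inv_inv] at h1 h2
  rw [← h2, H.dev_last]
  exact integral_le_of_le_volume (by positivity) (H.kernel_le_volume le_rfl) h1.norm
    (fun y => norm_nonneg _) s

/-- Convergence of the generating functional. -/
theorem tendsto_genFun (hc : IsCritical β h) (hh : 0 ≤ h) (hN : Tendsto N atTop atTop)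
    (hd : ∀ α, ∀ k ≤ m, (H.x (k + 1) - H.x k) * N α = d α k) (φ : C_c(ℝ, ℝ)) {v : ℝ} (hv : 0 < v) :
    Tendsto (fun α => H.genFun β h (N α) (d α) (testFunctional φ (β * Real.sqrt (N α))⁻¹
      (centering v (β * Real.sqrt (N α))⁻¹)) 0 0) atTop
      (𝓝 (Complex.exp (-(((Real.sqrt (2 * Real.pi * v) : ℂ) * ∫ y, expDefect φ y) *
        cutDensity H.tight (H.stepVar (β * h) h) m 0 0)))) := by
  set C := (Real.sqrt (2 * Real.pi * H.inc m))⁻¹ *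
    (Real.sqrt (2 * Real.pi * v) * ∫ y, ‖expDefect φ y‖) with hC
  have hC0 : 0 ≤ C := by
    have : 0 ≤ ∫ y, ‖expDefect φ y‖ := integral_nonneg fun _ => norm_nonneg _
    positivity
  set r := max (spinWeight (β * h) 1) (spinWeight (β * h) (-1)) with hr
  -- No configuration of the first block has tilted weight above `r ^ d α 0`, which tends to zero:
  -- the smallness needed for the exponential approximation at the root.
  have hr1 : r < 1 := max_lt (spinWeight_lt_one _ _) (spinWeight_lt_one _ _)
  have hr0 : 0 ≤ r := (spinWeight_pos _ _).le.trans (le_max_left _ _)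
  have hb : ∀ α, 0 < N α → IsBddMeas (deviation (β * Real.sqrt (N α)) 0
      (testFunctional φ (β * Real.sqrt (N α))⁻¹ (centering v (β * Real.sqrt (N α))⁻¹))) :=
    fun α hα => by
      have h1 := isBddMeas_deviation_testFunctional φ hv
        (inv_pos.2 (mul_pos hc.1 (Real.sqrt_pos.2 (by exact_mod_cast hα : (0 : ℝ) < N α))))
      rwa [inv_inv] at h1
  have hεk : ∃ ε : ℕ → ℝ, Tendsto ε atTop (𝓝 0) ∧ (∀ α, 0 ≤ ε α) ∧ ∀ᶠ α in atTop, ∀ k < m, ∀ s,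
      ∫ y, cutError H.tight (β * Real.sqrt (N α)) (H.rate β (N α)) (k + 1) (s + y)
        ∂H.kernel β h (N α) (d α) k ≤ ε α * (1 + Real.exp s) := by
    choose! ε hε hεb using fun k (hk : k < m) => H.exists_integral_cutError_le hc.1 hh hN hd hk
    refine ⟨fun α => ∑ k ∈ Finset.range m, |ε k α|, ?_,
      fun α => Finset.sum_nonneg fun _ _ => abs_nonneg _, ?_⟩
    · have h1 := tendsto_finsetSum (Finset.range m) fun k hk =>
        (hε k (Finset.mem_range.1 hk)).abs
      simpa using h1
    · have h1 : ∀ᶠ α in atTop, ∀ k ∈ Finset.range m, ∀ s,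
          ∫ y, cutError H.tight (β * Real.sqrt (N α)) (H.rate β (N α)) (k + 1) (s + y)
            ∂H.kernel β h (N α) (d α) k ≤ ε k α * (1 + Real.exp s) :=
        (Finset.eventually_all _).2 fun k hk => hεb k (Finset.mem_range.1 hk)
      filter_upwards [h1] with α hα k hk s
      refine (hα k (Finset.mem_range.2 hk) s).trans (mul_le_mul_of_nonneg_right ?_ ?_)
      · exact (le_abs_self _).trans (Finset.single_le_sum (f := fun k => |ε k α|)
          (fun _ _ => abs_nonneg _) (Finset.mem_range.2 hk))
      · linarith [Real.exp_pos s]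
  obtain ⟨ε, hε, hε0, hεb⟩ := hεk
  obtain ⟨η, hη, hηb⟩ := H.exists_tendsto_linearized (h := h) hc.1 hN hd φ hv (Nat.zero_le m)
  set L : ℂ := ((Real.sqrt (2 * Real.pi * v) : ℂ) * ∫ y, expDefect φ y) *
    cutDensity H.tight (H.stepVar (β * h) h) m 0 0 with hL
  set D : ℕ → ℂ := fun α => ∫ y, H.dev β h (N α) (d α) (testFunctional φ (β * Real.sqrt (N α))⁻¹
    (centering v (β * Real.sqrt (N α))⁻¹)) 1 y ∂H.kernel β h (N α) (d α) 0 with hD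
  have hexp1 : (1 : ℝ) ≤ Real.exp (4 * h ^ 2 + 1 / 2) := Real.one_le_exp (by positivity)
  have hDlim : Tendsto D atTop (𝓝 L) := by
    rw [tendsto_iff_norm_sub_tendsto_zero]
    have hlim : Tendsto (fun α => m * Real.exp (4 * h ^ 2 + 1 / 2) ^ m * (C ^ 2 + 2 * C + 2) * ε α * 2 +
        η α) atTop (𝓝 0) := by
      simpa using ((hε.const_mul (m * Real.exp (4 * h ^ 2 + 1 / 2) ^ m *
        (C ^ 2 + 2 * C + 2))).mul_const 2).add hη
    refine squeeze_zero' (Eventually.of_forall fun _ => norm_nonneg _) ?_ hlim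
    filter_upwards [hεb, hηb, hN.eventually_gt_atTop 0,
      (tendsto_two_mul_fieldCoeff h hN).eventually_le_const one_pos] with α h1 h2 h3 h4
    refine (norm_sub_le_norm_sub_add_norm_sub _ (H.linearized β h (N α) (d α) φ v 0 0) _).trans
      (add_le_add ?_ (h2 0))
    exact H.norm_integral_dev_sub_le hc h3 (hd α) (isDiscValued_testFunctional _ _ _) (hb α h3) hC0
      hexp1 (hε0 α) (H.integral_norm_dev_last_le hc.1 h3 φ hv)
      (fun k hk => H.integral_exp_kernel_le hh h3 h4 (hd α) hk) h1
  have hδ : Tendsto (fun α => r ^ d α 0 * C) atTop (𝓝 0) := by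
    simpa using ((tendsto_pow_atTop_nhds_zero_of_lt_one hr0 hr1).comp
      (H.tendsto_block hN hd H.pos)).mul_const C
  have hdiff : Tendsto (fun α => H.genFun β h (N α) (d α) (testFunctional φ (β * Real.sqrt (N α))⁻¹
      (centering v (β * Real.sqrt (N α))⁻¹)) 0 0 - Complex.exp (-D α)) atTop (𝓝 0) := by
    have hlim : Tendsto (fun α => r ^ d α 0 * C * C) atTop (𝓝 0) := by simpa using hδ.mul_const C
    refine squeeze_zero_norm' ?_ hlim
    filter_upwards [hN.eventually_gt_atTop 0, hδ.eventually_le_const one_pos] with α h1 h2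
    exact H.norm_genFun_sub_exp_le hc h1 (hd α) (isDiscValued_testFunctional _ _ _) (hb α h1)
      (H.integral_norm_dev_last_le hc.1 h1 φ hv)
      (fun v => mul_le_mul_of_nonneg_right (tiltWeight_le _ v) hC0) h2
  have h1 := hdiff.add ((Complex.continuous_exp.tendsto (-L)).comp hDlim.neg)
  simpa using h1

/-! ### Energies of a hierarchical field -/

lemma coe_blockSum {N : ℕ} {d : ℕ → ℕ} (hd : ∀ k ≤ m, (H.x (k + 1) - H.x k) * N = d k) {k : ℕ}
    (hk : k ≤ m + 1) : (blockSum d k : ℝ) = H.x k * N := by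
  induction k with
  | zero => simp [blockSum, H.x_zero]
  | succ k ih =>
    have h1 : ((blockSum d (k + 1) : ℕ) : ℝ) = blockSum d k + d k := by simp [blockSum]
    rw [h1, ih (by omega), ← hd k (by omega)]
    ring

lemma blockSum_last {N : ℕ} {d : ℕ → ℕ} (hd : ∀ k ≤ m, (H.x (k + 1) - H.x k) * N = d k) :
    N = blockSum d (m + 1) := by
  have h1 := H.coe_blockSum hd le_rfl
  rw [H.x_last, one_mul] at h1
  exact_mod_cast h1.symm

lemma sum_inc : ∑ k ∈ Finset.range (m + 1), (H.inc k : ℝ) = 1 := by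
  rw [Finset.sum_congr rfl fun k hk => H.coe_inc (Nat.lt_succ_iff.1 (Finset.mem_range.1 hk)),
    Finset.sum_range_sub, H.q_last, H.q_zero, sub_zero]

end Hierarchy

/-! ### The REM scaling expressed through the critical inverse temperature -/

lemma scaleA_eq {β h : ℝ} (hc : IsCritical β h) (N : ℕ) :
    scaleA N h = (β * Real.sqrt N)⁻¹ := by
  rw [scaleA, rho_tStar hc]

/-- Since `I''(t) = 1 / (1 - t²)`, the product `(1 - t²) (I''(t) + h²)` is `1 + h² (1 - t²)`, the
total limiting variance. -/
lemma scaleB_eq {β h : ℝ} (hc : IsCritical β h) (N : ℕ) :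
    scaleB N h = (β + h * Real.tanh (β * h)) * Real.sqrt N +
      centering (1 + h ^ 2 * (1 - Real.tanh (β * h) ^ 2)) (β * Real.sqrt N)⁻¹ := by
  have h1 := one_sub_tanh_sq_pos (β * h)
  rw [scaleB, scaleA_eq hc, maxM_eq hc, tStar_eq hc,
    iteratedDeriv_two_cramerEntropy (Real.abs_tanh_lt_one _), centering]
  have h2 : 2 * Real.pi * (1 - Real.tanh (β * h) ^ 2) * (1 / (1 - Real.tanh (β * h) ^ 2) + h ^ 2) =
      2 * Real.pi * (1 + h ^ 2 * (1 - Real.tanh (β * h) ^ 2)) := by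
    field_simp
  rw [h2]

lemma exp_remScalingInv {β h : ℝ} (hc : IsCritical β h) {N : ℕ} (φ : C_c(ℝ, ℝ)) {Ω : Type*}
    (G : Spins N → Ω → ℝ) (σ : Spins N) (ω : Ω) :
    Complex.exp (Complex.I * φ (remScalingInv N h (energy G h σ ω))) =
      testFunctional φ (β * Real.sqrt N)⁻¹
        (centering (1 + h ^ 2 * (1 - Real.tanh (β * h) ^ 2)) (β * Real.sqrt N)⁻¹)
        (G σ ω + (Hierarchy.fieldCoeff h N * ∑ i, spin (σ i) -
          Hierarchy.fieldCoeff h N * Real.tanh (β * h) * N - β * Real.sqrt N * 1)) := by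
  have h1 : Hierarchy.fieldCoeff h N * Real.tanh (β * h) * N =
      h * Real.tanh (β * h) * Real.sqrt N := by
    rw [Hierarchy.fieldCoeff]
    rcases (Nat.cast_nonneg N : (0 : ℝ) ≤ N).eq_or_lt with h0 | h0
    · simp [← h0]
    · have h3 := Real.sqrt_pos.2 h0
      field_simp
      rw [Real.sq_sqrt h0.le]
      ring
  rw [testFunctional, remScalingInv, scaleA_eq hc, scaleB_eq hc, energy, h1]
  congr 5
  simp only [spin, Hierarchy.fieldCoeff]
  ring

instance (K : ℝ) : IsLocallyFiniteMeasure (expIntensity K) :=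
  IsLocallyFiniteMeasure.withDensity_ofReal (by fun_prop)

lemma integral_expIntensity {K : ℝ} (hK : 0 ≤ K) (φ : C_c(ℝ, ℝ)) :
    ∫ z, (Complex.exp (Complex.I * φ z) - 1) ∂expIntensity K = -(K * ∫ y, expDefect φ y) := by
  rw [expIntensity, integral_withDensity_eq_integral_toReal_smul (by fun_prop)
    (ae_of_all _ fun _ => ENNReal.ofReal_lt_top), ← integral_const_mul, ← integral_neg]
  refine integral_congr_ae (ae_of_all _ fun y => ?_)
  beta_reduce
  rw [ENNReal.toReal_ofReal (by positivity), expDefect, Complex.real_smul]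
  push_cast
  ring

/-! ### Order parameters below the diagonal as hierarchies -/

namespace OrderParameter

variable {n : ℕ} (ϱ : OrderParameter (n + 1))

lemma x_lt {j k : ℕ} (hjk : j < k) (hk : k ≤ n + 1) : ϱ.x j < ϱ.x k :=
  ϱ.x_strictMono (Set.mem_Iic.2 (hjk.le.trans hk)) (Set.mem_Iic.2 hk) hjk

lemma q_lt {j k : ℕ} (hjk : j < k) (hk : k ≤ n + 1) : ϱ.q j < ϱ.q k :=
  ϱ.q_strictMono (Set.mem_Iic.2 (hjk.le.trans hk)) (Set.mem_Iic.2 hk) hjk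

lemma q_lt_one {k : ℕ} (hk : k ≤ n) : ϱ.q k < 1 :=
  (ϱ.q_lt (Nat.lt_succ_of_le hk) le_rfl).trans_eq ϱ.q_last

lemma x_lt_one {k : ℕ} (hk : k ≤ n) : ϱ.x k < 1 :=
  (ϱ.x_lt (Nat.lt_succ_of_le hk) le_rfl).trans_eq ϱ.x_last

/-- The hierarchy obtained by splitting the last jump of an order parameter below the diagonal. -/
def toHierarchy (hle : ∀ k ∈ Finset.Icc 1 n, ϱ.q k ≤ ϱ.x k) : Hierarchy (n + 1) where
  x k := if k ≤ n + 1 then ϱ.x k else 1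
  -- The midpoint splits the last jump into two positive variances. It stays below 1, so the added
  -- level is never tight.
  q k := if k ≤ n then ϱ.q k else if k = n + 1 then (1 + ϱ.q n) / 2 else 1
  pos := Nat.succ_pos n
  x_zero := by simp [ϱ.x_zero]
  q_zero := by simp [ϱ.q_zero]
  x_self := by simp [ϱ.x_last]
  x_last := by simp
  q_last := by simp
  x_lt k hk := by
    rw [if_pos hk.le, if_pos (Nat.succ_le_of_lt hk)]
    exact ϱ.x_lt (Nat.lt_succ_self k) (Nat.succ_le_of_lt hk)
  q_lt k hk := by
    have h1 := ϱ.q_lt_one le_rfl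
    rcases lt_trichotomy k n with h | rfl | h
    · rw [if_pos h.le, if_pos (Nat.succ_le_of_lt h)]
      exact ϱ.q_lt (Nat.lt_succ_self k) (by omega)
    · simp
      linarith
    · obtain rfl : k = n + 1 := by omega
      simp
      linarith
  q_le k hk := by
    have h1 := ϱ.q_lt_one le_rfl
    rw [if_pos hk]
    rcases hk.lt_or_eq with h | rfl
    · rw [if_pos (Nat.lt_succ_iff.1 h)]
      rcases Nat.eq_zero_or_pos k with rfl | h0
      · rw [ϱ.x_zero, ϱ.q_zero]
      · exact hle k (Finset.mem_Icc.2 ⟨h0, Nat.lt_succ_iff.1 h⟩)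
    · simp [ϱ.x_last]
      linarith

variable (hle : ∀ k ∈ Finset.Icc 1 n, ϱ.q k ≤ ϱ.x k)

lemma mem_tight_toHierarchy {k : ℕ} :
    k ∈ (ϱ.toHierarchy hle).tight ↔ k ∈ Finset.Icc 1 n ∧ ϱ.q k = ϱ.x k := by
  rw [Hierarchy.mem_tight, Finset.mem_Icc, Nat.lt_succ_iff]
  refine and_congr_right fun hk => ?_
  change (if k ≤ n then ϱ.q k else _) = (if k ≤ n + 1 then ϱ.x k else _) ↔ _
  rw [if_pos hk.2, if_pos (hk.2.trans (Nat.le_succ n))]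

lemma exists_blocks {N : ℕ} (hN : ∀ k ∈ Finset.Icc 1 (n + 1), ∃ j : ℕ, ϱ.x k * N = j) :
    ∃ d : ℕ → ℕ, ∀ k ≤ n + 1,
      ((ϱ.toHierarchy hle).x (k + 1) - (ϱ.toHierarchy hle).x k) * N = d k := by
  set H := ϱ.toHierarchy hle
  have h1 : ∀ k ≤ n + 2, ∃ j : ℕ, H.x k * N = j := fun k hk => by
    rcases Nat.eq_zero_or_pos k with rfl | h0
    · exact ⟨0, by rw [H.x_zero]; simp⟩
    · rcases hk.lt_or_eq with h | rfl
      · have h2 : H.x k = ϱ.x k := if_pos (Nat.lt_succ_iff.1 h)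
        rw [h2]
        exact hN k (Finset.mem_Icc.2 ⟨h0, Nat.lt_succ_iff.1 h⟩)
      · exact ⟨N, by rw [H.x_last, one_mul]⟩
  have h2 : ∀ k ≤ n + 1, ∃ j : ℕ, (H.x (k + 1) - H.x k) * N = j := fun k hk => by
    obtain ⟨i, hi⟩ := h1 k (by omega)
    obtain ⟨j, hj⟩ := h1 (k + 1) (by omega)
    have h3 : (i : ℝ) ≤ j := by
      rw [← hi, ← hj]
      exact mul_le_mul_of_nonneg_right (H.x_le_succ hk) (Nat.cast_nonneg _)
    refine ⟨j - i, ?_⟩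
    rw [sub_mul, hi, hj, Nat.cast_sub (by exact_mod_cast h3)]
  choose! d hd using h2
  exact ⟨d, hd⟩

end OrderParameter

variable {n : ℕ}

/-- The characteristic functional of the point process of energies. -/
lemma integral_prod_exp_energy (ϱ : OrderParameter (n + 1))
    (hle : ∀ k ∈ Finset.Icc 1 n, ϱ.q k ≤ ϱ.x k) {β h : ℝ} (hc : IsCritical β h) {N : ℕ} (hN : 0 < N)
    {d : ℕ → ℕ} (hd : ∀ k ≤ n + 1,
      ((ϱ.toHierarchy hle).x (k + 1) - (ϱ.toHierarchy hle).x k) * N = d k)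
    {Ω : Type*} [MeasurableSpace Ω] {P : Measure Ω} [IsProbabilityMeasure P]
    {G : Spins N → Ω → ℝ} (hG : IsGREM ϱ G P) (φ : C_c(ℝ, ℝ)) :
    ∫ ω, ∏ σ, Complex.exp (Complex.I * φ (remScalingInv N h (energy G h σ ω))) ∂P =
      (ϱ.toHierarchy hle).genFun β h N d (testFunctional φ (β * Real.sqrt N)⁻¹
        (centering (1 + h ^ 2 * (1 - Real.tanh (β * h) ^ 2)) (β * Real.sqrt N)⁻¹)) 0 0 := by
  set H := ϱ.toHierarchy hle with hH
  have hx : ∀ k ≤ n + 1, H.x k = ϱ.x k := fun k hk => if_pos hk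
  have hq : ∀ k ≤ n, H.q k = ϱ.q k := fun k hk => if_pos hk
  have hcov : ∀ σ τ, ∫ ω, G σ ω * G τ ω ∂P = treeCov d H.inc (n + 2) σ τ := fun σ τ => by
    rw [hG.covariance, treeCov_eq_toFun ϱ hN d H.inc]
    · exact fun k hk => by rw [← hx k hk, H.coe_blockSum hd (hk.trans (Nat.le_succ _))]
    · have h1 := hd (n + 1) le_rfl
      rw [H.x_self, H.x_last, sub_self, zero_mul] at h1
      exact_mod_cast h1.symm
    · exact fun k hk => by rw [H.coe_inc (by omega), hq k hk.le, hq (k + 1) hk]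
    · rw [H.coe_inc (Nat.le_succ n), H.coe_inc le_rfl, H.q_last, hq n le_rfl]
      ring
  have h1 := integral_prod_energy hG.gaussian hG.centered d H.inc (n + 2) (H.blockSum_last hd) hcov
    (isDiscValued_testFunctional φ (β * Real.sqrt N)⁻¹
      (centering (1 + h ^ 2 * (1 - Real.tanh (β * h) ^ 2)) (β * Real.sqrt N)⁻¹))
    (Hierarchy.fieldCoeff h N) (Real.tanh (β * h)) (β * Real.sqrt N)
  rw [H.sum_inc] at h1
  simp_rw [exp_remScalingInv hc φ G]
  exact h1

/-- The two cases of the result differ only in the tight set; `cutConstant` collects the mass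
`√(2πv)` of the final bump and the constrained density at the origin. -/
theorem energiesTendstoPPP_cutConstant (ϱ : OrderParameter (n + 1))
    (hle : ∀ k ∈ Finset.Icc 1 n, ϱ.q k ≤ ϱ.x k) {β h : ℝ} (hh : 0 ≤ h) (hc : IsCritical β h) :
    EnergiesTendstoPPP.{u} ϱ h (cutConstant (ϱ.toHierarchy hle).tight
      ((ϱ.toHierarchy hle).stepVar (β * h) h) (n + 1)) := by
  intro N hN hblocks Ω _ P _ G hG
  set H := ϱ.toHierarchy hle
  choose d hd using fun α => ϱ.exists_blocks hle (hblocks α)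
  have hv : 0 < 1 + h ^ 2 * (1 - Real.tanh (β * h) ^ 2) := by
    have := one_sub_tanh_sq_pos (β * h)
    positivity
  refine tendstoPPP_pointMeasure P (fun α ω σ => remScalingInv (N α) h (energy (G α) h σ ω))
    (fun α => aemeasurable_pi_lambda _ fun σ => ?_) fun φ => ?_
  · have h1 := (hG α).gaussian.aemeasurable σ
    unfold remScalingInv energy
    fun_prop
  · have hK := (cutConstant_pos (J := H.tight) (V := H.stepVar (β * h) h) (m := n + 1)
      fun k hk => H.stepVar_ne_zero (β * h) h hk).le
    have h1 := H.tendsto_genFun hc hh hN hd φ hv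
    rw [integral_expIntensity hK]
    have h2 : (cutConstant H.tight (H.stepVar (β * h) h) (n + 1) : ℂ) * ∫ y, expDefect φ y =
        ((Real.sqrt (2 * Real.pi * (1 + h ^ 2 * (1 - Real.tanh (β * h) ^ 2))) : ℂ) *
          ∫ y, expDefect φ y) * cutDensity H.tight (H.stepVar (β * h) h) (n + 1) 0 0 := by
      rw [cutConstant, H.coe_tailVar_stepVar]
      push_cast
      ring
    rw [h2]
    refine h1.congr' ?_
    filter_upwards [hN.eventually_gt_atTop 0] with α hα
    exact (integral_prod_exp_energy ϱ hle hc hα (hd α) (hG α) φ).symm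

/-- Since `q` and `x` both end at 1, the slope from `l - 1` exceeds 1 exactly when `q (l - 1) < x (l
- 1)`, and equals 1 exactly on the diagonal. -/
lemma entropyRatio_slope (ϱ : OrderParameter (n + 1)) {h : ℝ} (hh : 0 ≤ h) {l : ℕ}
    (hl : l ∈ Finset.Icc 2 (n + 1)) :
    (entropyRatio ϱ h l < ϱ.slope l (n + 1) → ϱ.q (l - 1) < ϱ.x (l - 1)) ∧
      (entropyRatio ϱ h l = ϱ.slope l (n + 1) → ϱ.q (l - 1) = ϱ.x (l - 1)) := by
  have hl' := Finset.mem_Icc.1 hl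
  have hx := sub_pos.2 (ϱ.x_lt_one (k := l - 1) (by omega))
  have hq := sub_pos.2 (ϱ.q_lt_one (k := l - 1) (by omega))
  have hslope : ϱ.slope l (n + 1) = (1 - ϱ.q (l - 1)) / (1 - ϱ.x (l - 1)) := by
    rw [OrderParameter.slope, ϱ.q_last, ϱ.x_last]
  have hθ : 0 < ϱ.slope l (n + 1) := hslope ▸ div_pos hq hx
  obtain ⟨β, hc⟩ := exists_isCritical h
  obtain ⟨β', hc'⟩ := exists_isCritical ((Real.sqrt (ϱ.slope l (n + 1)))⁻¹ * h)
  have h1 := slope_comparison hh hθ hc hc'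
  rw [← entropyRatio_eq ϱ l hc hc'] at h1
  refine ⟨fun hlt => ?_, fun heq => ?_⟩
  · have h2 := h1.1 hlt
    rw [hslope, lt_div_iff₀ hx] at h2
    linarith
  · have h2 := h1.2 heq
    rw [hslope, div_eq_one_iff_eq hx.ne'] at h2
    linarith

end GREM

end

theorem mainTheorem6 {n : ℕ} (ϱ : GREM.OrderParameter n) (h : ℝ) (hh : 0 ≤ h) :
    ((∀ l ∈ Finset.Icc 2 n, GREM.entropyRatio ϱ h l < ϱ.slope l n) →
      GREM.EnergiesTendstoPPP.{u} ϱ h 1) ∧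
    ((∀ l ∈ Finset.Icc 2 n, GREM.entropyRatio ϱ h l ≤ ϱ.slope l n) →
      (∃ l₀ ∈ Finset.Icc 2 n, GREM.entropyRatio ϱ h l₀ = ϱ.slope l₀ n) →
      ∃ K ∈ Set.Ioo (0 : ℝ) 1, GREM.EnergiesTendstoPPP.{u} ϱ h K) := by
  obtain _ | n := n
  -- There is no order parameter with `n = 0`: it would need `x 0 = 0` and `x 0 = 1`.
  · exact absurd (ϱ.x_zero.symm.trans ϱ.x_last) zero_ne_one
  obtain ⟨β, hc⟩ := GREM.exists_isCritical h
  have hmem : ∀ k ∈ Finset.Icc 1 n, k + 1 ∈ Finset.Icc 2 (n + 1) := fun k hk => by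
    rw [Finset.mem_Icc] at hk ⊢
    omega
  constructor
  · intro hlt
    have hlt' : ∀ k ∈ Finset.Icc 1 n, ϱ.q k < ϱ.x k := fun k hk =>
      (GREM.entropyRatio_slope ϱ hh (hmem k hk)).1 (hlt _ (hmem k hk))
    have hle := fun k hk => (hlt' k hk).le
    have h1 := GREM.energiesTendstoPPP_cutConstant ϱ hle hh hc
    rwa [GREM.cutConstant_eq_one ((ϱ.toHierarchy hle).stepVar_ne_zero _ _ le_rfl)] at h1
    -- Strict inequality everywhere leaves no tight level, so nothing is cut.
    refine Finset.eq_empty_of_forall_notMem fun k hk => ?_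
    have h2 := (ϱ.mem_tight_toHierarchy hle).1 hk
    exact (hlt' k h2.1).ne h2.2
  · rintro hle' ⟨l₀, hl₀, heq⟩
    have hle : ∀ k ∈ Finset.Icc 1 n, ϱ.q k ≤ ϱ.x k := fun k hk => by
      rcases (hle' _ (hmem k hk)).lt_or_eq with h1 | h1
      · exact ((GREM.entropyRatio_slope ϱ hh (hmem k hk)).1 h1).le
      · exact ((GREM.entropyRatio_slope ϱ hh (hmem k hk)).2 h1).le
    have hV := fun k (hk : k ≤ n + 1) => (ϱ.toHierarchy hle).stepVar_ne_zero (β * h) h hk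
    have hl := Finset.mem_Icc.1 hl₀
    -- Equality at `l₀` puts the point `l₀ - 1` on the diagonal. It lies strictly between the root
    -- and the top level, so its cut removes a positive part of the density.
    have htight : l₀ - 1 ∈ (ϱ.toHierarchy hle).tight :=
      (ϱ.mem_tight_toHierarchy hle).2 ⟨Finset.mem_Icc.2 (by omega),
        (GREM.entropyRatio_slope ϱ hh hl₀).2 heq⟩
    exact ⟨_, ⟨GREM.cutConstant_pos hV,
      GREM.cutConstant_lt_one hV htight (by omega) (by omega)⟩,
      GREM.energiesTendstoPPP_cutConstant ϱ hle hh hc⟩
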